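/- **Setting.** Let $\rho:\mathbb R\to[0,1/2]$ be given by $\rho(u-\sin u)=\tfrac12(1-\cos u)$, $u\in\mathbb R$, and for $G\in\mathbb R$ consider on $\{r>0\}$ the Hamiltonian of the restricted isosceles 3-body problem with angular momentum $G$, $$H_G(r,t,y)=\frac{y^2}{2}+V_G(r,t),\qquad V_G(r,t)=\frac{G^2}{2r^2}-\frac{1}{\sqrt{r^2+\rho(t)^2}} .$$ An orbit $(r,y):\mathbb R\to(0,\infty)\times\mathbb R$ of $H_G$ is *homoclinic to* $\gamma_\infty=\{r=\infty,\ y=0\}$ if $r(s)\to\infty$ and $y(s)\to0$ as $s\to\pm\infty$. A *doubly parabolic motion* with angular momentum $G$ is a solution $q:\mathbb R\to\mathbb R^2\setminus\{0\}$ of $\ddot q=-q/(|q|^2+\rho(t)^2)^{3/2}$ with $q_1\dot q_2-q_2\dot q_1=G$, $|q(t)|\to\infty$ and $|\dot q(t)|\to0$ as $t\to\pm\infty$. Fix $G_0>0$ and let $r_0:\mathbb R\to(0,\infty)$ be the parabolic orbit of the 2-body problem with angular momentum $G_0$, given by $r_0(s)=\tfrac{G_0^2}{2}(\tau^2+1)$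 for $s=\tfrac{G_0^3}{2}(\tau+\tfrac{\tau^3}{3})$. Let $D^{1,2}$ be the Hilbert space of continuous $\varphi:\mathbb R\to\mathbb R$ of the form $\varphi(s)=\varphi(0)+\int_0^s\dot\varphi$ with $\dot\varphi\in L^2(\mathbb R)$, with inner product $\varphi(0)\psi(0)+\langle\dot\varphi,\dot\psi\rangle_{L^2}$. For $\varphi\in D^{1,2}$ with $r_0+\varphi>0$ on $\mathbb R$ put $$\mathcal A_G(\varphi)=\int_{\mathbb R}\Big(\frac{\dot\varphi^2}{2}-V_G(r_0+\varphi,s)+\frac{G_0^2}{2r_0^2}-\frac1{r_0}-\ddot r_0\,\varphi\Big)\,ds ,$$ and put $\mathcal A_G(\varphi)=-\infty$ for all other $\varphi\in D^{1,2}$. A critical point of $\mathcal A_G$ is a $\varphi$ with $r_0+\varphi>0$ on $\mathbb R$ at which the Fréchet derivative of $\mathcal A_G$ is $0$. For $M>0$ call $(\psi_1,\psi_2)$ a *mountain-pass pair for $G$ and $M$* if $\psi_i\in D^{1,2}$, $r_0+\psi_i>0$ on $\mathbb R$, $\mathcal A_G(\psi_i)\le -M$ $(i=1,2)$, and every $\gamma\in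 C([0,1],D^{1,2})$ from $\psi_1$ to $\psi_2$ satisfies $\mathcal A_G(\gamma(t))\ge -M/2$ for some $t$. For $\overline m>0$ let $\mathcal F_{\overline m}=\{\varphi\in D^{1,2}:\min_{\mathbb R}(r_0+\varphi)\le\overline m\}$ and $$c_G=c_G(\psi_1,\psi_2,\overline m)=\inf_{\gamma}\ \max\{\mathcal A_G(\gamma(t)):t\in[0,1],\ \gamma(t)\in\mathcal F_{\overline m}\},$$ the infimum being over $\gamma\in C([0,1],D^{1,2})$ with $\gamma(0)=\psi_1$, $\gamma(1)=\psi_2$ (a maximum over the empty set being $-\infty$). **Theorem.** For every $G_0>0$ there are $M^*>0$, $m^*>0$ and a set $J\subset[-G_0,G_0]$ of full measure such that for every $G\in J$: 1. for every $M\ge M^*$ there is a mountain-pass pair for $G$ and $M$; 2. for every $M\ge M^*$, every mountain-pass pair $(\psi_1,\psi_2)$ for $G$ and $M$ and every $\overline m\ge m^*$, the functional $\mathcal A_G$ has a critical point at the level $c_G(\psi_1,\psi_2,\overline m)$; 3. equivalently, $H_G$ has an orbit homoclinic to $\gamma_\infty$: the functions $r$ that belong to an orbit $(r,y)$ of $H_G$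 homoclinic to $\gamma_\infty$ are exactly the functions $r_0+\varphi$ with $\varphi\in D^{1,2}$ a critical point of $\mathcal A_G$; 4. consequently there are an orbit $(r,y)$ of $H_G$ homoclinic to $\gamma_\infty$ and a doubly parabolic motion $q$ with angular momentum $G$ such that $|q(t)|=r(t)$ for all $t$. -/

import Mathlib

open MeasureTheory Set Filter Topology

noncomputable section

namespace RI3BP

/-! ### The primaries and the two-body parabolic orbit -/

/-- Kepler's equation `u ↦ u - sin u` (time as a function of the eccentric anomaly). -/
def keplerTime (u : ℝ) : ℝ := u - Real.sin u

/-- Half of the distance between the primaries at time `t`: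
`ρ (u - sin u) = (1 - cos u) / 2` (see `rho_keplerTime`). -/
def rho (t : ℝ) : ℝ := (1 - Real.cos (Function.invFun keplerTime t)) / 2

/-- Time along the parabolic orbit with angular momentum `G₀`, as a function of the parameter `τ`. -/
def parabolicTime (G₀ τ : ℝ) : ℝ := G₀ ^ 3 / 2 * (τ + τ ^ 3 / 3)

/-- The parabolic (zero energy) orbit `r₀` of the two-body problem with angular momentum `G₀ > 0`,
with pericentre at time `0`:
`r₀ (G₀³/2 (τ + τ³/3)) = G₀² (τ² + 1) / 2` (see `r0_parabolicTime`). -/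
def r0 (G₀ s : ℝ) : ℝ :=
  G₀ ^ 2 * ((Function.invFun (parabolicTime G₀) s) ^ 2 + 1) / 2

theorem keplerTime_injective : Function.Injective keplerTime := by
  intro a b hab
  by_contra hne
  have h1 : Real.sin a - Real.sin b = 2 * Real.sin ((a - b) / 2) * Real.cos ((a + b) / 2) :=
    Real.sin_sub_sin a b
  have h2 : |Real.sin ((a - b) / 2)| < |(a - b) / 2| :=
    Real.abs_sin_lt_abs (by intro h; apply hne; linarith)
  have h3 : |Real.cos ((a + b) / 2)| ≤ 1 := Real.abs_cos_le_one _
  have h4 : a - b = 2 * Real.sin ((a - b) / 2) * Real.cos ((a + b) / 2) := by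
    rw [← h1]; unfold keplerTime at hab; linarith
  have h5 : |(a - b) / 2| = |Real.sin ((a - b) / 2)| * |Real.cos ((a + b) / 2)| := by
    rw [← abs_mul]; congr 1; linarith
  have h6 := mul_le_of_le_one_right (abs_nonneg (Real.sin ((a - b) / 2))) h3
  linarith

theorem rho_keplerTime (u : ℝ) : rho (keplerTime u) = (1 - Real.cos u) / 2 := by
  unfold rho
  rw [Function.leftInverse_invFun keplerTime_injective u]

theorem keplerTime_surjective : Function.Surjective keplerTime := by
  have hc : Continuous keplerTime := by unfold keplerTime; fun_prop
  refine hc.surjective ?_ ?_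
  · refine tendsto_atTop_mono (f := fun u : ℝ => u - 1) (fun u => ?_)
      (tendsto_atTop_add_const_right _ (-1) tendsto_id)
    have := Real.sin_le_one u
    unfold keplerTime; linarith
  · refine tendsto_atBot_mono (f := fun u : ℝ => u + 1) (fun u => ?_)
      (tendsto_atBot_add_const_right _ 1 tendsto_id)
    have := Real.neg_one_le_sin u
    unfold keplerTime; linarith

theorem parabolicTime_strictMono {G₀ : ℝ} (hG : 0 < G₀) : StrictMono (parabolicTime G₀) := by
  have h3 : StrictMono (fun x : ℝ => x ^ 3) := Odd.strictMono_pow (by decide)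
  intro a b hab
  have h := h3 hab
  simp only at h
  unfold parabolicTime
  have : 0 < G₀ ^ 3 / 2 := by positivity
  apply mul_lt_mul_of_pos_left _ this
  linarith

theorem parabolicTime_surjective {G₀ : ℝ} (hG : 0 < G₀) :
    Function.Surjective (parabolicTime G₀) := by
  have hc : Continuous (parabolicTime G₀) := by unfold parabolicTime; fun_prop
  have hpos : 0 < G₀ ^ 3 / 2 := by positivity
  refine hc.surjective ?_ ?_
  · refine tendsto_atTop_mono' _ ?_ (tendsto_id.const_mul_atTop hpos)
    filter_upwards [eventually_ge_atTop 0] with τ hτ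
    have : 0 ≤ τ ^ 3 := by positivity
    unfold parabolicTime
    apply mul_le_mul_of_nonneg_left _ hpos.le
    simp only [id]; linarith
  · refine tendsto_atBot_mono' _ ?_ (tendsto_id.const_mul_atBot hpos)
    filter_upwards [eventually_le_atBot 0] with τ hτ
    have : τ ^ 3 ≤ 0 := Odd.pow_nonpos (by decide) hτ
    unfold parabolicTime
    apply mul_le_mul_of_nonneg_left _ hpos.le
    simp only [id]; linarith

theorem r0_parabolicTime {G₀ : ℝ} (hG : 0 < G₀) (τ : ℝ) :
    r0 G₀ (parabolicTime G₀ τ) = G₀ ^ 2 * (τ ^ 2 + 1) / 2 := by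
  unfold r0
  rw [Function.leftInverse_invFun (parabolicTime_strictMono hG).injective τ]

/-! ### The Hamiltonian system and its homoclinic (doubly parabolic) orbits -/

/-- The effective potential `V_G(r,t) = G²/(2r²) - 1/√(r² + ρ(t)²)`. -/
def effPotential (G r t : ℝ) : ℝ := G ^ 2 / (2 * r ^ 2) - 1 / √(r ^ 2 + rho t ^ 2)

/-- The Hamiltonian `H_G(r,t,y) = y²/2 + V_G(r,t)` of the restricted isosceles 3-body problem. -/
def hamiltonian (G r t y : ℝ) : ℝ := y ^ 2 / 2 + effPotential G r t

/-- `(r, y)` is a complete orbit of `H_G` in `{r > 0}` that is homoclinic to the periodic orbit at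
infinity `γ_∞ = {r = ∞, y = 0}`. -/
structure IsHomoclinicOrbit (G : ℝ) (r y : ℝ → ℝ) : Prop where
  pos : ∀ s, 0 < r s
  hasDerivAt_r : ∀ s, HasDerivAt r (deriv (fun p => hamiltonian G (r s) s p) (y s)) s
  hasDerivAt_y : ∀ s, HasDerivAt y (-deriv (fun x => hamiltonian G x s (y s)) (r s)) s
  r_atTop : Tendsto r atTop atTop
  r_atBot : Tendsto r atBot atTop
  y_atTop : Tendsto y atTop (𝓝 0)
  y_atBot : Tendsto y atBot (𝓝 0)

/-- `q` is a complete motion of the massless body in the plane (Newton's equation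
`q'' = -q / (|q|² + ρ²)^{3/2}`, no collision with the origin), with angular momentum `G`, which is
parabolic both in the past and in the future: `|q| → ∞` and `|q'| → 0` as `t → ± ∞`. -/
structure IsDoublyParabolicMotion (G : ℝ) (q : ℝ → EuclideanSpace ℝ (Fin 2)) : Prop where
  ne_zero : ∀ t, q t ≠ 0
  differentiable : Differentiable ℝ q
  newton : ∀ t, HasDerivAt (deriv q)
    (-((‖q t‖ ^ 2 + rho t ^ 2) ^ (3 / 2 : ℝ))⁻¹ • q t) t
  angularMomentum : ∀ t, q t 0 * deriv q t 1 - q t 1 * deriv q t 0 = G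
  norm_atTop : Tendsto (fun t => ‖q t‖) atTop atTop
  norm_atBot : Tendsto (fun t => ‖q t‖) atBot atTop
  speed_atTop : Tendsto (fun t => ‖deriv q t‖) atTop (𝓝 0)
  speed_atBot : Tendsto (fun t => ‖deriv q t‖) atBot (𝓝 0)

/-! ### The Hilbert space `D^{1,2}` -/

/-- The Hilbert space `D^{1,2}` of continuous functions
`φ(s) = φ(0) + ∫₀ˢ φ'(t) dt` with `φ' ∈ L²(ℝ)`, and inner product
`⟨φ, ψ⟩ = φ(0) ψ(0) + ⟨φ', ψ'⟩_{L²}`. An element is stored as the pair `(φ(0), φ')`, on which this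
inner product is the one of the Hilbert sum `ℝ ⊕ L²(ℝ)`; `D12.range_eval` and `D12.eval_injective`
identify it with the space of functions. -/
abbrev D12 : Type := WithLp 2 (ℝ × Lp ℝ 2 (volume : Measure ℝ))

/-- The weak derivative `φ'` of `φ ∈ D^{1,2}`. -/
def D12.weakDeriv (φ : D12) : Lp ℝ 2 (volume : Measure ℝ) := φ.snd

/-- The value `φ(s)` of `φ ∈ D^{1,2}`. -/
def D12.eval (φ : D12) (s : ℝ) : ℝ := φ.fst + ∫ t in (0 : ℝ)..s, φ.weakDeriv t

theorem D12.intervalIntegrable {v : ℝ → ℝ} (hv : MemLp v 2 (volume : Measure ℝ)) (a b : ℝ) :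
    IntervalIntegrable v volume a b := by
  rw [intervalIntegrable_iff]
  have h := hv.restrict (Set.uIoc a b)
  have : IsFiniteMeasure ((volume : Measure ℝ).restrict (Set.uIoc a b)) :=
    ⟨by rw [Measure.restrict_apply_univ, Set.uIoc]; exact measure_Ioc_lt_top⟩
  exact h.integrable (by norm_num)

theorem D12.eval_zero (φ : D12) : φ.eval 0 = φ.fst := by simp [D12.eval]

theorem D12.range_eval : Set.range D12.eval = {f : ℝ → ℝ | Continuous f ∧
    ∃ v : ℝ → ℝ, MemLp v 2 (volume : Measure ℝ) ∧
      ∀ s, f s = f 0 + ∫ t in (0 : ℝ)..s, v t} := by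
  ext f
  constructor
  · rintro ⟨φ, rfl⟩
    have hm : MemLp (φ.weakDeriv : ℝ → ℝ) 2 volume := Lp.memLp _
    refine ⟨?_, φ.weakDeriv, hm, fun s => by rw [D12.eval_zero]; rfl⟩
    exact continuous_const.add
      (intervalIntegral.continuous_primitive (fun a b => D12.intervalIntegrable hm a b) 0)
  · rintro ⟨-, v, hv, hf⟩
    refine ⟨WithLp.toLp 2 (f 0, hv.toLp v), funext fun s => ?_⟩
    rw [hf s]
    unfold D12.eval D12.weakDeriv
    congr 1
    exact intervalIntegral.integral_congr_ae
      (by filter_upwards [hv.coeFn_toLp] with t ht _ using ht)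

theorem D12.eval_injective : Function.Injective D12.eval := by
  intro φ ψ h
  have h0 : φ.fst = ψ.fst := by rw [← D12.eval_zero, ← D12.eval_zero, h]
  have hi : ∀ s : ℝ, ∫ t in (0 : ℝ)..s, φ.weakDeriv t = ∫ t in (0 : ℝ)..s, ψ.weakDeriv t := by
    intro s
    have := congrFun h s
    unfold D12.eval at this
    linarith
  have hφ : LocallyIntegrable (φ.weakDeriv : ℝ → ℝ) volume :=
    (Lp.memLp φ.weakDeriv).locallyIntegrable (by norm_num)
  have hψ : LocallyIntegrable (ψ.weakDeriv : ℝ → ℝ) volume :=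
    (Lp.memLp ψ.weakDeriv).locallyIntegrable (by norm_num)
  have hae : (φ.weakDeriv : ℝ → ℝ) =ᵐ[volume] ψ.weakDeriv := by
    filter_upwards [_root_.LocallyIntegrable.ae_hasDerivAt_integral hφ,
      _root_.LocallyIntegrable.ae_hasDerivAt_integral hψ] with x hx hy
    exact (hx 0).unique ((funext hi : (fun s => ∫ t in (0 : ℝ)..s, φ.weakDeriv t) = _) ▸ hy 0)
  have h1 : φ.weakDeriv = ψ.weakDeriv := Lp.ext hae
  apply WithLp.ofLp_injective
  exact Prod.ext h0 h1

/-! ### The renormalized action functional -/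

/-- The radius `r(s) = r₀(s) + φ(s)` associated with `φ ∈ D^{1,2}`. -/
def radius (G₀ : ℝ) (φ : D12) (s : ℝ) : ℝ := r0 G₀ s + φ.eval s

/-- `r₀ + φ` stays away from collision. -/
def NoCollision (G₀ : ℝ) (φ : D12) : Prop := ∀ s, 0 < radius G₀ φ s

/-- The renormalized Lagrangian along `φ`:
`φ'²/2 - V_G(r₀ + φ, s) + V₀(r₀) - r₀'' φ`, where `V₀(r₀) = G₀²/(2r₀²) - 1/r₀`. -/
def renLagrangian (G₀ G : ℝ) (φ : D12) (s : ℝ) : ℝ :=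
  (φ.weakDeriv s) ^ 2 / 2 - effPotential G (radius G₀ φ s) s
    + (G₀ ^ 2 / (2 * r0 G₀ s ^ 2) - 1 / r0 G₀ s)
    - deriv (deriv (r0 G₀)) s * φ.eval s

/-- The renormalized action `𝒜_G(φ) = ∫_ℝ L_ren`, meaningful (a convergent integral) for `φ` without
collisions. -/
def action (G₀ G : ℝ) (φ : D12) : ℝ := ∫ s, renLagrangian G₀ G φ s

open Classical in
/-- The action as an extended real number. If `r₀ + φ` vanishes somewhere then (for `G ≠ 0`) the
integral of the action diverges to `-∞`, because `∫ (r₀ + φ)⁻² = +∞`. -/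
def extAction (G₀ G : ℝ) (φ : D12) : EReal :=
  if NoCollision G₀ φ then (action G₀ G φ : EReal) else ⊥

/-- Critical points of `𝒜_G` on `D^{1,2}`: the action, which is finite near a `φ` without
collisions, has vanishing Fréchet derivative at `φ`. -/
def IsCriticalPoint (G₀ G : ℝ) (φ : D12) : Prop :=
  NoCollision G₀ φ ∧ HasFDerivAt (action G₀ G) (0 : D12 →L[ℝ] ℝ) φ

/-! ### The constrained mountain-pass level -/

/-- `ψ₁, ψ₂` are end points for the mountain-pass geometry of `𝒜_G` with constant `M`: the action is
at most `-M` at both, and on every curve joining them it reaches at least `-M/2`. -/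
structure IsMountainPassPair (G₀ G M : ℝ) (ψ₁ ψ₂ : D12) : Prop where
  noCollision₁ : NoCollision G₀ ψ₁
  noCollision₂ : NoCollision G₀ ψ₂
  low₁ : action G₀ G ψ₁ ≤ -M
  low₂ : action G₀ G ψ₂ ≤ -M
  pass : ∀ γ : Path ψ₁ ψ₂, ∃ t, ((-M / 2 : ℝ) : EReal) ≤ extAction G₀ G (γ t)

/-- The constraint set `{φ ∈ D^{1,2} : min (r₀ + φ) ≤ m}`. -/
def constraintSet (G₀ m : ℝ) : Set D12 := {φ | ∃ s, radius G₀ φ s ≤ m}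

/-- The constrained mountain-pass level
`c_G = inf_γ max {𝒜_G(γ(t)) : γ(t) ∈ F_m, t ∈ [0,1]}`, the infimum being over the curves in
`D^{1,2}` from `ψ₁` to `ψ₂`. -/
def mountainPassLevel (G₀ G m : ℝ) (ψ₁ ψ₂ : D12) : EReal :=
  ⨅ γ : Path ψ₁ ψ₂, ⨆ t : {t : unitInterval // γ t ∈ constraintSet G₀ m}, extAction G₀ G (γ t)

end RI3BP

end

open RI3BP

noncomputable section

namespace RI3BP

/-! The critical points are found by a mountain-pass argument for `action`, made compact by Struwe's
monotonicity trick in the parameter `G`.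

Functional setting. The parabolic orbit grows like `|s|^(2/3)`, so `1/r₀²` is integrable and `1/r₀³`
is a Hardy weight. Once the zeroth and first order parts along `r₀` are subtracted, the potential is
bounded by multiples of `1/r₀²` and `φ²/r₀³` (`abs_potDiff_le`), and the action is differentiable on
the open set of collision-free `φ` (`exists_action_taylor`, `exists_hasFDerivAt_action`).

Geometry. The action tends to `-∞` in two ways. Near a collision, functions in `D^{1,2}` being
Hölder of exponent 1/2, the integral of `1/r²` diverges logarithmically (`log_le_invSq`). When large
constants are added to `φ`, the integral of `1/r`, which is infinite, is lost
(`exists_action_add_const_le`). In between, where `min r` equals a suitable `m`, convexity of the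
Newtonian potential bounds the action from below (`exists_barrier`).

Compactness fails for three reasons. Translations by the period of the primaries leave the action
invariant; they are used to bring the close approach into `[0, 2π]` (`exists_translate`,
`exists_normalize`). The radius may escape to infinity; but far out adding constants lowers the
action, so the part of a path outside the constraint set can be pushed below any level, and the
constrained and unconstrained levels agree (`exists_path_lt`, `mountainPassLevel_eq`). Finally
`invSq`, the integral of `1/r²`, may be unbounded. The action is affine in `G²` with slope
`-invSq/2`, so the level is monotone in `|G|` and differentiable almost everywhere. Where it is,
paths nearly optimal for a slightly smaller momentum have bounded `invSq` wherever the action is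
near the level. If the level were not critical, such a path could be deformed below it
(`exists_deformation`, `exists_criticalPoint_of_differentiableAt`); the descent directions come from
compactness of Palais-Smale sequences with bounded `invSq` (`exists_descent`). A countable dense set
of end points yields one full-measure set for all pairs.

Homoclinic orbits. A critical point solves the Euler-Lagrange equation by du Bois-Reymond, and its
velocity decays because it and its derivative are square integrable. Conversely, monotonicity of the
force at infinity shows that a homoclinic orbit differs from `r₀` by a function of finite energy
(`integrableOn_sq_of_mul_le`). The planar motion is recovered by integrating `θ' = G/r²`. -/

theorem continuous_invFun_of_strictMono {f : ℝ → ℝ} (hf : StrictMono f)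
    (hs : Function.Surjective f) : Continuous (Function.invFun f) := by
  have h : Function.invFun f = (hf.orderIsoOfSurjective f hs).symm := by
    funext x
    apply hf.injective
    rw [Function.rightInverse_invFun hs x]
    exact ((hf.orderIsoOfSurjective f hs).apply_symm_apply x).symm
  rw [h]
  exact (hf.orderIsoOfSurjective f hs).symm.continuous

/-! ### The distance of the primaries -/

theorem keplerTime_strictMono : StrictMono keplerTime := by
  have hc : Continuous keplerTime := by unfold keplerTime; fun_prop
  rcases hc.strictMono_of_inj keplerTime_injective with h | h
  · exact h
  · exfalso
    have h1 := h (show (0 : ℝ) < Real.pi from Real.pi_pos)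
    simp only [keplerTime, Real.sin_pi, Real.sin_zero] at h1
    linarith [Real.pi_pos]

theorem continuous_rho : Continuous rho := by
  have := continuous_invFun_of_strictMono keplerTime_strictMono keplerTime_surjective
  unfold rho
  fun_prop

theorem rho_nonneg (t : ℝ) : 0 ≤ rho t := by
  unfold rho
  linarith [Real.cos_le_one (Function.invFun keplerTime t)]

theorem rho_le_one (t : ℝ) : rho t ≤ 1 := by
  unfold rho
  linarith [Real.neg_one_le_cos (Function.invFun keplerTime t)]

/-- The period of the primaries is the source of the translation symmetry of the action. -/
theorem rho_add_two_pi_mul_int (t : ℝ) (k : ℤ) : rho (t + k * (2 * Real.pi)) = rho t := by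
  obtain ⟨u, rfl⟩ := keplerTime_surjective t
  have : keplerTime u + k * (2 * Real.pi) = keplerTime (u + k * (2 * Real.pi)) := by
    simp only [keplerTime, Real.sin_add_int_mul_two_pi]; ring
  rw [this, rho_keplerTime, rho_keplerTime, Real.cos_add_int_mul_two_pi]

/-! ### The parabolic orbit -/

/-- The parameter `τ` of the parabolic orbit as a function of time. -/
def parabolicParam (G₀ s : ℝ) : ℝ := Function.invFun (parabolicTime G₀) s

theorem r0_eq (G₀ s : ℝ) : r0 G₀ s = G₀ ^ 2 * (parabolicParam G₀ s ^ 2 + 1) / 2 := rfl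

theorem parabolicTime_param {G₀ : ℝ} (hG₀ : 0 < G₀) (s : ℝ) : parabolicTime G₀ (parabolicParam G₀ s) = s :=
  Function.rightInverse_invFun (parabolicTime_surjective hG₀) s

theorem continuous_parabolicParam {G₀ : ℝ} (hG₀ : 0 < G₀) : Continuous (parabolicParam G₀) :=
  continuous_invFun_of_strictMono (parabolicTime_strictMono hG₀) (parabolicTime_surjective hG₀)

theorem hasDerivAt_parabolicParam {G₀ : ℝ} (hG₀ : 0 < G₀) (s : ℝ) :
    HasDerivAt (parabolicParam G₀) (2 / (G₀ ^ 3 * (1 + parabolicParam G₀ s ^ 2))) s := by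
  have h1 : HasDerivAt (parabolicTime G₀) (G₀ ^ 3 / 2 * (1 + parabolicParam G₀ s ^ 2))
      (parabolicParam G₀ s) := by
    unfold parabolicTime
    have := ((hasDerivAt_id (parabolicParam G₀ s)).add
      (((hasDerivAt_id (parabolicParam G₀ s)).pow 3).div_const 3)).const_mul (G₀ ^ 3 / 2)
    convert! this using 1
    simp
  have h2 := h1.of_local_left_inverse (continuous_parabolicParam hG₀).continuousAt
    (by positivity) (Eventually.of_forall (parabolicTime_param hG₀))
  convert! h2 using 1
  field_simp

/-- The radial velocity of the parabolic orbit. -/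
theorem hasDerivAt_r0 {G₀ : ℝ} (hG₀ : 0 < G₀) (s : ℝ) :
    HasDerivAt (r0 G₀) (2 / G₀ * (parabolicParam G₀ s / (1 + parabolicParam G₀ s ^ 2))) s := by
  have h := ((((hasDerivAt_parabolicParam hG₀ s).pow 2).add_const 1).const_mul (G₀ ^ 2)).div_const 2
  have e : r0 G₀ = fun s => G₀ ^ 2 * (parabolicParam G₀ s ^ 2 + 1) / 2 := rfl
  rw [e]
  convert! h using 1
  simp
  field_simp

theorem deriv_r0 {G₀ : ℝ} (hG₀ : 0 < G₀) : deriv (r0 G₀) =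
    fun s => 2 / G₀ * (parabolicParam G₀ s / (1 + parabolicParam G₀ s ^ 2)) :=
  funext fun s => (hasDerivAt_r0 hG₀ s).deriv

theorem r0_pos {G₀ : ℝ} (hG₀ : 0 < G₀) (s : ℝ) : 0 < r0 G₀ s := by rw [r0_eq]; positivity

theorem hasDerivAt_deriv_r0 {G₀ : ℝ} (hG₀ : 0 < G₀) (s : ℝ) :
    HasDerivAt (deriv (r0 G₀)) (G₀ ^ 2 / r0 G₀ s ^ 3 - 1 / r0 G₀ s ^ 2) s := by
  rw [deriv_r0 hG₀]
  have h := hasDerivAt_parabolicParam hG₀ s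
  have hne : 1 + parabolicParam G₀ s ^ 2 ≠ 0 := by positivity
  have := (h.div ((h.pow 2).const_add 1) hne).const_mul (2 / G₀)
  convert! this using 1
  rw [r0_eq]
  simp
  field_simp
  ring

theorem deriv_deriv_r0 {G₀ : ℝ} (hG₀ : 0 < G₀) (s : ℝ) :
    deriv (deriv (r0 G₀)) s = G₀ ^ 2 / r0 G₀ s ^ 3 - 1 / r0 G₀ s ^ 2 :=
  (hasDerivAt_deriv_r0 hG₀ s).deriv

theorem continuous_r0 {G₀ : ℝ} (hG₀ : 0 < G₀) : Continuous (r0 G₀) :=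
  continuous_iff_continuousAt.2 fun s => (hasDerivAt_r0 hG₀ s).continuousAt

theorem continuous_deriv_r0 {G₀ : ℝ} (hG₀ : 0 < G₀) : Continuous (deriv (r0 G₀)) :=
  continuous_iff_continuousAt.2 fun s => (hasDerivAt_deriv_r0 hG₀ s).continuousAt

theorem half_sq_le_r0 (G₀ : ℝ) (s : ℝ) : G₀ ^ 2 / 2 ≤ r0 G₀ s := by
  rw [r0_eq]; nlinarith [sq_nonneg (G₀ * parabolicParam G₀ s)]

/-- The growth `r₀ ≳ |s|^(2/3)`. In the parameter `τ` both sides are polynomials in `τ²`, compared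
coefficientwise. -/
theorem sq_le_two_mul_r0_cube {G₀ : ℝ} (hG₀ : 0 < G₀) (s : ℝ) : s ^ 2 ≤ 2 * r0 G₀ s ^ 3 := by
  conv_lhs => rw [← parabolicTime_param hG₀ s]
  rw [r0_eq, parabolicTime]
  set τ := parabolicParam G₀ s
  have : (τ + τ ^ 3 / 3) ^ 2 ≤ (τ ^ 2 + 1) ^ 3 := by
    have h1 : 0 ≤ τ ^ 2 := sq_nonneg _
    have : (τ + τ ^ 3 / 3) ^ 2 = τ^2 + 2/3 * (τ^2)^2 + 1/9 * (τ^2)^3 := by ring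
    rw [this]
    nlinarith [pow_nonneg h1 2, pow_nonneg h1 3]
  calc (G₀ ^ 3 / 2 * (τ + τ ^ 3 / 3)) ^ 2 = G₀ ^ 6 / 4 * (τ + τ ^ 3 / 3) ^ 2 := by ring
    _ ≤ G₀ ^ 6 / 4 * (τ ^ 2 + 1) ^ 3 := by gcongr
    _ = _ := by ring

/-- Conservation of the (zero) energy. -/
theorem deriv_r0_sq {G₀ : ℝ} (hG₀ : 0 < G₀) (s : ℝ) :
    deriv (r0 G₀) s ^ 2 = 2 / r0 G₀ s - G₀ ^ 2 / r0 G₀ s ^ 2 := by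
  rw [deriv_r0 hG₀, r0_eq]
  field_simp
  ring

theorem abs_deriv_r0_le {G₀ : ℝ} (hG₀ : 0 < G₀) (s : ℝ) : |deriv (r0 G₀) s| ≤ 2 / G₀ := by
  rw [deriv_r0 hG₀, abs_mul, abs_of_pos (by positivity : 0 < 2 / G₀)]
  refine mul_le_of_le_one_right (by positivity) ?_
  rw [abs_div, abs_of_pos (by positivity : 0 < 1 + parabolicParam G₀ s ^ 2),
    div_le_one (by positivity)]
  nlinarith [sq_nonneg (|parabolicParam G₀ s| - 1), sq_abs (parabolicParam G₀ s)]

theorem abs_r0_sub_le {G₀ : ℝ} (hG₀ : 0 < G₀) (s t : ℝ) : |r0 G₀ s - r0 G₀ t| ≤ 2 / G₀ * |s - t| := by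
  have := Convex.norm_image_sub_le_of_norm_hasDerivWithin_le (f := r0 G₀) (s := univ)
    (C := 2 / G₀) (fun x _ => (hasDerivAt_r0 hG₀ x).hasDerivWithinAt)
    (fun x _ => by rw [← (hasDerivAt_r0 hG₀ x).deriv]; exact abs_deriv_r0_le hG₀ x)
    convex_univ (mem_univ t) (mem_univ s)
  simpa using this

theorem tendsto_r0_of_abs {G₀ : ℝ} (hG₀ : 0 < G₀) {l : Filter ℝ} (hl : Tendsto (fun s : ℝ => |s|) l atTop) :
    Tendsto (r0 G₀) l atTop := by
  have h3 : Tendsto (fun s => r0 G₀ s ^ 3) l atTop := by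
    have : Tendsto (fun s : ℝ => |s| ^ 2 / 2) l atTop :=
      ((tendsto_pow_atTop (by norm_num)).comp hl).atTop_div_const (by norm_num)
    refine tendsto_atTop_mono (fun s => ?_) this
    rw [sq_abs]; linarith [sq_le_two_mul_r0_cube hG₀ s]
  rw [tendsto_atTop] at h3 ⊢
  intro b
  filter_upwards [h3 (|b| ^ 3)] with s hs
  exact (le_abs_self b).trans (le_of_pow_le_pow_left₀ (by norm_num) (r0_pos hG₀ s).le hs)

theorem tendsto_r0_atTop {G₀ : ℝ} (hG₀ : 0 < G₀) : Tendsto (r0 G₀) atTop atTop :=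
  tendsto_r0_of_abs hG₀ tendsto_abs_atTop_atTop

theorem tendsto_r0_atBot {G₀ : ℝ} (hG₀ : 0 < G₀) : Tendsto (r0 G₀) atBot atTop :=
  tendsto_r0_of_abs hG₀ tendsto_abs_atBot_atTop

theorem tendsto_deriv_r0_of_abs {G₀ : ℝ} (hG₀ : 0 < G₀) {l : Filter ℝ} (hl : Tendsto (fun s : ℝ => |s|) l atTop) :
    Tendsto (deriv (r0 G₀)) l (𝓝 0) := by
  have h := tendsto_r0_of_abs hG₀ hl
  have h2 : Tendsto (fun s => deriv (r0 G₀) s ^ 2) l (𝓝 0) := by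
    have : Tendsto (fun s => 2 / r0 G₀ s - G₀ ^ 2 / r0 G₀ s ^ 2) l (𝓝 (0 - 0)) :=
      (h.const_div_atTop 2).sub (((tendsto_pow_atTop (by norm_num)).comp h).const_div_atTop _)
    rw [sub_zero] at this
    exact this.congr fun s => (deriv_r0_sq hG₀ s).symm
  rw [tendsto_zero_iff_abs_tendsto_zero]
  have := (Real.continuous_sqrt.tendsto 0).comp h2
  simpa [Function.comp_def, Real.sqrt_sq_eq_abs] using this

/-- In the parameter `τ` the integrand becomes a multiple of `1/(1+τ²)`, so the primitive is a
bounded arctangent. -/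
theorem integrable_inv_r0_sq {G₀ : ℝ} (hG₀ : 0 < G₀) : Integrable (fun s => 1 / r0 G₀ s ^ 2) := by
  have hder : ∀ s, HasDerivAt (fun s => 2 / G₀ * Real.arctan (parabolicParam G₀ s))
      (1 / r0 G₀ s ^ 2) s := by
    intro s
    have := ((hasDerivAt_parabolicParam hG₀ s).arctan).const_mul (2 / G₀)
    convert! this using 1
    rw [r0_eq]
    field_simp
    ring
  have hmono : StrictMono (parabolicParam G₀) := by
    intro a b hab
    rw [← (parabolicTime_strictMono hG₀).lt_iff_lt, parabolicTime_param hG₀,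
      parabolicTime_param hG₀]
    exact hab
  have hcont : Continuous fun s => 1 / r0 G₀ s ^ 2 :=
    continuous_const.div ((continuous_r0 hG₀).pow 2) fun s => by
      have := r0_pos hG₀ s; positivity
  refine integrable_of_intervalIntegral_norm_bounded (a := fun n : ℕ => -(n : ℝ))
    (b := fun n : ℕ => (n : ℝ)) (l := atTop) (2 / G₀ * Real.pi)
    (fun n => (hcont.integrableOn_Icc).mono_set Ioc_subset_Icc_self)
    (tendsto_neg_atTop_atBot.comp tendsto_natCast_atTop_atTop) tendsto_natCast_atTop_atTop
    (Eventually.of_forall fun n => ?_)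
  have e : ∀ s, ‖1 / r0 G₀ s ^ 2‖ = 1 / r0 G₀ s ^ 2 := fun s =>
    Real.norm_of_nonneg (by positivity)
  simp only [e]
  rw [intervalIntegral.integral_eq_sub_of_hasDerivAt (fun s _ => hder s)
    (hcont.intervalIntegrable _ _), ← mul_sub]
  gcongr
  linarith [Real.arctan_lt_pi_div_two (parabolicParam G₀ n),
    Real.neg_pi_div_two_lt_arctan (parabolicParam G₀ (-n))]

/-- An integrable bound transfers: every measurable function that is `O(1/r₀²)` is integrable. -/
theorem integrable_of_le_inv_r0_sq {G₀ : ℝ} (hG₀ : 0 < G₀) {f : ℝ → ℝ} (hf : AEStronglyMeasurable f volume) (C : ℝ)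
    (h : ∀ s, |f s| ≤ C / r0 G₀ s ^ 2) : Integrable f :=
  ((integrable_inv_r0_sq hG₀).const_mul C).mono' hf
    (Eventually.of_forall fun s => by rw [Real.norm_eq_abs, mul_one_div]; exact h s)

theorem inv_r0_cube_le {G₀ : ℝ} (hG₀ : 0 < G₀) (s : ℝ) : 1 / r0 G₀ s ^ 3 ≤ 2 / G₀ ^ 2 * (1 / r0 G₀ s ^ 2) := by
  have h1 := half_sq_le_r0 G₀ s
  have h2 := r0_pos hG₀ s
  rw [div_mul_div_comm, div_le_div_iff₀ (by positivity) (by positivity)]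
  have : 0 < r0 G₀ s ^ 2 := by positivity
  nlinarith

theorem abs_deriv_deriv_r0_le {G₀ : ℝ} (hG₀ : 0 < G₀) (s : ℝ) : |deriv (deriv (r0 G₀)) s| ≤ 3 / r0 G₀ s ^ 2 := by
  rw [deriv_deriv_r0 hG₀]
  have h1 := inv_r0_cube_le hG₀ s
  have h2 := r0_pos hG₀ s
  have h3 : G₀ ^ 2 / r0 G₀ s ^ 3 ≤ 2 * (1 / r0 G₀ s ^ 2) := by
    calc G₀ ^ 2 / r0 G₀ s ^ 3 = G₀ ^ 2 * (1 / r0 G₀ s ^ 3) := by ring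
      _ ≤ G₀ ^ 2 * (2 / G₀ ^ 2 * (1 / r0 G₀ s ^ 2)) := by gcongr
      _ = _ := by field_simp
  have h4 : 0 ≤ G₀ ^ 2 / r0 G₀ s ^ 3 := by positivity
  have h5 : 0 ≤ 1 / r0 G₀ s ^ 2 := by positivity
  have h6 : 3 / r0 G₀ s ^ 2 = 3 * (1 / r0 G₀ s ^ 2) := by ring
  rw [h6, abs_le]
  constructor <;> linarith

theorem continuous_deriv_deriv_r0 {G₀ : ℝ} (hG₀ : 0 < G₀) : Continuous (deriv (deriv (r0 G₀))) := by
  rw [funext (deriv_deriv_r0 hG₀)]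
  have h : ∀ s, r0 G₀ s ≠ 0 := fun s => (r0_pos hG₀ s).ne'
  have := continuous_r0 hG₀
  fun_prop (disch := intro s; exact pow_ne_zero _ (h s))

theorem integrable_deriv_deriv_r0 {G₀ : ℝ} (hG₀ : 0 < G₀) : Integrable (deriv (deriv (r0 G₀))) :=
  integrable_of_le_inv_r0_sq hG₀ (continuous_deriv_deriv_r0 hG₀).aestronglyMeasurable 3
    (abs_deriv_deriv_r0_le hG₀)

/-- The velocity vanishes at both ends. Hence the term `-r₀'' φ` of the action does not change when
a constant is added to `φ`. -/
theorem integral_deriv_deriv_r0 {G₀ : ℝ} (hG₀ : 0 < G₀) : ∫ s, deriv (deriv (r0 G₀)) s = 0 := by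
  have := integral_of_hasDerivAt_of_tendsto
    (fun s => (hasDerivAt_deriv_r0 hG₀ s).differentiableAt.hasDerivAt)
    (integrable_deriv_deriv_r0 hG₀)
    (tendsto_deriv_r0_of_abs hG₀ tendsto_abs_atBot_atTop)
    (tendsto_deriv_r0_of_abs hG₀ tendsto_abs_atTop_atTop)
  simpa using this

/-! ### The potential as a function of the radius -/

/-- The opposite of the effective potential, `1/√(x² + p²) - g/(2x²)`, with `g = G²` and `p = ρ(t)`
as parameters. -/
def pot (g p x : ℝ) : ℝ := 1 / √(x ^ 2 + p ^ 2) - g / (2 * x ^ 2)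

/-- The radial force, the derivative of `pot g p`. -/
def force (g p x : ℝ) : ℝ := g / x ^ 3 - x / √(x ^ 2 + p ^ 2) ^ 3

theorem effPotential_eq (G r t : ℝ) : effPotential G r t = -pot (G ^ 2) (rho t) r := by
  unfold effPotential pot; ring

theorem le_sqrt_sq_add {x : ℝ} (hx : 0 < x) (p : ℝ) : x ≤ √(x ^ 2 + p ^ 2) :=
  Real.le_sqrt_of_sq_le (by nlinarith [sq_nonneg p])

theorem sqrt_sq_add_le {x p : ℝ} (hx : 0 < x) (hp : 0 ≤ p) : √(x ^ 2 + p ^ 2) ≤ x + p :=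
  Real.sqrt_le_iff.2 ⟨by positivity, by nlinarith⟩

theorem hasDerivAt_sqrt_sq_add {x : ℝ} (hx : 0 < x) (p : ℝ) :
    HasDerivAt (fun x => √(x ^ 2 + p ^ 2)) (x / √(x ^ 2 + p ^ 2)) x := by
  have h := (((hasDerivAt_id' x).fun_pow 2).add_const (p ^ 2)).sqrt
    (by positivity)
  convert! h using 1
  simp
  field_simp

theorem hasDerivAt_pot (g p : ℝ) {x : ℝ} (hx : 0 < x) :
    HasDerivAt (pot g p) (force g p x) x := by
  have hq : 0 < √(x ^ 2 + p ^ 2) := hx.trans_le (le_sqrt_sq_add hx p)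
  have h1 := (hasDerivAt_const x (1 : ℝ)).div (hasDerivAt_sqrt_sq_add hx p) hq.ne'
  have h2 := (hasDerivAt_const x g).div (((hasDerivAt_id' x).fun_pow 2).const_mul 2)
    (by positivity)
  have h := h1.sub h2
  convert! h using 1
  unfold force
  simp
  field_simp
  ring

theorem hasDerivAt_force (g p : ℝ) {x : ℝ} (hx : 0 < x) :
    HasDerivAt (force g p)
      ((2 * x ^ 2 - p ^ 2) / √(x ^ 2 + p ^ 2) ^ 5 - 3 * g / x ^ 4) x := by
  have hq : 0 < √(x ^ 2 + p ^ 2) := hx.trans_le (le_sqrt_sq_add hx p)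
  have h1 := (hasDerivAt_id' x).div ((hasDerivAt_sqrt_sq_add hx p).fun_pow 3) (by positivity)
  have h2 := (hasDerivAt_const x g).div ((hasDerivAt_id' x).fun_pow 3) (by positivity)
  have h := h2.sub h1
  convert! h using 1
  have hs : √(x ^ 2 + p ^ 2) ^ 2 = x ^ 2 + p ^ 2 := Real.sq_sqrt (by positivity)
  have : 2 * x ^ 2 - p ^ 2 = 3 * x ^ 2 - √(x ^ 2 + p ^ 2) ^ 2 := by linarith
  rw [this]
  simp
  field_simp
  ring

theorem abs_deriv_force_le {g p x a : ℝ} (hg : 0 ≤ g) (ha : 0 < a) (hx : a ≤ x) :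
    |(2 * x ^ 2 - p ^ 2) / √(x ^ 2 + p ^ 2) ^ 5 - 3 * g / x ^ 4|
      ≤ 2 / a ^ 3 + 3 * g / a ^ 4 := by
  have hx0 : 0 < x := ha.trans_le hx
  have hq := le_sqrt_sq_add hx0 p
  have hq0 : 0 < √(x ^ 2 + p ^ 2) := hx0.trans_le hq
  have hs : √(x ^ 2 + p ^ 2) ^ 2 = x ^ 2 + p ^ 2 := Real.sq_sqrt (by positivity)
  set q := √(x ^ 2 + p ^ 2)
  have h1 : |(2 * x ^ 2 - p ^ 2) / q ^ 5| ≤ 2 / a ^ 3 := by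
    rw [abs_div, abs_of_pos (by positivity : 0 < q ^ 5)]
    calc |2 * x ^ 2 - p ^ 2| / q ^ 5 ≤ 2 * q ^ 2 / q ^ 5 := by
          gcongr
          rw [hs, abs_le]; constructor <;> nlinarith [sq_nonneg p, sq_nonneg x]
      _ = 2 / q ^ 3 := by field_simp
      _ ≤ 2 / a ^ 3 := by gcongr; exact hx.trans hq
  have h2 : |3 * g / x ^ 4| ≤ 3 * g / a ^ 4 := by
    rw [abs_of_nonneg (by positivity)]; gcongr
  exact (abs_sub _ _).trans (add_le_add h1 h2)

theorem abs_force_sub_le {g p x y a : ℝ} (hg : 0 ≤ g) (ha : 0 < a) (hx : a ≤ x) (hy : a ≤ y) :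
    |force g p y - force g p x| ≤ (2 / a ^ 3 + 3 * g / a ^ 4) * |y - x| :=
  Convex.norm_image_sub_le_of_norm_hasDerivWithin_le (f := force g p) (s := Ici a)
    (fun z hz => (hasDerivAt_force g p (ha.trans_le hz)).hasDerivWithinAt)
    (fun _ hz => abs_deriv_force_le hg ha hz) (convex_Ici a) hx hy

/-- Taylor's formula of order two for the potential. -/
theorem abs_pot_taylor_le {g p x y a : ℝ} (hg : 0 ≤ g) (ha : 0 < a) (hx : a ≤ x) (hy : a ≤ y) :
    |pot g p y - pot g p x - force g p x * (y - x)| ≤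
      (2 / a ^ 3 + 3 * g / a ^ 4) * (y - x) ^ 2 := by
  have hsub : uIcc x y ⊆ Ici a := fun z hz => (le_min hx hy).trans hz.1
  have h := Convex.norm_image_sub_le_of_norm_hasDerivWithin_le
    (f := fun z => pot g p z - force g p x * z) (s := uIcc x y)
    (f' := fun z => force g p z - force g p x * 1)
    (C := (2 / a ^ 3 + 3 * g / a ^ 4) * |y - x|)
    (fun z hz => ((hasDerivAt_pot g p (ha.trans_le (hsub hz))).sub
      ((hasDerivAt_id z).const_mul _)).hasDerivWithinAt)
    (fun z hz => by
      rw [mul_one, Real.norm_eq_abs]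
      refine (abs_force_sub_le hg ha hx (hsub hz)).trans ?_
      gcongr ?_ * ?_
      exact abs_sub_left_of_mem_uIcc hz)
    (convex_uIcc x y) left_mem_uIcc right_mem_uIcc
  rw [Real.norm_eq_abs, Real.norm_eq_abs, mul_assoc, abs_mul_abs_self, ← sq] at h
  convert! h using 2
  ring

/-- Beyond the radius `1 + 4g` attraction dominates: there the root is at most `3x/2`, and `(3/2)³ <
4`. This is the threshold required of the constraint level. -/
theorem force_nonpos {g p x : ℝ} (hg : 0 ≤ g) (hp : p ^ 2 ≤ 1) (hx : 1 + 4 * g ≤ x) :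
    force g p x ≤ 0 := by
  have hx1 : 1 ≤ x := by linarith
  have hx0 : 0 < x := by linarith
  have hq := le_sqrt_sq_add hx0 p
  have hq0 : 0 < √(x ^ 2 + p ^ 2) := hx0.trans_le hq
  have hs : √(x ^ 2 + p ^ 2) ^ 2 = x ^ 2 + p ^ 2 := Real.sq_sqrt (by positivity)
  have hq2 : √(x ^ 2 + p ^ 2) ≤ 3 / 2 * x := by
    refine Real.sqrt_le_iff.2 ⟨by positivity, by nlinarith⟩
  unfold force
  set q := √(x ^ 2 + p ^ 2)
  rw [sub_nonpos, div_le_div_iff₀ (by positivity) (by positivity)]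
  calc g * q ^ 3 ≤ g * (3 / 2 * x) ^ 3 := by gcongr
    _ = (27 / 8 * g) * x ^ 3 := by ring
    _ ≤ x * x ^ 3 := by gcongr; linarith

theorem pot_antitoneOn {g p : ℝ} (hg : 0 ≤ g) (hp : p ^ 2 ≤ 1) :
    AntitoneOn (pot g p) (Ici (1 + 4 * g)) := by
  have hpos : ∀ x ∈ Ici (1 + 4 * g), 0 < x := fun x hx => by
    have : 1 + 4 * g ≤ x := hx
    linarith
  refine antitoneOn_of_deriv_nonpos (convex_Ici _)
    (fun x hx => (hasDerivAt_pot g p (hpos x hx)).continuousAt.continuousWithinAt)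
    (fun x hx => (hasDerivAt_pot g p (hpos x (interior_subset hx))).differentiableAt.differentiableWithinAt)
    (fun x hx => ?_)
  rw [(hasDerivAt_pot g p (hpos x (interior_subset hx))).deriv]
  exact force_nonpos hg hp (interior_subset hx)

/-- At large radii `pot` is convex, because the Newtonian term `x⁻³` in the derivative of the force
beats the centrifugal `x⁻⁴`. Both the compactness of Palais-Smale sequences and the finite energy of
homoclinic orbits rest on this sign. -/
theorem force_monotoneOn {g p : ℝ} (hg : 0 ≤ g) (hp : p ^ 2 ≤ 1) :
    MonotoneOn (force g p) (Ici (2 + 24 * g)) := by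
  have hpos : ∀ x ∈ Ici (2 + 24 * g), 2 + 24 * g ≤ x ∧ 0 < x := fun x hx => by
    have : 2 + 24 * g ≤ x := hx
    exact ⟨this, by linarith⟩
  refine monotoneOn_of_deriv_nonneg (convex_Ici _)
    (fun x hx => (hasDerivAt_force g p (hpos x hx).2).continuousAt.continuousWithinAt)
    (fun x hx => (hasDerivAt_force g p (hpos x (interior_subset hx)).2).differentiableAt.differentiableWithinAt)
    (fun x hx => ?_)
  obtain ⟨hx1, hx0⟩ := hpos x (interior_subset hx)
  rw [(hasDerivAt_force g p hx0).deriv]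
  have hq := le_sqrt_sq_add hx0 p
  have hq0 : 0 < √(x ^ 2 + p ^ 2) := hx0.trans_le hq
  have hq2 : √(x ^ 2 + p ^ 2) ≤ 6 / 5 * x := by
    refine Real.sqrt_le_iff.2 ⟨by positivity, by nlinarith⟩
  set q := √(x ^ 2 + p ^ 2)
  rw [sub_nonneg]
  calc 3 * g / x ^ 4 ≤ (x / 8) / x ^ 4 := by gcongr; linarith
    _ = x ^ 2 / (8 * x ^ 5) := by field_simp
    _ ≤ x ^ 2 / q ^ 5 := by
        gcongr
        calc q ^ 5 ≤ (6 / 5 * x) ^ 5 := by gcongr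
          _ = (6 / 5) ^ 5 * x ^ 5 := by ring
          _ ≤ 8 * x ^ 5 := by gcongr; norm_num
    _ ≤ (2 * x ^ 2 - p ^ 2) / q ^ 5 := by gcongr; nlinarith

theorem pot_zero_right (g : ℝ) {x : ℝ} (hx : 0 < x) : pot g 0 x = 1 / x - g / (2 * x ^ 2) := by
  unfold pot
  rw [zero_pow two_ne_zero, add_zero, Real.sqrt_sq hx.le]

theorem force_zero_right (g : ℝ) {x : ℝ} (hx : 0 < x) : force g 0 x = g / x ^ 3 - 1 / x ^ 2 := by
  unfold force
  rw [zero_pow two_ne_zero, add_zero, Real.sqrt_sq hx.le]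
  field_simp

/-- Splitting the central mass and changing the angular momentum perturb the Kepler potential only
at order `x⁻²`, which is integrable along `r₀`. -/
theorem abs_pot_sub_pot_le {g g' p x : ℝ} (hg : 0 ≤ g) (hg' : 0 ≤ g') (hp : 0 ≤ p) (hp1 : p ≤ 1)
    (hx : 0 < x) : |pot g p x - pot g' 0 x| ≤ (1 + g + g') / x ^ 2 := by
  rw [pot_zero_right g' hx]
  have hq := le_sqrt_sq_add hx p
  have hq2 := sqrt_sq_add_le hx hp
  unfold pot
  have hq0 : 0 < √(x ^ 2 + p ^ 2) := hx.trans_le hq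
  set q := √(x ^ 2 + p ^ 2)
  have h1 : 1 / q ≤ 1 / x := by gcongr
  have h2 : 1 / x - 1 / q ≤ 1 / x ^ 2 := by
    rw [div_sub_div _ _ hx.ne' hq0.ne', div_le_div_iff₀ (by positivity) (by positivity)]
    nlinarith [mul_pos hx hq0]
  have e1 : g / (2 * x ^ 2) = g / 2 * (1 / x ^ 2) := by field_simp
  have e2 : g' / (2 * x ^ 2) = g' / 2 * (1 / x ^ 2) := by field_simp
  have e3 : (1 + g + g') / x ^ 2 = (1 + g + g') * (1 / x ^ 2) := by field_simp
  rw [e1, e2, e3]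
  have h3 : 0 ≤ 1 / x ^ 2 := by positivity
  rw [abs_le]
  constructor <;> nlinarith [mul_nonneg hg h3, mul_nonneg hg' h3]

theorem abs_force_sub_force_le {g g' p x : ℝ} (hg : 0 ≤ g) (hg' : 0 ≤ g') (hp : 0 ≤ p)
    (hp1 : p ≤ 1) (hx : 0 < x) : |force g p x - force g' 0 x| ≤ (3 + g + g') / x ^ 3 := by
  rw [force_zero_right g' hx]
  have hq := le_sqrt_sq_add hx p
  have hq2 := sqrt_sq_add_le hx hp
  unfold force
  have hq0 : 0 < √(x ^ 2 + p ^ 2) := hx.trans_le hq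
  set q := √(x ^ 2 + p ^ 2)
  have h1 : x / q ^ 3 ≤ 1 / x ^ 2 := by
    calc x / q ^ 3 ≤ x / x ^ 3 := by gcongr
      _ = _ := by field_simp
  have h2 : 1 / x ^ 2 - x / q ^ 3 ≤ 3 * (1 / x ^ 3) := by
    have h4 : q ^ 3 - x ^ 3 ≤ 3 * q ^ 2 := by
      have : q ^ 3 - x ^ 3 = (q - x) * (q ^ 2 + q * x + x ^ 2) := by ring
      rw [this]
      calc (q - x) * (q ^ 2 + q * x + x ^ 2) ≤ 1 * (q ^ 2 + q * q + q ^ 2) := by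
            gcongr
            · linarith
            
        _ = _ := by ring
    have : 1 / x ^ 2 - x / q ^ 3 = (q ^ 3 - x ^ 3) / (x ^ 2 * q ^ 3) := by field_simp
    rw [this]
    calc (q ^ 3 - x ^ 3) / (x ^ 2 * q ^ 3) ≤ 3 * q ^ 2 / (x ^ 2 * q ^ 3) := by gcongr
      _ = 3 / (x ^ 2 * q) := by field_simp
      _ ≤ 3 / (x ^ 2 * x) := by gcongr
      _ = _ := by field_simp
  have e1 : g / x ^ 3 = g * (1 / x ^ 3) := by field_simp
  have e2 : g' / x ^ 3 = g' * (1 / x ^ 3) := by field_simp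
  have e3 : (3 + g + g') / x ^ 3 = (3 + g + g') * (1 / x ^ 3) := by field_simp
  rw [e1, e2, e3]
  have h3 : 0 ≤ 1 / x ^ 3 := by positivity
  rw [abs_le]
  constructor <;> nlinarith [mul_nonneg hg h3, mul_nonneg hg' h3]

/-! ### Primitives -/

/-- `f` is a primitive of the locally integrable function `v`. -/
structure IsPrimitive (f v : ℝ → ℝ) : Prop where
  intervalIntegrable : ∀ a b, IntervalIntegrable v volume a b
  eq : ∀ s, f s = f 0 + ∫ t in (0 : ℝ)..s, v t

theorem IsPrimitive.sub_eq {f v : ℝ → ℝ} (h : IsPrimitive f v) (a b : ℝ) :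
    f b - f a = ∫ t in a..b, v t := by
  rw [h.eq b, h.eq a, ← intervalIntegral.integral_interval_sub_left
    (h.intervalIntegrable 0 b) (h.intervalIntegrable 0 a)]
  ring

theorem IsPrimitive.continuous {f v : ℝ → ℝ} (h : IsPrimitive f v) : Continuous f := by
  rw [funext h.eq]
  exact continuous_const.add (intervalIntegral.continuous_primitive h.intervalIntegrable 0)

theorem IsPrimitive.absolutelyContinuous {f v : ℝ → ℝ} (h : IsPrimitive f v) (a b : ℝ) :
    AbsolutelyContinuousOnInterval f a b := by
  have e : f = fun s => f a + ∫ t in a..s, v t := by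
    funext s; rw [← h.sub_eq a s]; ring
  have h1 : AbsolutelyContinuousOnInterval (fun _ : ℝ => f a) a b :=
    contDiffOn_const.absolutelyContinuousOnInterval
  have h2 := (h.intervalIntegrable a b).absolutelyContinuousOnInterval_intervalIntegral
    (c := a) left_mem_uIcc
  rw [e]
  exact h1.add h2

theorem IsPrimitive.ae_hasDerivAt {f v : ℝ → ℝ} (h : IsPrimitive f v) (a b : ℝ) :
    ∀ᵐ x, x ∈ uIcc a b → HasDerivAt f (v x) x := by
  have e : f = fun s => f a + ∫ t in a..s, v t := by
    funext s; rw [← h.sub_eq a s]; ring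
  filter_upwards [(h.intervalIntegrable a b).ae_hasDerivAt_integral] with x hx hxm
  rw [e]
  simpa using (hx hxm a left_mem_uIcc).const_add (f a)

theorem isPrimitive_of_hasDerivAt {f v : ℝ → ℝ} (h : ∀ s, HasDerivAt f (v s) s)
    (hv : Continuous v) : IsPrimitive f v :=
  ⟨fun a b => hv.intervalIntegrable a b, fun s => by
    rw [intervalIntegral.integral_eq_sub_of_hasDerivAt (fun x _ => h x)
      (hv.intervalIntegrable 0 s)]; ring⟩

/-- Integration by parts. -/
theorem IsPrimitive.integral_mul {f g v w : ℝ → ℝ} (hf : IsPrimitive f v) (hg : IsPrimitive g w)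
    (a b : ℝ) : ∫ x in a..b, (v x * g x + f x * w x) = f b * g b - f a * g a := by
  rw [← (hf.absolutelyContinuous a b).integral_deriv_mul_eq_sub (hg.absolutelyContinuous a b)]
  apply intervalIntegral.integral_congr_ae
  filter_upwards [hf.ae_hasDerivAt a b, hg.ae_hasDerivAt a b] with x h1 h2 h3
  have h4 := uIoc_subset_uIcc h3
  rw [(h1 h4).deriv, (h2 h4).deriv]

theorem IsPrimitive.intervalIntegrable_mul {f g v w : ℝ → ℝ} (hf : IsPrimitive f v)
    (hg : IsPrimitive g w) (a b : ℝ) :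
    IntervalIntegrable (fun x => v x * g x + f x * w x) volume a b :=
  ((hf.intervalIntegrable a b).mul_continuousOn hg.continuous.continuousOn).add
    ((hg.intervalIntegrable a b).continuousOn_mul hf.continuous.continuousOn)

theorem IsPrimitive.mul {f g v w : ℝ → ℝ} (hf : IsPrimitive f v) (hg : IsPrimitive g w) :
    IsPrimitive (fun x => f x * g x) (fun x => v x * g x + f x * w x) :=
  ⟨hf.intervalIntegrable_mul hg, fun s => by rw [hf.integral_mul hg]; ring⟩

theorem IsPrimitive.comp_neg {f v : ℝ → ℝ} (hf : IsPrimitive f v) :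
    IsPrimitive (fun s => f (-s)) (fun s => -v (-s)) := by
  refine ⟨fun a b => ?_, fun s => ?_⟩
  · have := (IntervalIntegrable.iff_comp_neg (f := v) (a := -a) (b := -b)).1
      (hf.intervalIntegrable _ _)
    simp only [neg_neg] at this
    exact this.neg
  · rw [intervalIntegral.integral_neg, intervalIntegral.integral_comp_neg (fun x => v x),
      ← hf.sub_eq]
    simp

/-- Hardy's inequality on a half-line. -/
theorem IsPrimitive.hardy_interval {f v : ℝ → ℝ} (hf : IsPrimitive f v)
    (hv : Integrable (fun s => v s ^ 2)) {R : ℝ} (hR : 0 ≤ R) :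
    ∫ s in (0 : ℝ)..R, f s ^ 2 / (1 + |s|) ^ 2 ≤ 2 * f 0 ^ 2 + 4 * ∫ s, v s ^ 2 := by
  have hpos : ∀ s ∈ uIcc 0 R, 0 < 1 + s := fun s hs => by
    rw [uIcc_of_le hR] at hs; linarith [hs.1]
  have hg : ∀ s ∈ uIcc 0 R, HasDerivAt (fun s : ℝ => -(1 + s)⁻¹) (1 / (1 + s) ^ 2) s := by
    intro s hs
    have := (((hasDerivAt_id' s).const_add 1).fun_inv (hpos s hs).ne').fun_neg
    convert! this using 1
    ring
  have hgc : ContinuousOn (fun s : ℝ => 1 / (1 + s) ^ 2) (uIcc 0 R) :=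
    continuousOn_const.div (by fun_prop) fun s hs => by have := hpos s hs; positivity
  have hgac : AbsolutelyContinuousOnInterval (fun s : ℝ => -(1 + s)⁻¹) 0 R := by
    apply ContDiffOn.absolutelyContinuousOnInterval
    exact ((contDiffOn_const.add contDiffOn_id).inv fun s hs => (hpos s hs).ne').neg
  have hff := hf.mul hf
  -- Integration by parts of `f²` against `-1/(1+s)`, a primitive of the Hardy weight.
  have key := (hff.absolutelyContinuous 0 R).integral_deriv_mul_eq_sub hgac
  have e1 : ∫ x in (0 : ℝ)..R, (deriv (fun x => f x * f x) x * -(1 + x)⁻¹ +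
      f x * f x * deriv (fun s : ℝ => -(1 + s)⁻¹) x) =
      ∫ x in (0 : ℝ)..R, (-(2 * f x * v x * (1 + x)⁻¹) + f x ^ 2 / (1 + |x|) ^ 2) := by
    apply intervalIntegral.integral_congr_ae
    filter_upwards [hff.ae_hasDerivAt 0 R] with x h1 h3
    have h4 := uIoc_subset_uIcc h3
    rw [(h1 h4).deriv, (hg x h4).deriv, abs_of_nonneg (by rw [uIcc_of_le hR] at h4; exact h4.1)]
    ring
  rw [e1] at key
  have i2 : IntervalIntegrable (fun x => f x ^ 2 / (1 + |x|) ^ 2) volume 0 R := by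
    apply Continuous.intervalIntegrable
    exact (hf.continuous.pow 2).div (by fun_prop) fun x => by positivity
  have i3 : IntervalIntegrable (fun x => v x ^ 2) volume 0 R := hv.intervalIntegrable
  have i1 : IntervalIntegrable (fun x => -(2 * f x * v x * (1 + x)⁻¹)) volume 0 R := by
    have hc : ContinuousOn (fun x => -(2 * f x * (1 + x)⁻¹)) (uIcc 0 R) := by
      have := hf.continuous
      have h2 : ContinuousOn (fun x : ℝ => (1 + x)⁻¹) (uIcc 0 R) :=
        (by fun_prop : ContinuousOn (fun x : ℝ => 1 + x) (uIcc 0 R)).inv₀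
          fun s hs => (hpos s hs).ne'
      exact ((continuous_const.mul this).continuousOn.mul h2).neg
    refine ((hf.intervalIntegrable 0 R).continuousOn_mul hc).congr ?_
    exact fun x _ => by ring
  -- Young's inequality: with `a = f/(1+x)`, the difference of the integrands is `(a - 2v)²/2`.
  have le : ∫ x in (0 : ℝ)..R, (1 / 2 * (f x ^ 2 / (1 + |x|) ^ 2) - 2 * v x ^ 2) ≤
      ∫ x in (0 : ℝ)..R, (-(2 * f x * v x * (1 + x)⁻¹) + f x ^ 2 / (1 + |x|) ^ 2) := by
    refine intervalIntegral.integral_mono_on hR ((i2.const_mul _).sub (i3.const_mul _))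
      (i1.add i2) fun x hx => ?_
    rw [abs_of_nonneg hx.1]
    have h1 : 0 < 1 + x := by linarith [hx.1]
    have e : f x ^ 2 / (1 + x) ^ 2 = (f x * (1 + x)⁻¹) ^ 2 := by
      rw [mul_pow, inv_pow, div_eq_mul_inv]
    rw [e]
    nlinarith [sq_nonneg (f x * (1 + x)⁻¹ - 2 * v x)]
  rw [key, intervalIntegral.integral_sub (i2.const_mul _) (i3.const_mul _),
    intervalIntegral.integral_const_mul, intervalIntegral.integral_const_mul] at le
  have h5 : ∫ x in (0 : ℝ)..R, v x ^ 2 ≤ ∫ s, v s ^ 2 := by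
    rw [intervalIntegral.integral_of_le hR]
    exact setIntegral_le_integral hv (Eventually.of_forall fun s => sq_nonneg _)
  -- The boundary term at `R` has the favourable sign and is dropped.
  have h6 : 0 ≤ f R * f R * (1 + R)⁻¹ := by
    have : 0 < 1 + R := by linarith
    have := mul_self_nonneg (f R)
    positivity
  simp only [add_zero, inv_one] at le
  nlinarith

/-! ### Calculus in `D^{1,2}` -/

namespace D12

theorem memLp (φ : D12) : MemLp (φ.weakDeriv : ℝ → ℝ) 2 volume := Lp.memLp _

theorem isPrimitive (φ : D12) : IsPrimitive φ.eval φ.weakDeriv :=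
  ⟨fun a b => D12.intervalIntegrable φ.memLp a b, fun s => by rw [eval_zero]; rfl⟩

theorem continuous_eval (φ : D12) : Continuous φ.eval := φ.isPrimitive.continuous

theorem coeFn_weakDeriv_add (φ ψ : D12) :
    ((φ + ψ).weakDeriv : ℝ → ℝ) =ᵐ[volume] fun s => φ.weakDeriv s + ψ.weakDeriv s :=
  Lp.coeFn_add φ.snd ψ.snd

theorem coeFn_weakDeriv_smul (c : ℝ) (φ : D12) :
    ((c • φ).weakDeriv : ℝ → ℝ) =ᵐ[volume] fun s => c * φ.weakDeriv s :=
  Lp.coeFn_smul c φ.snd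

theorem eval_add (φ ψ : D12) (s : ℝ) : (φ + ψ).eval s = φ.eval s + ψ.eval s := by
  unfold eval
  have : ∫ t in (0 : ℝ)..s, (φ + ψ).weakDeriv t
      = ∫ t in (0 : ℝ)..s, (φ.weakDeriv t + ψ.weakDeriv t) :=
    intervalIntegral.integral_congr_ae (by
      filter_upwards [coeFn_weakDeriv_add φ ψ] with t ht _ using ht)
  rw [this, intervalIntegral.integral_add (φ.isPrimitive.intervalIntegrable 0 s)
    (ψ.isPrimitive.intervalIntegrable 0 s), WithLp.add_fst]
  ring

theorem eval_smul (c : ℝ) (φ : D12) (s : ℝ) : (c • φ).eval s = c * φ.eval s := by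
  unfold eval
  have : ∫ t in (0 : ℝ)..s, (c • φ).weakDeriv t = ∫ t in (0 : ℝ)..s, (c * φ.weakDeriv t) :=
    intervalIntegral.integral_congr_ae (by
      filter_upwards [coeFn_weakDeriv_smul c φ] with t ht _ using ht)
  rw [this, intervalIntegral.integral_const_mul, WithLp.smul_fst, smul_eq_mul]
  ring

theorem eval_neg (φ : D12) (s : ℝ) : (-φ).eval s = -φ.eval s := by
  rw [← neg_one_smul ℝ, eval_smul]; ring

theorem eval_sub (φ ψ : D12) (s : ℝ) : (φ - ψ).eval s = φ.eval s - ψ.eval s := by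
  rw [sub_eq_add_neg, eval_add, eval_neg]; ring

theorem integrable_weakDeriv_sq (φ : D12) : Integrable (fun s => φ.weakDeriv s ^ 2) :=
  φ.memLp.integrable_sq

theorem norm_weakDeriv_sq (φ : D12) : ‖φ.weakDeriv‖ ^ 2 = ∫ s, φ.weakDeriv s ^ 2 := by
  rw [← real_inner_self_eq_norm_sq, L2.inner_def]
  congr 1
  funext s
  rw [real_inner_self_eq_norm_sq, Real.norm_eq_abs, sq_abs]

theorem norm_sq (φ : D12) : ‖φ‖ ^ 2 = φ.eval 0 ^ 2 + ‖φ.weakDeriv‖ ^ 2 := by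
  rw [WithLp.prod_norm_sq_eq_of_L2, eval_zero, Real.norm_eq_abs, sq_abs]; rfl

theorem norm_weakDeriv_le (φ : D12) : ‖φ.weakDeriv‖ ≤ ‖φ‖ := by
  refine le_of_sq_le_sq ?_ (norm_nonneg _)
  rw [norm_sq φ]; linarith [sq_nonneg (φ.eval 0)]

theorem abs_eval_zero_le (φ : D12) : |φ.eval 0| ≤ ‖φ‖ := by
  refine le_of_sq_le_sq ?_ (norm_nonneg _)
  rw [norm_sq φ, sq_abs]; linarith [sq_nonneg ‖φ.weakDeriv‖]

theorem norm_le (φ : D12) : ‖φ‖ ≤ |φ.eval 0| + ‖φ.weakDeriv‖ := by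
  refine le_of_sq_le_sq ?_ (by positivity)
  rw [norm_sq φ, add_sq, sq_abs]
  have : 0 ≤ 2 * |φ.eval 0| * ‖φ.weakDeriv‖ := by positivity
  linarith

/-- Elements of `D^{1,2}` are Hölder continuous. -/
theorem abs_eval_sub_le (φ : D12) (a b : ℝ) :
    |φ.eval b - φ.eval a| ≤ ‖φ.weakDeriv‖ * √|b - a| := by
  wlog hab : a ≤ b generalizing a b
  · rw [abs_sub_comm, abs_sub_comm b]; exact this b a (le_of_not_ge hab)
  have h1 := L2.inner_indicatorConstLp_one (𝕜 := ℝ) (μ := (volume : Measure ℝ))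
    (measurableSet_Ioc (a := a) (b := b)) measure_Ioc_lt_top.ne φ.weakDeriv
  rw [φ.isPrimitive.sub_eq, intervalIntegral.integral_of_le hab, ← h1]
  refine (abs_real_inner_le_norm _ _).trans ?_
  rw [mul_comm, norm_indicatorConstLp (by norm_num) (by norm_num)]
  simp only [norm_one, one_mul, ENNReal.toReal_ofNat, Real.volume_real_Ioc]
  rw [Real.sqrt_eq_rpow, max_eq_left (by linarith), abs_of_nonneg (by linarith)]

theorem abs_eval_le (φ : D12) (s : ℝ) : |φ.eval s| ≤ ‖φ‖ * (1 + √|s|) := by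
  have h1 := φ.abs_eval_sub_le 0 s
  have h2 := φ.abs_eval_zero_le
  have h3 := φ.norm_weakDeriv_le
  rw [sub_zero] at h1
  have h4 : |φ.eval s| ≤ |φ.eval s - φ.eval 0| + |φ.eval 0| := by
    simpa using abs_add_le (φ.eval s - φ.eval 0) (φ.eval 0)
  nlinarith [mul_le_mul_of_nonneg_right h3 (Real.sqrt_nonneg |s|)]

/-- The element of `D^{1,2}` with given value at `0` and given derivative. -/
def ofDeriv (c : ℝ) {v : ℝ → ℝ} (hv : MemLp v 2 (volume : Measure ℝ)) : D12 :=
  WithLp.toLp 2 (c, hv.toLp v)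

theorem coeFn_weakDeriv_ofDeriv (c : ℝ) {v : ℝ → ℝ} (hv : MemLp v 2 (volume : Measure ℝ)) :
    ((ofDeriv c hv).weakDeriv : ℝ → ℝ) =ᵐ[volume] v := hv.coeFn_toLp

theorem eval_ofDeriv (c : ℝ) {v : ℝ → ℝ} (hv : MemLp v 2 (volume : Measure ℝ)) (s : ℝ) :
    (ofDeriv c hv).eval s = c + ∫ t in (0 : ℝ)..s, v t := by
  unfold eval
  have : ∫ t in (0 : ℝ)..s, (ofDeriv c hv).weakDeriv t = ∫ t in (0 : ℝ)..s, v t :=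
    intervalIntegral.integral_congr_ae (by
      filter_upwards [coeFn_weakDeriv_ofDeriv c hv] with t ht _ using ht)
  rw [this]; rfl

theorem eval_ofDeriv_eq {f v : ℝ → ℝ} (hf : IsPrimitive f v)
    (hv : MemLp v 2 (volume : Measure ℝ)) : (ofDeriv (f 0) hv).eval = f :=
  funext fun s => by rw [eval_ofDeriv, ← hf.eq]

/-- Constant functions. -/
def const (c : ℝ) : D12 := WithLp.toLp 2 (c, 0)

theorem weakDeriv_const (c : ℝ) : (const c).weakDeriv = 0 := rfl

theorem eval_const (c s : ℝ) : (const c).eval s = c := by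
  unfold eval
  rw [weakDeriv_const]
  have : ∫ t in (0 : ℝ)..s, (0 : Lp ℝ 2 (volume : Measure ℝ)) t = ∫ t in (0 : ℝ)..s, (0 : ℝ) :=
    intervalIntegral.integral_congr_ae (by
      filter_upwards [Lp.coeFn_zero ℝ 2 (volume : Measure ℝ)] with t ht _ using ht)
  rw [this]
  simp [const]

/-- Translation by `a`. -/
def shift (a : ℝ) (φ : D12) : D12 :=
  WithLp.toLp 2 (φ.eval (-a),
    Lp.compMeasurePreserving (fun s : ℝ => s - a) (measurePreserving_sub_right volume a)
      φ.weakDeriv)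

theorem coeFn_weakDeriv_shift (a : ℝ) (φ : D12) :
    ((shift a φ).weakDeriv : ℝ → ℝ) =ᵐ[volume] fun s => φ.weakDeriv (s - a) :=
  Lp.coeFn_compMeasurePreserving φ.weakDeriv (measurePreserving_sub_right volume a)

theorem norm_weakDeriv_shift (a : ℝ) (φ : D12) : ‖(shift a φ).weakDeriv‖ = ‖φ.weakDeriv‖ :=
  Lp.norm_compMeasurePreserving φ.weakDeriv (measurePreserving_sub_right volume a)

theorem eval_shift (a : ℝ) (φ : D12) (s : ℝ) : (shift a φ).eval s = φ.eval (s - a) := by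
  have : ∫ t in (0 : ℝ)..s, (shift a φ).weakDeriv t
      = ∫ t in (0 : ℝ)..s, φ.weakDeriv (t - a) :=
    intervalIntegral.integral_congr_ae (by
      filter_upwards [coeFn_weakDeriv_shift a φ] with t ht _ using ht)
  have h2 : (shift a φ).eval s = φ.eval (-a) + ∫ t in (0 : ℝ)..s, (shift a φ).weakDeriv t := rfl
  rw [h2, this, intervalIntegral.integral_comp_sub_right (fun t => φ.weakDeriv t),
    ← φ.isPrimitive.sub_eq]
  simp

theorem shift_add (a : ℝ) (φ ψ : D12) : shift a (φ + ψ) = shift a φ + shift a ψ :=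
  eval_injective (funext fun s => by simp only [eval_shift, eval_add])

theorem shift_smul (a c : ℝ) (φ : D12) : shift a (c • φ) = c • shift a φ :=
  eval_injective (funext fun s => by simp only [eval_shift, eval_smul])

/-! ### Weighted inequalities -/

/-- `φ = o(r₀)` at infinity, quantitatively. -/
theorem exists_eval_pow_four_le {G₀ : ℝ} (hG₀ : 0 < G₀) :
    ∃ C > 0, ∀ (φ : D12) (s : ℝ), φ.eval s ^ 4 ≤ C * ‖φ‖ ^ 4 * r0 G₀ s ^ 3 := by
  -- Elements of `D^{1,2}` grow at most like `|s|^(1/2)`, hence like `r₀^(3/4)`; fourth powers keep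
  -- the exponents integral.
  refine ⟨8 * (8 / G₀ ^ 6 + 2), by positivity, fun φ s => ?_⟩
  have h1 := φ.abs_eval_le s
  have h2 := sq_le_two_mul_r0_cube hG₀ s
  have h3 : G₀ ^ 6 / 8 ≤ r0 G₀ s ^ 3 := by
    calc G₀ ^ 6 / 8 = (G₀ ^ 2 / 2) ^ 3 := by ring
      _ ≤ _ := by gcongr; exact half_sq_le_r0 G₀ s
  have h4 : (1 + √|s|) ^ 4 ≤ 8 * (1 + s ^ 2) := by
    have e : √|s| ^ 2 = |s| := Real.sq_sqrt (abs_nonneg s)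
    have e2 : s ^ 2 = (√|s| ^ 2) ^ 2 := by rw [e, sq_abs]
    rw [e2]
    nlinarith [sq_nonneg (√|s| - 1), sq_nonneg (√|s| ^ 2 - 1), sq_nonneg (√|s|),
      sq_nonneg (√|s| ^ 2 - √|s|)]
  calc φ.eval s ^ 4 = |φ.eval s| ^ 4 := by rw [← Even.pow_abs (by decide)]
    _ ≤ (‖φ‖ * (1 + √|s|)) ^ 4 := by gcongr
    _ = ‖φ‖ ^ 4 * (1 + √|s|) ^ 4 := by ring
    _ ≤ ‖φ‖ ^ 4 * (8 * ((8 / G₀ ^ 6 + 2) * r0 G₀ s ^ 3)) := by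
        gcongr
        refine h4.trans ?_
        have : 1 ≤ 8 / G₀ ^ 6 * r0 G₀ s ^ 3 := by
          calc (1 : ℝ) = 8 / G₀ ^ 6 * (G₀ ^ 6 / 8) := by field_simp
            _ ≤ _ := by gcongr
        nlinarith
    _ = _ := by ring

/-- The norm controls `φ/r₀` uniformly on the line, so a small perturbation in `D^{1,2}` is a small
relative perturbation of a radius comparable with `r₀`. -/
theorem exists_abs_eval_le {G₀ : ℝ} (hG₀ : 0 < G₀) :
    ∃ C > 0, ∀ (φ : D12) (s : ℝ), |φ.eval s| ≤ C * ‖φ‖ * r0 G₀ s := by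
  obtain ⟨C, hC, h⟩ := exists_eval_pow_four_le hG₀
  refine ⟨1 + C * (2 / G₀ ^ 2), by positivity, fun φ s => ?_⟩
  have hr := r0_pos hG₀ s
  have hr2 := half_sq_le_r0 G₀ s
  refine le_of_pow_le_pow_left₀ (n := 4) (by norm_num) (by positivity) ?_
  rw [Even.pow_abs (by decide)]
  refine (h φ s).trans ?_
  set D := C * (2 / G₀ ^ 2)
  have hD : 0 < D := by positivity
  calc C * ‖φ‖ ^ 4 * r0 G₀ s ^ 3 = D * ‖φ‖ ^ 4 * ((G₀ ^ 2 / 2) * r0 G₀ s ^ 3) := by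
        simp only [D]; field_simp
    _ ≤ D * ‖φ‖ ^ 4 * (r0 G₀ s * r0 G₀ s ^ 3) := by gcongr
    _ ≤ (1 + D) ^ 4 * ‖φ‖ ^ 4 * (r0 G₀ s * r0 G₀ s ^ 3) := by
        gcongr
        nlinarith [sq_nonneg D, sq_nonneg (D ^ 2), pow_pos hD 3]
    _ = _ := by ring

/-- The weight `1/r₀³` is dominated by a multiple of `(1+|s|)⁻²`, so Hardy's inequality on the two
half-lines applies. This controls every second order remainder. -/
theorem exists_hardy {G₀ : ℝ} (hG₀ : 0 < G₀) :
    ∃ C > 0, ∀ φ : D12, Integrable (fun s => φ.eval s ^ 2 / r0 G₀ s ^ 3) ∧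
      ∫ s, φ.eval s ^ 2 / r0 G₀ s ^ 3 ≤ C * ‖φ‖ ^ 2 := by
  have hw : ∀ s, 1 / r0 G₀ s ^ 3 ≤ 2 * (8 / G₀ ^ 6 + 2) * (1 / (1 + |s|) ^ 2) := by
    intro s
    have h0 := r0_pos hG₀ s
    have h2 := sq_le_two_mul_r0_cube hG₀ s
    have h3 : G₀ ^ 6 / 8 ≤ r0 G₀ s ^ 3 := by
      calc G₀ ^ 6 / 8 = (G₀ ^ 2 / 2) ^ 3 := by ring
        _ ≤ _ := by gcongr; exact half_sq_le_r0 G₀ s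
    have : 1 ≤ 8 / G₀ ^ 6 * r0 G₀ s ^ 3 := by
      calc (1 : ℝ) = 8 / G₀ ^ 6 * (G₀ ^ 6 / 8) := by field_simp
        _ ≤ _ := by gcongr
    rw [mul_one_div, div_le_div_iff₀ (by positivity) (by positivity)]
    nlinarith [sq_nonneg (|s| - 1), sq_abs s]
  have hcont : ∀ φ : D12, Continuous fun s => φ.eval s ^ 2 / (1 + |s|) ^ 2 := fun φ =>
    (φ.continuous_eval.pow 2).div (by fun_prop) fun x => by positivity
  have hbound : ∀ (φ : D12) (n : ℕ), ∫ s in (-(n : ℝ))..n, ‖φ.eval s ^ 2 / (1 + |s|) ^ 2‖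
      ≤ 8 * ‖φ‖ ^ 2 := by
    intro φ n
    have e : ∀ s, ‖φ.eval s ^ 2 / (1 + |s|) ^ 2‖ = φ.eval s ^ 2 / (1 + |s|) ^ 2 := fun s =>
      Real.norm_of_nonneg (by positivity)
    simp only [e]
    have hn : (0 : ℝ) ≤ n := Nat.cast_nonneg n
    have h1 := φ.isPrimitive.hardy_interval φ.integrable_weakDeriv_sq hn
    have hi : Integrable (fun s => (-φ.weakDeriv (-s)) ^ 2) := by
      simpa using φ.integrable_weakDeriv_sq.comp_neg
    have h2 := φ.isPrimitive.comp_neg.hardy_interval hi hn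
    have e2 : ∫ s in (0 : ℝ)..n, φ.eval (-s) ^ 2 / (1 + |s|) ^ 2
        = ∫ s in (-(n : ℝ))..0, φ.eval s ^ 2 / (1 + |s|) ^ 2 := by
      have := intervalIntegral.integral_comp_neg (a := 0) (b := (n : ℝ))
        (fun s => φ.eval s ^ 2 / (1 + |s|) ^ 2)
      simpa using this
    have e3 : ∫ s, (-φ.weakDeriv (-s)) ^ 2 = ∫ s, φ.weakDeriv s ^ 2 := by
      simpa using integral_neg_eq_self (fun s => φ.weakDeriv s ^ 2) volume
    rw [e2, e3, neg_zero] at h2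
    rw [← intervalIntegral.integral_add_adjacent_intervals (b := 0)
      ((hcont φ).intervalIntegrable _ _) ((hcont φ).intervalIntegrable _ _), norm_sq φ,
      norm_weakDeriv_sq]
    nlinarith [sq_nonneg (φ.eval 0)]
  have hint : ∀ φ : D12, Integrable fun s => φ.eval s ^ 2 / (1 + |s|) ^ 2 := fun φ =>
    integrable_of_intervalIntegral_norm_bounded (a := fun n : ℕ => -(n : ℝ))
      (b := fun n : ℕ => (n : ℝ)) (l := atTop) (8 * ‖φ‖ ^ 2)
      (fun n => ((hcont φ).integrableOn_Icc).mono_set Ioc_subset_Icc_self)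
      (tendsto_neg_atTop_atBot.comp tendsto_natCast_atTop_atTop) tendsto_natCast_atTop_atTop
      (Eventually.of_forall (hbound φ))
  have hle : ∀ φ : D12, ∫ s, φ.eval s ^ 2 / (1 + |s|) ^ 2 ≤ 8 * ‖φ‖ ^ 2 := fun φ => by
    refine le_of_tendsto (intervalIntegral_tendsto_integral (hint φ)
      (tendsto_neg_atTop_atBot.comp tendsto_natCast_atTop_atTop)
      (tendsto_natCast_atTop_atTop (R := ℝ))) (Eventually.of_forall fun n => ?_)
    refine le_trans (le_of_eq ?_) (hbound φ n)
    refine intervalIntegral.integral_congr fun s _ => (Real.norm_of_nonneg (by positivity)).symm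
  have hpt : ∀ (φ : D12) (s : ℝ), φ.eval s ^ 2 / r0 G₀ s ^ 3
      ≤ 2 * (8 / G₀ ^ 6 + 2) * (φ.eval s ^ 2 / (1 + |s|) ^ 2) := fun φ s => by
    calc φ.eval s ^ 2 / r0 G₀ s ^ 3 = φ.eval s ^ 2 * (1 / r0 G₀ s ^ 3) := by ring
      _ ≤ φ.eval s ^ 2 * (2 * (8 / G₀ ^ 6 + 2) * (1 / (1 + |s|) ^ 2)) := by gcongr; exact hw s
      _ = _ := by ring
  have hint' : ∀ φ : D12, Integrable (fun s => φ.eval s ^ 2 / r0 G₀ s ^ 3) := fun φ => by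
    refine ((hint φ).const_mul (2 * (8 / G₀ ^ 6 + 2))).mono' ?_ (Eventually.of_forall fun s => ?_)
    · exact ((φ.continuous_eval.pow 2).div ((continuous_r0 hG₀).pow 3) fun s =>
        pow_ne_zero _ (r0_pos hG₀ s).ne').aestronglyMeasurable
    · have := r0_pos hG₀ s
      rw [Real.norm_of_nonneg (by positivity)]
      exact hpt φ s
  refine ⟨2 * (8 / G₀ ^ 6 + 2) * 8, by positivity, fun φ => ⟨hint' φ, ?_⟩⟩
  calc ∫ s, φ.eval s ^ 2 / r0 G₀ s ^ 3
      ≤ ∫ s, 2 * (8 / G₀ ^ 6 + 2) * (φ.eval s ^ 2 / (1 + |s|) ^ 2) :=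
        integral_mono (hint' φ) ((hint φ).const_mul _) (hpt φ)
    _ = 2 * (8 / G₀ ^ 6 + 2) * ∫ s, φ.eval s ^ 2 / (1 + |s|) ^ 2 := integral_const_mul _ _
    _ ≤ 2 * (8 / G₀ ^ 6 + 2) * (8 * ‖φ‖ ^ 2) := by gcongr; exact hle φ
    _ = _ := by ring

end D12

/-! ### Radii that are comparable with `r₀` -/

theorem radius_add (G₀ : ℝ) (φ v : D12) (s : ℝ) :
    radius G₀ (φ + v) s = radius G₀ φ s + v.eval s := by
  unfold radius; rw [D12.eval_add]; ring

theorem continuous_radius {G₀ : ℝ} (hG₀ : 0 < G₀) (φ : D12) : Continuous (radius G₀ φ) :=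
  (continuous_r0 hG₀).add φ.continuous_eval

/-- By the growth `r₀^(3/4)` of `φ`, collisions can be approached only where `r₀` is bounded in
terms of the norm, that is, on a compact set of times. -/
theorem exists_abs_eval_le_half {G₀ : ℝ} (hG₀ : 0 < G₀) :
    ∃ C > 0, ∀ (φ : D12) (s : ℝ), C * ‖φ‖ ^ 4 ≤ r0 G₀ s → |φ.eval s| ≤ r0 G₀ s / 2 := by
  obtain ⟨C, hC, h⟩ := D12.exists_eval_pow_four_le hG₀
  refine ⟨16 * C, by positivity, fun φ s hs => ?_⟩
  have hr := r0_pos hG₀ s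
  refine le_of_pow_le_pow_left₀ (n := 4) (by norm_num) (by positivity) ?_
  rw [Even.pow_abs (by decide)]
  calc φ.eval s ^ 4 ≤ C * ‖φ‖ ^ 4 * r0 G₀ s ^ 3 := h φ s
    _ ≤ r0 G₀ s / 16 * r0 G₀ s ^ 3 := by gcongr; linarith
    _ = _ := by ring

theorem abs_le_of_r0_le {G₀ : ℝ} (hG₀ : 0 < G₀) {R s : ℝ} (hs : r0 G₀ s ≤ R) :
    |s| ≤ 1 + 2 * R ^ 3 := by
  have h1 := sq_le_two_mul_r0_cube hG₀ s
  have h2 := r0_pos hG₀ s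
  have h3 : r0 G₀ s ^ 3 ≤ R ^ 3 := by gcongr
  nlinarith [sq_nonneg (|s| - 1), sq_abs s]

/-- Positivity becomes a uniform bound: at infinity the radius is at least `r₀/2`, and on the
remaining compact interval the ratio attains its minimum. -/
theorem NoCollision.exists_le {G₀ : ℝ} (hG₀ : 0 < G₀) {φ : D12} (hφ : NoCollision G₀ φ) :
    ∃ δ > 0, δ ≤ 1 ∧ ∀ s, δ * r0 G₀ s ≤ radius G₀ φ s := by
  obtain ⟨C, hC, h⟩ := exists_abs_eval_le_half hG₀
  set S := 1 + 2 * (C * ‖φ‖ ^ 4) ^ 3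
  have hS : 0 ≤ S := by positivity
  have hcont : ContinuousOn (fun s => radius G₀ φ s / r0 G₀ s) (Icc (-S) S) :=
    ((continuous_radius hG₀ φ).div (continuous_r0 hG₀) fun s => (r0_pos hG₀ s).ne').continuousOn
  obtain ⟨s₀, -, hmin⟩ := isCompact_Icc.exists_isMinOn ⟨0, by constructor <;> linarith⟩ hcont
  refine ⟨min (1 / 2) (radius G₀ φ s₀ / r0 G₀ s₀),
    lt_min (by norm_num) (div_pos (hφ s₀) (r0_pos hG₀ s₀)),
    (min_le_left _ _).trans (by norm_num), fun s => ?_⟩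
  have hr := r0_pos hG₀ s
  by_cases hs : C * ‖φ‖ ^ 4 ≤ r0 G₀ s
  · have h1 := abs_le.1 (h φ s hs)
    have h2 : min (1 / 2) (radius G₀ φ s₀ / r0 G₀ s₀) * r0 G₀ s ≤ 1 / 2 * r0 G₀ s := by
      gcongr; exact min_le_left _ _
    unfold radius at *
    linarith
  · have h1 := abs_le.1 (abs_le_of_r0_le hG₀ (le_of_not_ge hs))
    have h2 : radius G₀ φ s₀ / r0 G₀ s₀ ≤ radius G₀ φ s / r0 G₀ s := hmin h1
    rw [← le_div_iff₀ hr]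
    exact (min_le_right _ _).trans h2

theorem noCollision_of_le {G₀ δ : ℝ} (hG₀ : 0 < G₀) (hδ : 0 < δ) {φ : D12}
    (hφ : ∀ s, δ * r0 G₀ s ≤ radius G₀ φ s) : NoCollision G₀ φ :=
  fun s => (mul_pos hδ (r0_pos hG₀ s)).trans_le (hφ s)

/-- Small perturbations of a radius comparable with `r₀` are comparable with `r₀`. -/
theorem exists_le_radius_add {G₀ : ℝ} (hG₀ : 0 < G₀) : ∃ η > 0, ∀ (δ : ℝ) (φ v : D12),
    (∀ s, δ * r0 G₀ s ≤ radius G₀ φ s) → ‖v‖ ≤ η * δ →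
      ∀ s, δ / 2 * r0 G₀ s ≤ radius G₀ (φ + v) s := by
  obtain ⟨C, hC, h⟩ := D12.exists_abs_eval_le hG₀
  refine ⟨1 / (2 * C), by positivity, fun δ φ v hφ hv s => ?_⟩
  have h1 := abs_le.1 (h v s)
  have h2 : C * ‖v‖ * r0 G₀ s ≤ C * (1 / (2 * C) * δ) * r0 G₀ s := by
    have := r0_pos hG₀ s
    gcongr
  have h3 : C * (1 / (2 * C) * δ) = δ / 2 := by field_simp
  rw [h3] at h2
  rw [radius_add]
  linarith [hφ s]

theorem isOpen_noCollision {G₀ : ℝ} (hG₀ : 0 < G₀) : IsOpen {φ | NoCollision G₀ φ} := by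
  rw [Metric.isOpen_iff]
  intro φ hφ
  obtain ⟨δ, hδ, -, h⟩ := hφ.exists_le hG₀
  obtain ⟨η, hη, h2⟩ := exists_le_radius_add hG₀
  refine ⟨η * δ, by positivity, fun ψ hψ => ?_⟩
  rw [mem_ball_iff_norm] at hψ
  have := h2 δ φ (ψ - φ) h hψ.le
  rw [add_sub_cancel] at this
  exact noCollision_of_le hG₀ (half_pos hδ) this

/-! ### The renormalized potential -/

/-- The constant in the second order estimates along radii larger than `δ r₀`. -/
def quadConst (G₀ g δ : ℝ) : ℝ := 2 / δ ^ 3 + 6 * g / (G₀ ^ 2 * δ ^ 4)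

theorem quadConst_nonneg {G₀ g δ : ℝ} (hg : 0 ≤ g) (hδ : 0 < δ) : 0 ≤ quadConst G₀ g δ := by
  unfold quadConst; positivity

theorem quad_le_quadConst {G₀ g δ : ℝ} (hG₀ : 0 < G₀) (hg : 0 ≤ g) (hδ : 0 < δ) (s : ℝ) :
    2 / (δ * r0 G₀ s) ^ 3 + 3 * g / (δ * r0 G₀ s) ^ 4 ≤ quadConst G₀ g δ / r0 G₀ s ^ 3 := by
  have h1 := half_sq_le_r0 G₀ s
  have h2 := r0_pos hG₀ s
  unfold quadConst
  rw [add_div]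
  refine add_le_add (le_of_eq (by field_simp)) ?_
  rw [div_div, div_le_div_iff₀ (by positivity) (by positivity)]
  have e : 6 * g * (δ * r0 G₀ s) ^ 4 = 6 * g * δ ^ 4 * r0 G₀ s ^ 3 * r0 G₀ s := by ring
  have e2 : 3 * g * (G₀ ^ 2 * δ ^ 4 * r0 G₀ s ^ 3)
    = 6 * g * δ ^ 4 * r0 G₀ s ^ 3 * (G₀ ^ 2 / 2) := by ring
  rw [e, e2]
  gcongr

/-- The potential part of the renormalized Lagrangian. -/
def potDiff (G₀ G : ℝ) (φ : D12) (s : ℝ) : ℝ :=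
  pot (G ^ 2) (rho s) (radius G₀ φ s) - pot (G₀ ^ 2) 0 (r0 G₀ s)
    - force (G₀ ^ 2) 0 (r0 G₀ s) * φ.eval s

/-- The force along `φ`, minus the one along the parabolic orbit. -/
def forceDiff (G₀ G : ℝ) (φ : D12) (s : ℝ) : ℝ :=
  force (G ^ 2) (rho s) (radius G₀ φ s) - force (G₀ ^ 2) 0 (r0 G₀ s)

theorem deriv_deriv_r0_eq_force {G₀ : ℝ} (hG₀ : 0 < G₀) (s : ℝ) :
    deriv (deriv (r0 G₀)) s = force (G₀ ^ 2) 0 (r0 G₀ s) := by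
  rw [deriv_deriv_r0 hG₀, force_zero_right _ (r0_pos hG₀ s)]

theorem renLagrangian_eq {G₀ : ℝ} (hG₀ : 0 < G₀) (G : ℝ) (φ : D12) (s : ℝ) :
    renLagrangian G₀ G φ s = 1 / 2 * φ.weakDeriv s ^ 2 + potDiff G₀ G φ s := by
  unfold renLagrangian potDiff
  rw [effPotential_eq, deriv_deriv_r0_eq_force hG₀, pot_zero_right _ (r0_pos hG₀ s)]
  ring

theorem continuous_pot {g : ℝ} {p x : ℝ → ℝ} (hp : Continuous p) (hx : Continuous x)
    (h : ∀ s, 0 < x s) : Continuous fun s => pot g (p s) (x s) := by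
  unfold pot
  have h1 : ∀ s, √(x s ^ 2 + p s ^ 2) ≠ 0 := fun s =>
    ((h s).trans_le (le_sqrt_sq_add (h s) (p s))).ne'
  have h2 : ∀ s, 2 * x s ^ 2 ≠ 0 := fun s => by have := h s; positivity
  exact (continuous_const.div (by fun_prop) h1).sub (continuous_const.div (by fun_prop) h2)

theorem continuous_force {g : ℝ} {p x : ℝ → ℝ} (hp : Continuous p) (hx : Continuous x)
    (h : ∀ s, 0 < x s) : Continuous fun s => force g (p s) (x s) := by
  unfold force
  have h1 : ∀ s, √(x s ^ 2 + p s ^ 2) ^ 3 ≠ 0 := fun s => pow_ne_zero _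
    ((h s).trans_le (le_sqrt_sq_add (h s) (p s))).ne'
  have h2 : ∀ s, x s ^ 3 ≠ 0 := fun s => by have := h s; positivity
  exact (continuous_const.div (by fun_prop) h2).sub (hx.div (by fun_prop) h1)

theorem continuous_potDiff {G₀ : ℝ} (hG₀ : 0 < G₀) (G : ℝ) {φ : D12} (hφ : NoCollision G₀ φ) :
    Continuous (potDiff G₀ G φ) :=
  ((continuous_pot continuous_rho (continuous_radius hG₀ φ) hφ).sub
    (continuous_pot continuous_const (continuous_r0 hG₀) (r0_pos hG₀))).sub
    ((continuous_force continuous_const (continuous_r0 hG₀) (r0_pos hG₀)).mul φ.continuous_eval)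

theorem continuous_forceDiff {G₀ : ℝ} (hG₀ : 0 < G₀) (G : ℝ) {φ : D12}
    (hφ : NoCollision G₀ φ) : Continuous (forceDiff G₀ G φ) :=
  (continuous_force continuous_rho (continuous_radius hG₀ φ) hφ).sub
    (continuous_force continuous_const (continuous_r0 hG₀) (r0_pos hG₀))

/-- The potential is first replaced by the two-body one at the same radius, an error `O(1/r₀²)`; the
two-body potential is then expanded at `r₀`, with remainder `O(φ²/r₀³)`. -/
theorem abs_potDiff_le {G₀ : ℝ} (hG₀ : 0 < G₀) (G : ℝ) {δ : ℝ} (hδ : 0 < δ) (hδ1 : δ ≤ 1)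
    {φ : D12} {s : ℝ} (hφ : δ * r0 G₀ s ≤ radius G₀ φ s) :
    |potDiff G₀ G φ s| ≤ (1 + G ^ 2 + G₀ ^ 2) / δ ^ 2 / r0 G₀ s ^ 2 +
      quadConst G₀ (G₀ ^ 2) δ * (φ.eval s ^ 2 / r0 G₀ s ^ 3) := by
  have hr0 := r0_pos hG₀ s
  have hr : 0 < radius G₀ φ s := (mul_pos hδ hr0).trans_le hφ
  have hle : δ * r0 G₀ s ≤ r0 G₀ s := mul_le_of_le_one_left hr0.le hδ1
  have h1 := abs_pot_sub_pot_le (sq_nonneg G) (sq_nonneg G₀) (rho_nonneg s) (rho_le_one s) hr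
  have h2 := abs_pot_taylor_le (p := 0) (sq_nonneg G₀) (by positivity) hle hφ
  have h3 : (1 + G ^ 2 + G₀ ^ 2) / radius G₀ φ s ^ 2
      ≤ (1 + G ^ 2 + G₀ ^ 2) / δ ^ 2 / r0 G₀ s ^ 2 := by
    rw [div_div, ← mul_pow]; gcongr
  have h4 := mul_le_mul_of_nonneg_right (quad_le_quadConst hG₀ (sq_nonneg G₀) hδ s)
    (sq_nonneg (φ.eval s))
  have e : radius G₀ φ s - r0 G₀ s = φ.eval s := by unfold radius; ring
  rw [e] at h2
  have e2 : potDiff G₀ G φ s = (pot (G ^ 2) (rho s) (radius G₀ φ s)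
      - pot (G₀ ^ 2) 0 (radius G₀ φ s)) + (pot (G₀ ^ 2) 0 (radius G₀ φ s)
      - pot (G₀ ^ 2) 0 (r0 G₀ s) - force (G₀ ^ 2) 0 (r0 G₀ s) * φ.eval s) := by
    unfold potDiff; ring
  rw [e2]
  refine (abs_add_le _ _).trans (add_le_add (h1.trans h3) (h2.trans (h4.trans (le_of_eq ?_))))
  ring

theorem integrable_potDiff {G₀ : ℝ} (hG₀ : 0 < G₀) (G : ℝ) {φ : D12} (hφ : NoCollision G₀ φ) :
    Integrable (potDiff G₀ G φ) := by
  obtain ⟨δ, hδ, hδ1, h⟩ := hφ.exists_le hG₀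
  obtain ⟨C, -, hC⟩ := D12.exists_hardy hG₀
  refine (((integrable_inv_r0_sq hG₀).const_mul ((1 + G ^ 2 + G₀ ^ 2) / δ ^ 2)).add
    ((hC φ).1.const_mul (quadConst G₀ (G₀ ^ 2) δ))).mono'
    (continuous_potDiff hG₀ G hφ).aestronglyMeasurable (Eventually.of_forall fun s => ?_)
  refine (abs_potDiff_le hG₀ G hδ hδ1 (h s)).trans (le_of_eq ?_)
  simp only [Pi.add_apply]
  ring

theorem integrable_renLagrangian {G₀ : ℝ} (hG₀ : 0 < G₀) (G : ℝ) {φ : D12}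
    (hφ : NoCollision G₀ φ) : Integrable (renLagrangian G₀ G φ) := by
  rw [funext (renLagrangian_eq hG₀ G φ)]
  exact (φ.integrable_weakDeriv_sq.const_mul _).add (integrable_potDiff hG₀ G hφ)

theorem action_eq {G₀ : ℝ} (hG₀ : 0 < G₀) (G : ℝ) {φ : D12} (hφ : NoCollision G₀ φ) :
    action G₀ G φ = 1 / 2 * ‖φ.weakDeriv‖ ^ 2 + ∫ s, potDiff G₀ G φ s := by
  unfold action
  rw [funext (renLagrangian_eq hG₀ G φ),
    integral_add (φ.integrable_weakDeriv_sq.const_mul _) (integrable_potDiff hG₀ G hφ),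
    integral_const_mul, D12.norm_weakDeriv_sq]

/-- The weighted Cauchy-Schwarz inequality that goes with Hardy's inequality. -/
theorem exists_hardy_mul {G₀ : ℝ} (hG₀ : 0 < G₀) :
    ∃ C > 0, ∀ φ v : D12, Integrable (fun s => |φ.eval s| * |v.eval s| / r0 G₀ s ^ 3) ∧
      ∫ s, |φ.eval s| * |v.eval s| / r0 G₀ s ^ 3 ≤ C * ‖φ‖ * ‖v‖ := by
  obtain ⟨C, hC, h⟩ := D12.exists_hardy hG₀
  have hint : ∀ φ v : D12, Integrable (fun s => |φ.eval s| * |v.eval s| / r0 G₀ s ^ 3) := by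
    intro φ v
    refine ((h φ).1.add (h v).1).mono' ?_ (Eventually.of_forall fun s => ?_)
    · exact (((φ.continuous_eval.abs).mul v.continuous_eval.abs).div ((continuous_r0 hG₀).pow 3)
        fun s => pow_ne_zero _ (r0_pos hG₀ s).ne').aestronglyMeasurable
    · have := r0_pos hG₀ s
      rw [Real.norm_of_nonneg (by positivity), Pi.add_apply, ← add_div]
      gcongr
      nlinarith [sq_nonneg (|φ.eval s| - |v.eval s|), sq_abs (φ.eval s), sq_abs (v.eval s)]
  refine ⟨C, hC, fun φ v => ⟨hint φ v, ?_⟩⟩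
  rcases eq_or_lt_of_le (norm_nonneg φ) with h0 | h0
  · have hz : φ = 0 := norm_eq_zero.1 h0.symm
    have : ∀ s, φ.eval s = 0 := fun s => by
      rw [hz, ← zero_smul ℝ (0 : D12), D12.eval_smul, zero_mul]
    simp [this, ← h0]
  rcases eq_or_lt_of_le (norm_nonneg v) with h1 | h1
  · have hz : v = 0 := norm_eq_zero.1 h1.symm
    have : ∀ s, v.eval s = 0 := fun s => by
      rw [hz, ← zero_smul ℝ (0 : D12), D12.eval_smul, zero_mul]
    simp [this, ← h1]
  -- This weight balances the two terms of Young's inequality.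
  set t := ‖v‖ / ‖φ‖
  have ht : 0 < t := by positivity
  calc ∫ s, |φ.eval s| * |v.eval s| / r0 G₀ s ^ 3
      ≤ ∫ s, (t / 2 * (φ.eval s ^ 2 / r0 G₀ s ^ 3) + 1 / (2 * t) * (v.eval s ^ 2 / r0 G₀ s ^ 3)) := by
        refine integral_mono (hint φ v)
          (((h φ).1.const_mul _).add ((h v).1.const_mul _)) fun s => ?_
        have := r0_pos hG₀ s
        have e : t / 2 * (φ.eval s ^ 2 / r0 G₀ s ^ 3) + 1 / (2 * t) * (v.eval s ^ 2 / r0 G₀ s ^ 3)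
          = (t / 2 * |φ.eval s| ^ 2 + 1 / (2 * t) * |v.eval s| ^ 2) / r0 G₀ s ^ 3 := by
          rw [sq_abs, sq_abs]; ring
        simp only [e]
        gcongr
        have e2 : t / 2 * |φ.eval s| ^ 2 + 1 / (2 * t) * |v.eval s| ^ 2 - |φ.eval s| * |v.eval s|
          = (t * |φ.eval s| - |v.eval s|) ^ 2 / (2 * t) := by field_simp; ring
        have : 0 ≤ (t * |φ.eval s| - |v.eval s|) ^ 2 / (2 * t) := by positivity
        linarith
    _ = t / 2 * (∫ s, φ.eval s ^ 2 / r0 G₀ s ^ 3) + 1 / (2 * t) * ∫ s, v.eval s ^ 2 / r0 G₀ s ^ 3 := by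
        rw [integral_add ((h φ).1.const_mul _) ((h v).1.const_mul _), integral_const_mul,
          integral_const_mul]
    _ ≤ t / 2 * (C * ‖φ‖ ^ 2) + 1 / (2 * t) * (C * ‖v‖ ^ 2) := by
        gcongr
        · exact (h φ).2
        · exact (h v).2
    _ = C * ‖φ‖ * ‖v‖ := by simp only [t]; field_simp; ring

theorem abs_forceDiff_le {G₀ : ℝ} (hG₀ : 0 < G₀) (G : ℝ) {δ : ℝ} (hδ : 0 < δ) (hδ1 : δ ≤ 1)
    {φ : D12} (hφ : ∀ s, δ * r0 G₀ s ≤ radius G₀ φ s) (s : ℝ) :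
    |forceDiff G₀ G φ s| ≤ (3 + G ^ 2 + G₀ ^ 2) / δ ^ 3 / r0 G₀ s ^ 3 +
      quadConst G₀ (G₀ ^ 2) δ * (|φ.eval s| / r0 G₀ s ^ 3) := by
  have hr0 := r0_pos hG₀ s
  have hr : 0 < radius G₀ φ s := noCollision_of_le hG₀ hδ hφ s
  have hle : δ * r0 G₀ s ≤ r0 G₀ s := mul_le_of_le_one_left hr0.le hδ1
  have h1 := abs_force_sub_force_le (sq_nonneg G) (sq_nonneg G₀) (rho_nonneg s) (rho_le_one s) hr
  have h2 := abs_force_sub_le (p := 0) (sq_nonneg G₀) (by positivity) hle (hφ s)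
  have h3 : (3 + G ^ 2 + G₀ ^ 2) / radius G₀ φ s ^ 3
      ≤ (3 + G ^ 2 + G₀ ^ 2) / δ ^ 3 / r0 G₀ s ^ 3 := by
    rw [div_div, ← mul_pow]; gcongr; exact hφ s
  have h4 := mul_le_mul_of_nonneg_right (quad_le_quadConst hG₀ (sq_nonneg G₀) hδ s)
    (abs_nonneg (φ.eval s))
  have e : radius G₀ φ s - r0 G₀ s = φ.eval s := by unfold radius; ring
  rw [e] at h2
  have e2 : forceDiff G₀ G φ s = (force (G ^ 2) (rho s) (radius G₀ φ s)
      - force (G₀ ^ 2) 0 (radius G₀ φ s)) + (force (G₀ ^ 2) 0 (radius G₀ φ s)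
      - force (G₀ ^ 2) 0 (r0 G₀ s)) := by
    unfold forceDiff; ring
  rw [e2]
  refine (abs_add_le _ _).trans (add_le_add (h1.trans h3) (h2.trans (h4.trans (le_of_eq ?_))))
  ring

/-- The force difference has a part of order `1/r₀³`, paired with `|v| ≲ ‖v‖ r₀`, and a part of
order `|φ|/r₀³`, paired with `v` by the weighted Cauchy-Schwarz inequality. -/
theorem exists_forceDiff_mul_le {G₀ : ℝ} (hG₀ : 0 < G₀) (G : ℝ) {φ : D12}
    (hφ : NoCollision G₀ φ) : ∃ C, ∀ v : D12,
      Integrable (fun s => forceDiff G₀ G φ s * v.eval s) ∧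
      |∫ s, forceDiff G₀ G φ s * v.eval s| ≤ C * ‖v‖ := by
  obtain ⟨δ, hδ, hδ1, h⟩ := hφ.exists_le hG₀
  obtain ⟨C, hC, hCm⟩ := exists_hardy_mul hG₀
  obtain ⟨C', hC', hle⟩ := D12.exists_abs_eval_le hG₀
  set A := (3 + G ^ 2 + G₀ ^ 2) / δ ^ 3
  set B := quadConst G₀ (G₀ ^ 2) δ
  have hA : 0 ≤ A := by positivity
  have hB : 0 ≤ B := quadConst_nonneg (sq_nonneg G₀) hδ
  have hi : ∀ v : D12, Integrable fun s => A * (C' * ‖v‖) * (1 / r0 G₀ s ^ 2) +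
      B * (|φ.eval s| * |v.eval s| / r0 G₀ s ^ 3) := fun v =>
    ((integrable_inv_r0_sq hG₀).const_mul _).add ((hCm φ v).1.const_mul B)
  have hb : ∀ (v : D12) (s : ℝ), ‖forceDiff G₀ G φ s * v.eval s‖ ≤
      A * (C' * ‖v‖) * (1 / r0 G₀ s ^ 2) + B * (|φ.eval s| * |v.eval s| / r0 G₀ s ^ 3) := by
    intro v s
    have hr0 := r0_pos hG₀ s
    rw [Real.norm_eq_abs, abs_mul]
    calc |forceDiff G₀ G φ s| * |v.eval s|
        ≤ (A / r0 G₀ s ^ 3 + B * (|φ.eval s| / r0 G₀ s ^ 3)) * |v.eval s| := by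
          gcongr; exact abs_forceDiff_le hG₀ G hδ hδ1 h s
      _ = A / r0 G₀ s ^ 3 * |v.eval s| + B * (|φ.eval s| * |v.eval s| / r0 G₀ s ^ 3) := by ring
      _ ≤ A / r0 G₀ s ^ 3 * (C' * ‖v‖ * r0 G₀ s)
          + B * (|φ.eval s| * |v.eval s| / r0 G₀ s ^ 3) := by gcongr; exact hle v s
      _ = _ := by field_simp
  refine ⟨A * C' * (∫ s, 1 / r0 G₀ s ^ 2) + B * (C * ‖φ‖), fun v => ⟨(hi v).mono'
    (((continuous_forceDiff hG₀ G hφ).mul v.continuous_eval).aestronglyMeasurable)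
    (Eventually.of_forall (hb v)), ?_⟩⟩
  calc |∫ s, forceDiff G₀ G φ s * v.eval s|
      ≤ ∫ s, (A * (C' * ‖v‖) * (1 / r0 G₀ s ^ 2)
        + B * (|φ.eval s| * |v.eval s| / r0 G₀ s ^ 3)) :=
        norm_integral_le_of_norm_le (hi v) (Eventually.of_forall (hb v))
    _ = A * (C' * ‖v‖) * (∫ s, 1 / r0 G₀ s ^ 2)
        + B * ∫ s, |φ.eval s| * |v.eval s| / r0 G₀ s ^ 3 := by
        rw [integral_add ((integrable_inv_r0_sq hG₀).const_mul _) ((hCm φ v).1.const_mul B),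
          integral_const_mul, integral_const_mul]
    _ ≤ A * (C' * ‖v‖) * (∫ s, 1 / r0 G₀ s ^ 2) + B * (C * ‖φ‖ * ‖v‖) := by
        gcongr; exact (hCm φ v).2
    _ = _ := by ring

/-! ### The first variation -/

/-- The first variation of the action at `φ` in the direction `v`. -/
def firstVar (G₀ G : ℝ) (φ v : D12) : ℝ :=
  inner ℝ φ.weakDeriv v.weakDeriv + ∫ s, forceDiff G₀ G φ s * v.eval s

theorem exists_clm_firstVar {G₀ : ℝ} (hG₀ : 0 < G₀) (G : ℝ) {φ : D12} (hφ : NoCollision G₀ φ) :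
    ∃ L : D12 →L[ℝ] ℝ, ∀ v, L v = firstVar G₀ G φ v := by
  obtain ⟨C, hC⟩ := exists_forceDiff_mul_le hG₀ G hφ
  let L : D12 →ₗ[ℝ] ℝ :=
    { toFun := firstVar G₀ G φ
      map_add' := fun v w => by
        have e : (v + w).weakDeriv = v.weakDeriv + w.weakDeriv := rfl
        simp only [firstVar, e, inner_add_right, D12.eval_add, mul_add]
        rw [integral_add (hC v).1 (hC w).1]
        ring
      map_smul' := fun c v => by
        have e : (c • v).weakDeriv = c • v.weakDeriv := rfl
        have e2 : ∀ s, forceDiff G₀ G φ s * (c * v.eval s) = c * (forceDiff G₀ G φ s * v.eval s) :=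
          fun s => by ring
        simp only [firstVar, e, inner_smul_right, D12.eval_smul, e2, integral_const_mul,
          RingHom.id_apply, smul_eq_mul]
        ring }
  refine ⟨L.mkContinuous (‖φ‖ + C) fun v => ?_, fun v => rfl⟩
  have h1 : |inner ℝ φ.weakDeriv v.weakDeriv| ≤ ‖φ‖ * ‖v‖ :=
    (abs_real_inner_le_norm _ _).trans (mul_le_mul φ.norm_weakDeriv_le v.norm_weakDeriv_le
      (norm_nonneg _) (norm_nonneg _))
  calc ‖L v‖ ≤ |inner ℝ φ.weakDeriv v.weakDeriv| + |∫ s, forceDiff G₀ G φ s * v.eval s| :=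
        abs_add_le _ _
    _ ≤ ‖φ‖ * ‖v‖ + C * ‖v‖ := add_le_add h1 (hC v).2
    _ = _ := by ring

/-- Second order Taylor estimate for the action. -/
theorem exists_action_taylor {G₀ : ℝ} (hG₀ : 0 < G₀) (G : ℝ) {δ : ℝ} (hδ : 0 < δ) :
    ∃ C > 0, ∀ φ v : D12, (∀ s, δ * r0 G₀ s ≤ radius G₀ φ s) →
      (∀ s, δ * r0 G₀ s ≤ radius G₀ (φ + v) s) →
      |action G₀ G (φ + v) - action G₀ G φ - firstVar G₀ G φ v| ≤ C * ‖v‖ ^ 2 := by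
  obtain ⟨C, hC, hH⟩ := D12.exists_hardy hG₀
  have hB : 0 ≤ quadConst G₀ (G ^ 2) δ := quadConst_nonneg (sq_nonneg G) hδ
  refine ⟨1 / 2 + quadConst G₀ (G ^ 2) δ * C, by positivity, fun φ v hφ hφv => ?_⟩
  have h1 := noCollision_of_le hG₀ hδ hφ
  have h2 := noCollision_of_le hG₀ hδ hφv
  obtain ⟨C', hC'⟩ := exists_forceDiff_mul_le hG₀ G h1
  rw [action_eq hG₀ G h1, action_eq hG₀ G h2, firstVar]
  have e1 : (φ + v).weakDeriv = φ.weakDeriv + v.weakDeriv := rfl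
  rw [e1, norm_add_sq_real]
  have e2 : 1 / 2 * (‖φ.weakDeriv‖ ^ 2 + 2 * inner ℝ φ.weakDeriv v.weakDeriv + ‖v.weakDeriv‖ ^ 2)
      + (∫ s, potDiff G₀ G (φ + v) s) - (1 / 2 * ‖φ.weakDeriv‖ ^ 2 + ∫ s, potDiff G₀ G φ s)
      - (inner ℝ φ.weakDeriv v.weakDeriv + ∫ s, forceDiff G₀ G φ s * v.eval s)
      = 1 / 2 * ‖v.weakDeriv‖ ^ 2 +
        ∫ s, (potDiff G₀ G (φ + v) s - potDiff G₀ G φ s - forceDiff G₀ G φ s * v.eval s) := by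
    have hi : Integrable fun s => potDiff G₀ G (φ + v) s - potDiff G₀ G φ s :=
      (integrable_potDiff hG₀ G h2).sub (integrable_potDiff hG₀ G h1)
    rw [integral_sub hi (hC' v).1, integral_sub (integrable_potDiff hG₀ G h2) (integrable_potDiff hG₀ G h1)]
    ring
  rw [e2]
  have h3 : |∫ s, (potDiff G₀ G (φ + v) s - potDiff G₀ G φ s - forceDiff G₀ G φ s * v.eval s)|
      ≤ ∫ s, quadConst G₀ (G ^ 2) δ * (v.eval s ^ 2 / r0 G₀ s ^ 3) := by
    rw [← Real.norm_eq_abs]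
    refine norm_integral_le_of_norm_le ((hH v).1.const_mul _) (Eventually.of_forall fun s => ?_)
    have hr0 := r0_pos hG₀ s
    have h4 := abs_pot_taylor_le (p := rho s) (sq_nonneg G) (by positivity) (hφ s) (hφv s)
    have h5 := mul_le_mul_of_nonneg_right (quad_le_quadConst hG₀ (sq_nonneg G) hδ s)
      (sq_nonneg (v.eval s))
    have e3 : radius G₀ (φ + v) s - radius G₀ φ s = v.eval s := by rw [radius_add]; ring
    rw [e3] at h4
    have e4 : potDiff G₀ G (φ + v) s - potDiff G₀ G φ s - forceDiff G₀ G φ s * v.eval s =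
      pot (G ^ 2) (rho s) (radius G₀ (φ + v) s) - pot (G ^ 2) (rho s) (radius G₀ φ s)
        - force (G ^ 2) (rho s) (radius G₀ φ s) * v.eval s := by
      unfold potDiff forceDiff; rw [D12.eval_add]; ring
    rw [e4, Real.norm_eq_abs]
    refine (h4.trans h5).trans (le_of_eq (by ring))
  rw [integral_const_mul] at h3
  have h6 : ‖v.weakDeriv‖ ^ 2 ≤ ‖v‖ ^ 2 := by gcongr; exact v.norm_weakDeriv_le
  calc _ ≤ |1 / 2 * ‖v.weakDeriv‖ ^ 2| + _ := abs_add_le _ _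
    _ ≤ 1 / 2 * ‖v‖ ^ 2 + quadConst G₀ (G ^ 2) δ * (C * ‖v‖ ^ 2) := by
        refine add_le_add ?_ (h3.trans (mul_le_mul_of_nonneg_left (hH v).2 hB))
        rw [abs_of_nonneg (by positivity)]
        linarith
    _ = _ := by ring

theorem exists_hasFDerivAt_action {G₀ : ℝ} (hG₀ : 0 < G₀) (G : ℝ) {φ : D12}
    (hφ : NoCollision G₀ φ) : ∃ L : D12 →L[ℝ] ℝ, (∀ v, L v = firstVar G₀ G φ v) ∧
      HasFDerivAt (action G₀ G) L φ := by
  obtain ⟨L, hL⟩ := exists_clm_firstVar hG₀ G hφ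
  obtain ⟨δ, hδ, -, h⟩ := hφ.exists_le hG₀
  obtain ⟨η, hη, h2⟩ := exists_le_radius_add hG₀
  obtain ⟨C, hC, hT⟩ := exists_action_taylor hG₀ G (half_pos hδ)
  have hφ' : ∀ s, δ / 2 * r0 G₀ s ≤ radius G₀ φ s := fun s => by
    have := h s
    have := r0_pos hG₀ s
    nlinarith
  refine ⟨L, hL, ?_⟩
  rw [hasFDerivAt_iff_isLittleO_nhds_zero, Asymptotics.isLittleO_iff]
  intro c hc
  have hpos : 0 < min (η * δ) (c / C) := by positivity
  filter_upwards [Metric.ball_mem_nhds (0 : D12) hpos] with v hv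
  rw [mem_ball_zero_iff, lt_min_iff] at hv
  rw [hL, Real.norm_eq_abs]
  refine (hT φ v hφ' (h2 δ φ v h hv.1.le)).trans ?_
  have := (le_div_iff₀ hC).1 hv.2.le
  nlinarith [norm_nonneg v]

theorem hasFDerivAt_action {G₀ : ℝ} (hG₀ : 0 < G₀) (G : ℝ) {φ : D12} (hφ : NoCollision G₀ φ) :
    HasFDerivAt (action G₀ G) (fderiv ℝ (action G₀ G) φ) φ := by
  obtain ⟨L, -, h⟩ := exists_hasFDerivAt_action hG₀ G hφ
  exact h.differentiableAt.hasFDerivAt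

theorem fderiv_action_apply {G₀ : ℝ} (hG₀ : 0 < G₀) (G : ℝ) {φ : D12} (hφ : NoCollision G₀ φ)
    (v : D12) : fderiv ℝ (action G₀ G) φ v = firstVar G₀ G φ v := by
  obtain ⟨L, hL, h⟩ := exists_hasFDerivAt_action hG₀ G hφ
  rw [h.fderiv, hL]

theorem isCriticalPoint_iff {G₀ : ℝ} (hG₀ : 0 < G₀) (G : ℝ) (φ : D12) :
    IsCriticalPoint G₀ G φ ↔ NoCollision G₀ φ ∧ ∀ v, firstVar G₀ G φ v = 0 := by
  refine and_congr_right fun hφ => ⟨fun h v => ?_, fun h => ?_⟩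
  · rw [← fderiv_action_apply hG₀ G hφ, h.fderiv]; rfl
  · have := hasFDerivAt_action hG₀ G hφ
    rwa [show fderiv ℝ (action G₀ G) φ = 0 from
      ContinuousLinearMap.ext fun v => by rw [fderiv_action_apply hG₀ G hφ, h v]; rfl] at this

/-- The first variation is Lipschitz along radii that are comparable with `r₀`. -/
theorem exists_firstVar_lipschitz {G₀ : ℝ} (hG₀ : 0 < G₀) (G : ℝ) {δ : ℝ} (hδ : 0 < δ) :
    ∃ C > 0, ∀ φ ψ v : D12, (∀ s, δ * r0 G₀ s ≤ radius G₀ φ s) →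
      (∀ s, δ * r0 G₀ s ≤ radius G₀ ψ s) →
      |firstVar G₀ G ψ v - firstVar G₀ G φ v| ≤ C * ‖ψ - φ‖ * ‖v‖ := by
  obtain ⟨C, hC, hH⟩ := exists_hardy_mul hG₀
  have hB : 0 ≤ quadConst G₀ (G ^ 2) δ := quadConst_nonneg (sq_nonneg G) hδ
  refine ⟨1 + quadConst G₀ (G ^ 2) δ * C, by positivity, fun φ ψ v hφ hψ => ?_⟩
  obtain ⟨_, h1⟩ := exists_forceDiff_mul_le hG₀ G (noCollision_of_le hG₀ hδ hφ)
  obtain ⟨_, h2⟩ := exists_forceDiff_mul_le hG₀ G (noCollision_of_le hG₀ hδ hψ)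
  have e1 : (ψ - φ).weakDeriv = ψ.weakDeriv - φ.weakDeriv := rfl
  have e : firstVar G₀ G ψ v - firstVar G₀ G φ v = inner ℝ (ψ - φ).weakDeriv v.weakDeriv +
      ∫ s, (forceDiff G₀ G ψ s * v.eval s - forceDiff G₀ G φ s * v.eval s) := by
    rw [e1, inner_sub_left, integral_sub (h2 v).1 (h1 v).1, firstVar, firstVar]; ring
  rw [e]
  have h3 : |∫ s, (forceDiff G₀ G ψ s * v.eval s - forceDiff G₀ G φ s * v.eval s)|
      ≤ ∫ s, quadConst G₀ (G ^ 2) δ * (|(ψ - φ).eval s| * |v.eval s| / r0 G₀ s ^ 3) := by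
    rw [← Real.norm_eq_abs]
    refine norm_integral_le_of_norm_le ((hH _ v).1.const_mul _) (Eventually.of_forall fun s => ?_)
    have hr0 := r0_pos hG₀ s
    have h4 := abs_force_sub_le (p := rho s) (sq_nonneg G) (by positivity) (hφ s) (hψ s)
    have h5 := mul_le_mul_of_nonneg_right (quad_le_quadConst hG₀ (sq_nonneg G) hδ s)
      (abs_nonneg ((ψ - φ).eval s))
    have e3 : radius G₀ ψ s - radius G₀ φ s = (ψ - φ).eval s := by
      rw [D12.eval_sub]; unfold radius; ring
    rw [e3] at h4
    have e4 : forceDiff G₀ G ψ s * v.eval s - forceDiff G₀ G φ s * v.eval s =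
      (force (G ^ 2) (rho s) (radius G₀ ψ s) - force (G ^ 2) (rho s) (radius G₀ φ s))
        * v.eval s := by
      unfold forceDiff; ring
    rw [e4, Real.norm_eq_abs, abs_mul]
    refine (mul_le_mul_of_nonneg_right (h4.trans h5) (abs_nonneg _)).trans (le_of_eq (by ring))
  rw [integral_const_mul] at h3
  calc _ ≤ |inner ℝ (ψ - φ).weakDeriv v.weakDeriv| + _ := abs_add_le _ _
    _ ≤ ‖ψ - φ‖ * ‖v‖ + quadConst G₀ (G ^ 2) δ * (C * ‖ψ - φ‖ * ‖v‖) :=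
        add_le_add ((abs_real_inner_le_norm _ _).trans (mul_le_mul (ψ - φ).norm_weakDeriv_le
          v.norm_weakDeriv_le (norm_nonneg _) (norm_nonneg _)))
          (h3.trans (mul_le_mul_of_nonneg_left (hH _ v).2 hB))
    _ = _ := by ring

/-- With this continuity a direction of descent at one point remains one nearby, and limits of
Palais-Smale sequences are critical. -/
theorem tendsto_firstVar {G₀ : ℝ} (hG₀ : 0 < G₀) (G : ℝ) {φ : D12} (hφ : NoCollision G₀ φ)
    (v : D12) : Tendsto (fun ψ => firstVar G₀ G ψ v) (𝓝 φ) (𝓝 (firstVar G₀ G φ v)) := by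
  obtain ⟨δ, hδ, -, h⟩ := hφ.exists_le hG₀
  obtain ⟨η, hη, h2⟩ := exists_le_radius_add hG₀
  obtain ⟨C, hC, hT⟩ := exists_firstVar_lipschitz hG₀ G (half_pos hδ)
  have hφ' : ∀ s, δ / 2 * r0 G₀ s ≤ radius G₀ φ s := fun s => by
    have := h s
    have := r0_pos hG₀ s
    nlinarith
  rw [tendsto_iff_norm_sub_tendsto_zero]
  have hlim : Tendsto (fun ψ : D12 => C * ‖ψ - φ‖ * ‖v‖) (𝓝 φ) (𝓝 0) := by
    have : Continuous fun ψ : D12 => C * ‖ψ - φ‖ * ‖v‖ := by fun_prop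
    simpa using this.tendsto φ
  refine squeeze_zero' (Eventually.of_forall fun _ => norm_nonneg _) ?_ hlim
  filter_upwards [Metric.ball_mem_nhds φ (by positivity : 0 < η * δ)] with ψ hψ
  rw [mem_ball_iff_norm] at hψ
  have h3 := h2 δ φ (ψ - φ) h hψ.le
  rw [add_sub_cancel] at h3
  exact hT φ ψ v hφ' h3

theorem continuousAt_action {G₀ : ℝ} (hG₀ : 0 < G₀) (G : ℝ) {φ : D12} (hφ : NoCollision G₀ φ) :
    ContinuousAt (action G₀ G) φ := (hasFDerivAt_action hG₀ G hφ).continuousAt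

/-! ### Invariance of the action under the period of the primaries -/

theorem r0_le_mul_r0 {G₀ : ℝ} (hG₀ : 0 < G₀) (s t : ℝ) :
    r0 G₀ s ≤ (1 + 4 / G₀ ^ 3 * |s - t|) * r0 G₀ t := by
  have h1 := (abs_le.1 (abs_r0_sub_le hG₀ s t)).2
  have h2 := half_sq_le_r0 G₀ t
  have h3 : 2 / G₀ * |s - t| ≤ 4 / G₀ ^ 3 * |s - t| * r0 G₀ t := by
    calc 2 / G₀ * |s - t| = 4 / G₀ ^ 3 * |s - t| * (G₀ ^ 2 / 2) := by field_simp; ring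
      _ ≤ _ := by gcongr
  linarith

/-- Increments of the velocity of the parabolic orbit. -/
theorem exists_abs_deriv_r0_sub_le {G₀ : ℝ} (hG₀ : 0 < G₀) (a : ℝ) :
    ∃ C > 0, ∀ s, |deriv (r0 G₀) s - deriv (r0 G₀) (s + a)| ≤ C / r0 G₀ s ^ 2 := by
  set κ := 1 + 4 / G₀ ^ 3 * |a|
  have hκ : 0 < κ := by positivity
  refine ⟨3 * κ ^ 2 * |a| + 1, by positivity, fun s => ?_⟩
  have hr := r0_pos hG₀ s
  have h := Convex.norm_image_sub_le_of_norm_hasDerivWithin_le (f := deriv (r0 G₀))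
    (s := uIcc (s + a) s) (C := 3 * κ ^ 2 / r0 G₀ s ^ 2)
    (fun x _ => (hasDerivAt_deriv_r0 hG₀ x).hasDerivWithinAt)
    (fun x hx => ?_) (convex_uIcc _ _) left_mem_uIcc right_mem_uIcc
  · have e : s - (s + a) = -a := by ring
    rw [e, norm_neg, Real.norm_eq_abs, Real.norm_eq_abs] at h
    refine h.trans ?_
    rw [div_mul_eq_mul_div]
    gcongr
    linarith
  · rw [← deriv_deriv_r0 hG₀]
    refine (abs_deriv_deriv_r0_le hG₀ x).trans ?_
    have hx0 := r0_pos hG₀ x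
    have h1 : |s - x| ≤ |a| := by
      have := abs_sub_right_of_mem_uIcc hx
      simpa [abs_sub_comm] using this
    have h2 : r0 G₀ s ≤ κ * r0 G₀ x := (r0_le_mul_r0 hG₀ s x).trans (by simp only [κ]; gcongr)
    rw [div_le_div_iff₀ (by positivity) (by positivity)]
    calc 3 * r0 G₀ s ^ 2 ≤ 3 * (κ * r0 G₀ x) ^ 2 := by gcongr
      _ = _ := by ring

/-- A primitive of the square of the velocity of the parabolic orbit. -/
theorem exists_primitive_deriv_r0_sq {G₀ : ℝ} (hG₀ : 0 < G₀) :
    ∃ P : ℝ → ℝ, (∀ s, HasDerivAt P (deriv (r0 G₀) s ^ 2) s) ∧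
      ∀ a, ∃ C, ∀ s, |P s - P (s + a)| ≤ C / r0 G₀ s := by
  have hc : Continuous fun s => deriv (r0 G₀) s ^ 2 := (continuous_deriv_r0 hG₀).pow 2
  have hP : ∀ s, HasDerivAt (fun s => ∫ t in (0 : ℝ)..s, deriv (r0 G₀) t ^ 2)
      (deriv (r0 G₀) s ^ 2) s := fun s =>
    intervalIntegral.integral_hasDerivAt_right (hc.intervalIntegrable _ _)
      (hc.stronglyMeasurableAtFilter _ _) hc.continuousAt
  refine ⟨_, hP, fun a => ?_⟩
  set κ := 1 + 4 / G₀ ^ 3 * |a|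
  have hκ : 0 < κ := by positivity
  refine ⟨2 * κ * |a|, fun s => ?_⟩
  have hr := r0_pos hG₀ s
  have h := Convex.norm_image_sub_le_of_norm_hasDerivWithin_le
    (f := fun s => ∫ t in (0 : ℝ)..s, deriv (r0 G₀) t ^ 2)
    (s := uIcc (s + a) s) (C := 2 * κ / r0 G₀ s)
    (fun x _ => (hP x).hasDerivWithinAt)
    (fun x hx => ?_) (convex_uIcc _ _) left_mem_uIcc right_mem_uIcc
  · have e : s - (s + a) = -a := by ring
    rw [e, norm_neg, Real.norm_eq_abs, Real.norm_eq_abs] at h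
    refine h.trans ?_
    rw [div_mul_eq_mul_div]
  · have hx0 := r0_pos hG₀ x
    rw [Real.norm_of_nonneg (sq_nonneg _), deriv_r0_sq hG₀]
    have h1 : |s - x| ≤ |a| := by
      have := abs_sub_right_of_mem_uIcc hx
      simpa [abs_sub_comm] using this
    have h2 : r0 G₀ s ≤ κ * r0 G₀ x := (r0_le_mul_r0 hG₀ s x).trans (by simp only [κ]; gcongr)
    have h3 : 0 ≤ G₀ ^ 2 / r0 G₀ x ^ 2 := by positivity
    have h4 : 2 / r0 G₀ x ≤ 2 * κ / r0 G₀ s := by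
      rw [div_le_div_iff₀ (by positivity) (by positivity)]
      calc 2 * r0 G₀ s ≤ 2 * (κ * r0 G₀ x) := by gcongr
        _ = _ := by ring
    linarith

/-- Translating the orbit `r₀ + φ` by `a` shifts `φ` and adds `r₀(· - a) - r₀`. This drift lies in
`D^{1,2}` because its velocity is `O(1/r₀²)`. -/
theorem exists_r0_drift {G₀ : ℝ} (hG₀ : 0 < G₀) (a : ℝ) : ∃ d : D12,
    (∀ s, d.eval s = r0 G₀ (s - a) - r0 G₀ s) ∧
    (d.weakDeriv : ℝ → ℝ) =ᵐ[volume] fun s => deriv (r0 G₀) (s - a) - deriv (r0 G₀) s := by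
  obtain ⟨C, hC, h⟩ := exists_abs_deriv_r0_sub_le hG₀ (-a)
  have hc : Continuous fun s => deriv (r0 G₀) (s - a) - deriv (r0 G₀) s := by
    have := continuous_deriv_r0 hG₀
    fun_prop
  have hm : MemLp (fun s => deriv (r0 G₀) (s - a) - deriv (r0 G₀) s) 2 volume := by
    rw [memLp_two_iff_integrable_sq hc.aestronglyMeasurable]
    refine integrable_of_le_inv_r0_sq hG₀ (hc.pow 2).aestronglyMeasurable
      (C ^ 2 * (4 / G₀ ^ 4)) fun s => ?_
    have hr := r0_pos hG₀ s
    have h1 := half_sq_le_r0 G₀ s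
    rw [abs_of_nonneg (sq_nonneg _), ← sq_abs, abs_sub_comm]
    have h2 := h s
    rw [← sub_eq_add_neg] at h2
    calc _ ≤ (C / r0 G₀ s ^ 2) ^ 2 := by gcongr
      _ = C ^ 2 / r0 G₀ s ^ 2 * (1 / r0 G₀ s ^ 2) := by field_simp
      _ ≤ C ^ 2 / r0 G₀ s ^ 2 * (1 / (G₀ ^ 2 / 2) ^ 2) := by gcongr
      _ = _ := by field_simp; norm_num
  have hp : IsPrimitive (fun s => r0 G₀ (s - a) - r0 G₀ s)
      (fun s => deriv (r0 G₀) (s - a) - deriv (r0 G₀) s) := by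
    refine isPrimitive_of_hasDerivAt (fun s => ?_) hc
    have h1 := (hasDerivAt_r0 hG₀ (s - a)).differentiableAt.hasDerivAt.comp_sub_const s a
    exact h1.sub (hasDerivAt_r0 hG₀ s).differentiableAt.hasDerivAt
  exact ⟨_, fun s => congrFun (D12.eval_ofDeriv_eq hp hm) s, D12.coeFn_weakDeriv_ofDeriv _ hm⟩

theorem tendsto_abs_natCast : Tendsto (fun n : ℕ => |(n : ℝ)|) atTop atTop :=
  tendsto_abs_atTop_atTop.comp tendsto_natCast_atTop_atTop

theorem tendsto_abs_neg_natCast : Tendsto (fun n : ℕ => |(-(n : ℝ))|) atTop atTop := by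
  simpa only [abs_neg] using tendsto_abs_natCast

/-- The action is invariant under translations of the orbit by a multiple of the period. -/
theorem action_translate {G₀ : ℝ} (hG₀ : 0 < G₀) (G : ℝ) (k : ℤ) {d : D12}
    (hd : ∀ s, d.eval s = r0 G₀ (s - k * (2 * Real.pi)) - r0 G₀ s)
    (hd' : (d.weakDeriv : ℝ → ℝ) =ᵐ[volume]
      fun s => deriv (r0 G₀) (s - k * (2 * Real.pi)) - deriv (r0 G₀) s)
    {φ : D12} (hφ : NoCollision G₀ φ) :
    action G₀ G (D12.shift (k * (2 * Real.pi)) φ + d) = action G₀ G φ := by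
  set a : ℝ := k * (2 * Real.pi)
  set ψ := D12.shift a φ + d
  have hrad : ∀ s, radius G₀ ψ (s + a) = radius G₀ φ s := fun s => by
    simp only [ψ, radius, D12.eval_add, D12.eval_shift, hd]; rw [add_sub_cancel_right]; ring
  have hψ : NoCollision G₀ ψ := fun s => by
    have := hrad (s - a); rw [sub_add_cancel] at this; rw [this]; exact hφ _
  have hi1 : Integrable fun s => renLagrangian G₀ G ψ (s + a) :=
    (integrable_renLagrangian hG₀ G hψ).comp_add_right a
  have hi2 := integrable_renLagrangian hG₀ G hφ
  obtain ⟨P, hP, hPa⟩ := exists_primitive_deriv_r0_sq hG₀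
  obtain ⟨C1, hC1⟩ := hPa a
  obtain ⟨C2, -, hC2⟩ := exists_abs_deriv_r0_sub_le hG₀ a
  obtain ⟨C3, hC3, hC3'⟩ := D12.exists_abs_eval_le hG₀
  have h1 : ∀ s, HasDerivAt (r0 G₀) (deriv (r0 G₀) s) s := fun s =>
    (hasDerivAt_r0 hG₀ s).differentiableAt.hasDerivAt
  have h2 : ∀ s, HasDerivAt (deriv (r0 G₀)) (deriv (deriv (r0 G₀)) s) s := fun s =>
    (hasDerivAt_deriv_r0 hG₀ s).differentiableAt.hasDerivAt
  have c1 := continuous_deriv_r0 hG₀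
  have c2 := continuous_deriv_deriv_r0 hG₀
  have c0 := continuous_r0 hG₀
  -- By periodicity of `ρ` and zero energy of `r₀`, the two renormalized Lagrangians, taken at
  -- corresponding times, differ by the derivative of `φ D + E`. The two actions therefore differ by
  -- boundary terms only.
  set D : ℝ → ℝ := fun s => deriv (r0 G₀) s - deriv (r0 G₀) (s + a)
  have pD : IsPrimitive D (fun s => deriv (deriv (r0 G₀)) s - deriv (deriv (r0 G₀)) (s + a)) :=
    isPrimitive_of_hasDerivAt (fun s => (h2 s).sub ((h2 (s + a)).comp_add_const s a))
      (by fun_prop)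
  have pφ := φ.isPrimitive.mul pD
  set E : ℝ → ℝ := fun s => -(deriv (r0 G₀) (s + a) * (r0 G₀ s - r0 G₀ (s + a))) +
    (P s - P (s + a))
  have pE : IsPrimitive E (fun s => -(deriv (deriv (r0 G₀)) (s + a) * (r0 G₀ s - r0 G₀ (s + a)) +
      deriv (r0 G₀) (s + a) * (deriv (r0 G₀) s - deriv (r0 G₀) (s + a))) +
      (deriv (r0 G₀) s ^ 2 - deriv (r0 G₀) (s + a) ^ 2)) := by
    refine isPrimitive_of_hasDerivAt (fun s => ?_) (by fun_prop)
    exact (((h2 (s + a)).comp_add_const s a).mul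
      ((h1 s).sub ((h1 (s + a)).comp_add_const s a))).neg.add
      ((hP s).sub ((hP (s + a)).comp_add_const s a))
  have hae : (fun s => renLagrangian G₀ G ψ (s + a) - renLagrangian G₀ G φ s) =ᵐ[volume]
      fun s => (φ.weakDeriv s * D s +
        φ.eval s * (deriv (deriv (r0 G₀)) s - deriv (deriv (r0 G₀)) (s + a))) +
      (-(deriv (deriv (r0 G₀)) (s + a) * (r0 G₀ s - r0 G₀ (s + a)) +
      deriv (r0 G₀) (s + a) * (deriv (r0 G₀) s - deriv (r0 G₀) (s + a))) +
      (deriv (r0 G₀) s ^ 2 - deriv (r0 G₀) (s + a) ^ 2)) := by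
    have q := (measurePreserving_add_right (volume : Measure ℝ) a).quasiMeasurePreserving
    filter_upwards [q.ae (D12.coeFn_weakDeriv_add (D12.shift a φ) d),
      q.ae (D12.coeFn_weakDeriv_shift a φ), q.ae hd'] with s e1 e2 e3
    rw [renLagrangian_eq hG₀, renLagrangian_eq hG₀, e1, e2, e3, add_sub_cancel_right]
    unfold potDiff
    have e4 : ψ.eval (s + a) = φ.eval s + r0 G₀ s - r0 G₀ (s + a) := by
      have := hrad s
      unfold radius at this
      linarith
    rw [hrad, rho_add_two_pi_mul_int, e4, ← deriv_deriv_r0_eq_force hG₀,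
      ← deriv_deriv_r0_eq_force hG₀, pot_zero_right _ (r0_pos hG₀ s),
      pot_zero_right _ (r0_pos hG₀ (s + a))]
    have f1 : 1 / r0 G₀ s - G₀ ^ 2 / (2 * r0 G₀ s ^ 2) = 1 / 2 * deriv (r0 G₀) s ^ 2 := by
      rw [deriv_r0_sq hG₀]; ring
    have f2 : 1 / r0 G₀ (s + a) - G₀ ^ 2 / (2 * r0 G₀ (s + a) ^ 2)
      = 1 / 2 * deriv (r0 G₀) (s + a) ^ 2 := by
      rw [deriv_r0_sq hG₀]; ring
    rw [f1, f2]
    simp only [D]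
    ring
  have hint : Integrable fun s => renLagrangian G₀ G ψ (s + a) - renLagrangian G₀ G φ s :=
    hi1.sub hi2
  have hlim := intervalIntegral_tendsto_integral hint
    (tendsto_neg_atTop_atBot.comp tendsto_natCast_atTop_atTop)
    (tendsto_natCast_atTop_atTop (R := ℝ))
  have hFE : ∀ n : ℕ, ∫ s in (-(n : ℝ))..n, (renLagrangian G₀ G ψ (s + a) - renLagrangian G₀ G φ s)
      = (φ.eval n * D n - φ.eval (-n) * D (-n)) + (E n - E (-n)) := fun n => by
    rw [pφ.sub_eq, pE.sub_eq, ← intervalIntegral.integral_add (pφ.intervalIntegrable _ _)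
      (pE.intervalIntegrable _ _)]
    exact intervalIntegral.integral_congr_ae (hae.mono fun s hs _ => hs)
  -- The boundary terms vanish at infinity, since `φ = O(r₀)`, `D = O(1/r₀²)`, the velocity of `r₀`
  -- decays, and the increments of `P` over the fixed length `a` are `O(1/r₀)`.
  have hz : ∀ {u : ℕ → ℝ}, Tendsto (fun n => |u n|) atTop atTop →
      Tendsto (fun n => φ.eval (u n) * D (u n)) atTop (𝓝 0) ∧
      Tendsto (fun n => E (u n)) atTop (𝓝 0) := by
    intro u hu
    have hr : Tendsto (fun n => r0 G₀ (u n)) atTop atTop :=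
      (tendsto_r0_of_abs hG₀ (l := comap (fun s : ℝ => |s|) atTop) tendsto_comap).comp
        (tendsto_comap_iff.2 hu)
    have hra : Tendsto (fun n => deriv (r0 G₀) (u n + a)) atTop (𝓝 0) := by
      refine (tendsto_deriv_r0_of_abs hG₀ (l := comap (fun s : ℝ => |s|) atTop)
        tendsto_comap).comp (tendsto_comap_iff.2 ?_)
      refine tendsto_atTop_mono (fun n => ?_) (tendsto_atTop_add_const_right _ (-|a|) hu)
      have := abs_sub_abs_le_abs_sub (u n) (-a)
      rw [abs_neg, sub_neg_eq_add] at this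
      simpa [sub_eq_add_neg] using this
    constructor
    · refine squeeze_zero_norm (fun n => ?_) (hr.const_div_atTop (C3 * ‖φ‖ * C2))
      have hr0 := r0_pos hG₀ (u n)
      rw [Real.norm_eq_abs, abs_mul]
      calc |φ.eval (u n)| * |D (u n)| ≤ (C3 * ‖φ‖ * r0 G₀ (u n)) * (C2 / r0 G₀ (u n) ^ 2) := by
            gcongr
            · exact hC3' φ _
            · exact hC2 _
        _ = _ := by field_simp
    · have t1 : Tendsto (fun n => deriv (r0 G₀) (u n + a) * (r0 G₀ (u n) - r0 G₀ (u n + a)))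
          atTop (𝓝 0) := by
        refine squeeze_zero_norm (a := fun n => |deriv (r0 G₀) (u n + a)| * (2 / G₀ * |a|))
          (fun n => ?_) ?_
        · rw [Real.norm_eq_abs, abs_mul]
          gcongr
          have := abs_r0_sub_le hG₀ (u n) (u n + a)
          simpa using this
        · simpa using hra.abs.mul_const (2 / G₀ * |a|)
      have t2 : Tendsto (fun n => P (u n) - P (u n + a)) atTop (𝓝 0) :=
        squeeze_zero_norm (fun n => hC1 (u n)) (hr.const_div_atTop C1)
      simpa [E] using t1.neg.add t2
  have hz1 := hz tendsto_abs_natCast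
  have hz2 := hz tendsto_abs_neg_natCast
  have hlim2 : Tendsto (fun n : ℕ => (φ.eval n * D n - φ.eval (-n) * D (-n)) + (E n - E (-n)))
      atTop (𝓝 0) := by
    simpa using (hz1.1.sub hz2.1).add (hz1.2.sub hz2.2)
  have hfin := tendsto_nhds_unique (hlim.congr hFE) hlim2
  rw [integral_sub hi1 hi2, integral_add_right_eq_self (fun s => renLagrangian G₀ G ψ s)] at hfin
  unfold action
  linarith

/-- The translations of `D^{1,2}` that correspond to those of the orbit by multiples of the
period. -/
theorem exists_translate {G₀ : ℝ} (hG₀ : 0 < G₀) (k : ℤ) : ∃ d : D12,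
    (∀ (φ : D12) (s : ℝ), radius G₀ (D12.shift (k * (2 * Real.pi)) φ + d) s
      = radius G₀ φ (s - k * (2 * Real.pi))) ∧
    ∀ (G : ℝ) (φ : D12), NoCollision G₀ φ →
      action G₀ G (D12.shift (k * (2 * Real.pi)) φ + d) = action G₀ G φ ∧
      ∀ v, firstVar G₀ G (D12.shift (k * (2 * Real.pi)) φ + d) (D12.shift (k * (2 * Real.pi)) v)
        = firstVar G₀ G φ v := by
  obtain ⟨d, hd, hd'⟩ := exists_r0_drift hG₀ (k * (2 * Real.pi))
  have hrad : ∀ (φ : D12) (s : ℝ), radius G₀ (D12.shift (k * (2 * Real.pi)) φ + d) s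
      = radius G₀ φ (s - k * (2 * Real.pi)) := fun φ s => by
    simp only [radius, D12.eval_add, D12.eval_shift, hd]; ring
  refine ⟨d, hrad, fun G φ hφ => ⟨action_translate hG₀ G k hd hd' hφ, fun v => ?_⟩⟩
  set a : ℝ := k * (2 * Real.pi)
  have hψ : NoCollision G₀ (D12.shift a φ + d) := fun s => by rw [hrad]; exact hφ _
  -- Invariance of the first variation follows by differentiating that of the action along lines.
  have hline : ∀ (χ w : D12), NoCollision G₀ χ →
      HasDerivAt (fun t : ℝ => action G₀ G (χ + t • w)) (firstVar G₀ G χ w) 0 := by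
    intro χ w hχ
    have h1 : HasDerivAt (fun t : ℝ => χ + t • w) w 0 := by
      simpa using ((hasDerivAt_id (0 : ℝ)).smul_const w).const_add χ
    have h2 : HasFDerivAt (action G₀ G) (fderiv ℝ (action G₀ G) χ) (χ + (0 : ℝ) • w) := by
      simpa using hasFDerivAt_action hG₀ G hχ
    have := h2.comp_hasDerivAt (0 : ℝ) h1
    rwa [fderiv_action_apply hG₀ G hχ] at this
  refine (hline _ _ hψ).unique ((hline φ v hφ).congr_of_eventuallyEq ?_)
  have hopen : ∀ᶠ t : ℝ in 𝓝 0, NoCollision G₀ (φ + t • v) := by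
    have hc : Continuous fun t : ℝ => φ + t • v := by fun_prop
    refine hc.continuousAt.eventually ((isOpen_noCollision hG₀).mem_nhds ?_)
    simpa using hφ
  filter_upwards [hopen] with t ht
  rw [← action_translate hG₀ G k hd hd' ht, D12.shift_add, D12.shift_smul]
  congr 1
  abel

/-! ### The centrifugal part of the action -/

/-- `∫ (r₀ + φ)⁻²`, the derivative of the action with respect to `-G²/2`. -/
def invSq (G₀ : ℝ) (φ : D12) : ℝ := ∫ s, 1 / radius G₀ φ s ^ 2

theorem integrable_inv_radius_sq {G₀ : ℝ} (hG₀ : 0 < G₀) {φ : D12} (hφ : NoCollision G₀ φ) :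
    Integrable fun s => 1 / radius G₀ φ s ^ 2 := by
  obtain ⟨δ, hδ, -, h⟩ := hφ.exists_le hG₀
  refine integrable_of_le_inv_r0_sq hG₀ (continuous_const.div ((continuous_radius hG₀ φ).pow 2)
    fun s => pow_ne_zero _ (hφ s).ne').aestronglyMeasurable (1 / δ ^ 2) fun s => ?_
  have h0 := r0_pos hG₀ s
  rw [abs_of_nonneg (by positivity), div_div, ← mul_pow]
  gcongr
  exact h s

theorem invSq_nonneg (G₀ : ℝ) (φ : D12) : 0 ≤ invSq G₀ φ :=
  integral_nonneg fun s => by positivity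

/-- The action is affine in `G²` with slope `-invSq/2`: comparing two momenta at the same `φ`
measures `invSq`. This drives the monotonicity trick. -/
theorem action_eq_add_invSq {G₀ : ℝ} (hG₀ : 0 < G₀) (G G' : ℝ) {φ : D12}
    (hφ : NoCollision G₀ φ) :
    action G₀ G φ = action G₀ G' φ + (G' ^ 2 - G ^ 2) / 2 * invSq G₀ φ := by
  rw [action_eq hG₀ G hφ, action_eq hG₀ G' hφ, invSq, ← integral_const_mul, add_assoc,
    ← integral_add (integrable_potDiff hG₀ G' hφ)
      ((integrable_inv_radius_sq hG₀ hφ).const_mul _)]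
  congr 1
  refine integral_congr_ae (Eventually.of_forall fun s => ?_)
  have := hφ s
  simp only [potDiff, pot]
  field_simp
  ring

theorem action_anti {G₀ : ℝ} (hG₀ : 0 < G₀) {G G' : ℝ} (h : G' ^ 2 ≤ G ^ 2) {φ : D12}
    (hφ : NoCollision G₀ φ) : action G₀ G φ ≤ action G₀ G' φ := by
  rw [action_eq_add_invSq hG₀ G G' hφ]
  nlinarith [invSq_nonneg G₀ φ]

/-- From the value `m` at time `s` the radius grows at most by `L √(t - s)` during a unit of time,
where `2/G₀` is the Lipschitz constant of `r₀`. So `r² ≤ 2(m² + L²(t - s))`, and integrating the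
reciprocal gives the logarithm. -/
theorem log_le_invSq {G₀ : ℝ} (hG₀ : 0 < G₀) {φ : D12} (hφ : NoCollision G₀ φ) {L : ℝ}
    (hL : ‖φ‖ + 2 / G₀ ≤ L) (s : ℝ) :
    Real.log (1 + L ^ 2 / radius G₀ φ s ^ 2) ≤ 2 * L ^ 2 * invSq G₀ φ := by
  have hL0 : 0 < L := lt_of_lt_of_le (by positivity) hL
  set m := radius G₀ φ s
  have hm : 0 < m := hφ s
  have hder : ∀ t ∈ uIcc s (s + 1), HasDerivAt
      (fun t => Real.log (m ^ 2 + L ^ 2 * (t - s)) / (2 * L ^ 2))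
      (1 / (2 * (m ^ 2 + L ^ 2 * (t - s)))) t := by
    intro t ht
    rw [uIcc_of_le (by linarith)] at ht
    have hpos : 0 < m ^ 2 + L ^ 2 * (t - s) := by
      have := mul_nonneg (sq_nonneg L) (sub_nonneg.2 ht.1)
      positivity
    have := (((((hasDerivAt_id' t).sub_const s).const_mul (L ^ 2)).const_add (m ^ 2)).log
      hpos.ne').div_const (2 * L ^ 2)
    convert! this using 1
    field_simp
  have hcont : ContinuousOn (fun t => 1 / (2 * (m ^ 2 + L ^ 2 * (t - s)))) (uIcc s (s + 1)) := by
    refine continuousOn_const.div (by fun_prop) fun t ht => ?_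
    rw [uIcc_of_le (by linarith)] at ht
    have := mul_nonneg (sq_nonneg L) (sub_nonneg.2 ht.1)
    positivity
  have hint := intervalIntegral.integral_eq_sub_of_hasDerivAt hder hcont.intervalIntegrable
  have hle : ∫ t in s..(s + 1), 1 / (2 * (m ^ 2 + L ^ 2 * (t - s))) ≤ invSq G₀ φ := by
    have hi := integrable_inv_radius_sq hG₀ hφ
    calc ∫ t in s..(s + 1), 1 / (2 * (m ^ 2 + L ^ 2 * (t - s)))
        ≤ ∫ t in s..(s + 1), 1 / radius G₀ φ t ^ 2 := by
          refine intervalIntegral.integral_mono_on (by linarith) hcont.intervalIntegrable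
            hi.intervalIntegrable fun t ht => ?_
          have hr := hφ t
          have h0 : 0 ≤ t - s := sub_nonneg.2 ht.1
          have h1 : t - s ≤ 1 := by linarith [ht.2]
          gcongr
          have e1 := φ.abs_eval_sub_le s t
          have e2 := abs_r0_sub_le hG₀ t s
          rw [abs_of_nonneg h0] at e1 e2
          have e3 : t - s ≤ √(t - s) := Real.le_sqrt_of_sq_le (by nlinarith)
          have e4 : radius G₀ φ t ≤ m + L * √(t - s) := by
            have f1 := (abs_le.1 e1).2
            have f2 := (abs_le.1 e2).2
            have f3 : ‖φ.weakDeriv‖ * √(t - s) + 2 / G₀ * (t - s) ≤ L * √(t - s) := by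
              calc _ ≤ ‖φ‖ * √(t - s) + 2 / G₀ * √(t - s) := by
                    gcongr; exact φ.norm_weakDeriv_le
                _ = (‖φ‖ + 2 / G₀) * √(t - s) := by ring
                _ ≤ _ := by gcongr
            simp only [m, radius]
            linarith
          calc radius G₀ φ t ^ 2 ≤ (m + L * √(t - s)) ^ 2 := by gcongr
            _ ≤ 2 * (m ^ 2 + (L * √(t - s)) ^ 2) := by
                nlinarith [sq_nonneg (m - L * √(t - s))]
            _ = _ := by rw [mul_pow, Real.sq_sqrt h0]
      _ ≤ invSq G₀ φ := by
          rw [intervalIntegral.integral_of_le (by linarith)]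
          exact setIntegral_le_integral hi (Eventually.of_forall fun t => by positivity)
  rw [hint] at hle
  have e : Real.log (1 + L ^ 2 / m ^ 2) = Real.log (m ^ 2 + L ^ 2 * (s + 1 - s))
      - Real.log (m ^ 2 + L ^ 2 * (s - s)) := by
    rw [sub_self, mul_zero, add_zero, add_sub_cancel_left, mul_one,
      ← Real.log_div (by positivity) (by positivity)]
    congr 1
    field_simp
  rw [e]
  rw [← sub_div, div_le_iff₀ (by positivity)] at hle
  linarith

/-- Bounds on the norm and on `invSq` keep a whole family uniformly away from collision; this is
what the monotonicity trick is needed for. -/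
theorem exists_le_radius_of_invSq_le {G₀ : ℝ} (hG₀ : 0 < G₀) (B K : ℝ) :
    ∃ δ > 0, ∀ φ : D12, NoCollision G₀ φ → ‖φ‖ ≤ B → invSq G₀ φ ≤ K →
      ∀ s, δ * r0 G₀ s ≤ radius G₀ φ s := by
  obtain ⟨C, hC, h⟩ := exists_abs_eval_le_half hG₀
  set L := |B| + 2 / G₀
  have hL : 0 < L := by positivity
  -- The value of `m` for which `log (L²/m²) = 2 L² K`.
  set μ := L * Real.exp (-(L ^ 2 * K))
  have hμ : 0 < μ := by positivity
  set R := C * |B| ^ 4 + 1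
  have hR : 0 < R := by positivity
  refine ⟨min (1 / 2) (μ / R), by positivity, fun φ hφ hB hK s => ?_⟩
  have hr0 := r0_pos hG₀ s
  have hB' : ‖φ‖ ≤ |B| := hB.trans (le_abs_self B)
  by_cases hs : C * ‖φ‖ ^ 4 ≤ r0 G₀ s
  · have h1 := abs_le.1 (h φ s hs)
    have h2 : min (1 / 2) (μ / R) * r0 G₀ s ≤ 1 / 2 * r0 G₀ s := by
      gcongr; exact min_le_left _ _
    unfold radius at *
    linarith
  · have hlog := log_le_invSq hG₀ hφ (show ‖φ‖ + 2 / G₀ ≤ L by simp only [L]; linarith) s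
    have hr := hφ s
    set m := radius G₀ φ s
    have h1 : L ^ 2 / m ^ 2 ≤ Real.exp (2 * L ^ 2 * K) := by
      have h2 : Real.log (L ^ 2 / m ^ 2) ≤ 2 * L ^ 2 * K := by
        refine le_trans ?_ (hlog.trans (by gcongr))
        exact Real.log_le_log (by positivity) (by linarith)
      calc L ^ 2 / m ^ 2 = Real.exp (Real.log (L ^ 2 / m ^ 2)) :=
            (Real.exp_log (by positivity)).symm
        _ ≤ _ := Real.exp_le_exp.2 h2
    have h3 : μ ≤ m := by
      refine le_of_sq_le_sq ?_ hr.le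
      rw [div_le_iff₀ (by positivity)] at h1
      simp only [μ]
      rw [mul_pow, ← Real.exp_nat_mul]
      calc L ^ 2 * Real.exp ((2 : ℕ) * (-(L ^ 2 * K)))
          ≤ Real.exp (2 * L ^ 2 * K) * m ^ 2 * Real.exp ((2 : ℕ) * (-(L ^ 2 * K))) := by gcongr
        _ = m ^ 2 * (Real.exp (2 * L ^ 2 * K) * Real.exp ((2 : ℕ) * (-(L ^ 2 * K)))) := by ring
        _ = m ^ 2 := by
            rw [← Real.exp_add]
            have : 2 * L ^ 2 * K + (2 : ℕ) * (-(L ^ 2 * K)) = 0 := by push_cast; ring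
            rw [this, Real.exp_zero, mul_one]
    have h4 : r0 G₀ s ≤ R := by
      have : C * ‖φ‖ ^ 4 ≤ C * |B| ^ 4 := by gcongr
      simp only [R]
      linarith [le_of_not_ge hs]
    calc min (1 / 2) (μ / R) * r0 G₀ s ≤ μ / R * R := by
          gcongr; exact min_le_right _ _
      _ = μ := by field_simp
      _ ≤ m := h3

/-! ### Upper bounds and semicontinuity -/

/-- Where `r ≥ r₀/2` the estimate of `potDiff` applies. Elsewhere `r₀` is bounded in terms of `B`,
and for `G ≠ 0` the centrifugal term caps `pot` at `1/(2G²)` however small `r` is. -/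
theorem exists_action_le {G₀ : ℝ} (hG₀ : 0 < G₀) {G : ℝ} (hG : G ≠ 0) (B : ℝ) :
    ∃ C, ∀ φ : D12, NoCollision G₀ φ → ‖φ‖ ≤ B → action G₀ G φ ≤ C := by
  obtain ⟨C, hC, h⟩ := exists_abs_eval_le_half hG₀
  obtain ⟨C', hC', h'⟩ := D12.exists_abs_eval_le hG₀
  obtain ⟨CH, hCH, hH⟩ := D12.exists_hardy hG₀
  set R := C * |B| ^ 4
  set A := (1 + G ^ 2 + G₀ ^ 2) / (1 / 2) ^ 2
  set Q := quadConst G₀ (G₀ ^ 2) (1 / 2)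
  have hQ : 0 ≤ Q := quadConst_nonneg (sq_nonneg _) (by norm_num)
  set A' := 1 / (2 * G ^ 2) * R ^ 2 + G₀ ^ 2 / 2 + C' * |B| * (G₀ ^ 2 + R)
  have hR : 0 ≤ R := by positivity
  have hA' : 0 ≤ A' := by positivity
  have hA : 0 ≤ A := by positivity
  refine ⟨1 / 2 * |B| ^ 2 + ((A + A') * (∫ s, 1 / r0 G₀ s ^ 2) + Q * (CH * |B| ^ 2)),
    fun φ hφ hB => ?_⟩
  have hB' : ‖φ‖ ≤ |B| := hB.trans (le_abs_self B)
  have key : ∀ s, potDiff G₀ G φ s ≤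
      (A + A') * (1 / r0 G₀ s ^ 2) + Q * (φ.eval s ^ 2 / r0 G₀ s ^ 3) := by
    intro s
    have hr0 := r0_pos hG₀ s
    have hr := hφ s
    by_cases hs : 1 / 2 * r0 G₀ s ≤ radius G₀ φ s
    · have h1 : potDiff G₀ G φ s ≤ A / r0 G₀ s ^ 2 + Q * (φ.eval s ^ 2 / r0 G₀ s ^ 3) :=
        (abs_le.1 (abs_potDiff_le hG₀ G (by norm_num) (by norm_num) hs)).2
      have h2 : 0 ≤ A' * (1 / r0 G₀ s ^ 2) := by positivity
      have h3 : A / r0 G₀ s ^ 2 = A * (1 / r0 G₀ s ^ 2) := by ring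
      rw [add_mul]
      linarith
    · have hsmall : ¬ C * ‖φ‖ ^ 4 ≤ r0 G₀ s := fun hc => by
        have := (abs_le.1 (h φ s hc)).1
        unfold radius at hs
        linarith
      have hrR : r0 G₀ s ≤ R := by
        refine (le_of_not_ge hsmall).trans ?_
        simp only [R]; gcongr
      have hφs : |φ.eval s| ≤ C' * |B| * r0 G₀ s := (h' φ s).trans (by gcongr)
      have h1 : pot (G ^ 2) (rho s) (radius G₀ φ s) ≤ 1 / (2 * G ^ 2) * R ^ 2 * (1 / r0 G₀ s ^ 2) := by
        have hq := le_sqrt_sq_add hr (rho s)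
        have h2 : pot (G ^ 2) (rho s) (radius G₀ φ s) ≤ 1 / (2 * G ^ 2) := by
          have e1 : 1 / √(radius G₀ φ s ^ 2 + rho s ^ 2) ≤ 1 / radius G₀ φ s := by gcongr
          have e2 : 1 / radius G₀ φ s - G ^ 2 / (2 * radius G₀ φ s ^ 2) ≤ 1 / (2 * G ^ 2) := by
            have e3 : 1 / (2 * G ^ 2) - (1 / radius G₀ φ s - G ^ 2 / (2 * radius G₀ φ s ^ 2))
              = (radius G₀ φ s - G ^ 2) ^ 2 / (2 * G ^ 2 * radius G₀ φ s ^ 2) := by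
              field_simp; ring
            have : 0 ≤ (radius G₀ φ s - G ^ 2) ^ 2 / (2 * G ^ 2 * radius G₀ φ s ^ 2) := by
              positivity
            linarith
          unfold pot; linarith
        refine h2.trans ?_
        rw [mul_assoc, mul_one_div]
        refine le_mul_of_one_le_right (by positivity) ?_
        rw [one_le_div (by positivity)]
        gcongr
      have h2 : - pot (G₀ ^ 2) 0 (r0 G₀ s) ≤ G₀ ^ 2 / 2 * (1 / r0 G₀ s ^ 2) := by
        rw [pot_zero_right _ hr0]
        have : 0 ≤ 1 / r0 G₀ s := by positivity
        have e : G₀ ^ 2 / (2 * r0 G₀ s ^ 2) = G₀ ^ 2 / 2 * (1 / r0 G₀ s ^ 2) := by field_simp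
        linarith
      have h3 : -(force (G₀ ^ 2) 0 (r0 G₀ s) * φ.eval s)
          ≤ C' * |B| * (G₀ ^ 2 + R) * (1 / r0 G₀ s ^ 2) := by
        calc -(force (G₀ ^ 2) 0 (r0 G₀ s) * φ.eval s)
            ≤ |force (G₀ ^ 2) 0 (r0 G₀ s)| * |φ.eval s| := by
              rw [← abs_mul]; exact neg_le_abs _
          _ ≤ (G₀ ^ 2 / r0 G₀ s ^ 3 + 1 / r0 G₀ s ^ 2) * (C' * |B| * r0 G₀ s) := by
              gcongr
              rw [force_zero_right _ hr0]
              refine (abs_sub _ _).trans (le_of_eq ?_)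
              rw [abs_of_nonneg (by positivity), abs_of_nonneg (by positivity)]
          _ = C' * |B| * (G₀ ^ 2 + r0 G₀ s) * (1 / r0 G₀ s ^ 2) := by field_simp
          _ ≤ _ := by gcongr
      have h4 : 0 ≤ A * (1 / r0 G₀ s ^ 2) := by positivity
      have h5 : 0 ≤ Q * (φ.eval s ^ 2 / r0 G₀ s ^ 3) := by positivity
      have h6 : A' * (1 / r0 G₀ s ^ 2) = 1 / (2 * G ^ 2) * R ^ 2 * (1 / r0 G₀ s ^ 2)
        + G₀ ^ 2 / 2 * (1 / r0 G₀ s ^ 2) + C' * |B| * (G₀ ^ 2 + R) * (1 / r0 G₀ s ^ 2) := by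
        simp only [A']; ring
      rw [add_mul, h6]
      unfold potDiff
      linarith
  have hi : Integrable fun s => (A + A') * (1 / r0 G₀ s ^ 2) +
      Q * (φ.eval s ^ 2 / r0 G₀ s ^ 3) :=
    ((integrable_inv_r0_sq hG₀).const_mul (A + A')).add ((hH φ).1.const_mul Q)
  rw [action_eq hG₀ G hφ]
  have h1 : ‖φ.weakDeriv‖ ≤ |B| := φ.norm_weakDeriv_le.trans hB'
  have h2 : ∫ s, potDiff G₀ G φ s ≤ (A + A') * (∫ s, 1 / r0 G₀ s ^ 2) + Q * (CH * |B| ^ 2) := by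
    refine (integral_mono (integrable_potDiff hG₀ G hφ) hi key).trans ?_
    rw [integral_add ((integrable_inv_r0_sq hG₀).const_mul _) ((hH φ).1.const_mul Q),
      integral_const_mul, integral_const_mul]
    gcongr
    exact (hH φ).2.trans (by gcongr)
  gcongr

theorem extAction_of_noCollision {G₀ G : ℝ} {φ : D12} (hφ : NoCollision G₀ φ) :
    extAction G₀ G φ = (action G₀ G φ : EReal) := if_pos hφ

theorem extAction_of_not {G₀ G : ℝ} {φ : D12} (hφ : ¬ NoCollision G₀ φ) :
    extAction G₀ G φ = ⊥ := if_neg hφ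

/-- The action tends to `-∞` at collisions. -/
theorem eventually_extAction_lt_of_collision {G₀ : ℝ} (hG₀ : 0 < G₀) {G : ℝ} (hG : G ≠ 0)
    {φ : D12} (hφ : ¬ NoCollision G₀ φ) (b : ℝ) :
    ∀ᶠ ψ in 𝓝 φ, extAction G₀ G ψ < b := by
  unfold NoCollision at hφ
  push Not at hφ
  obtain ⟨s, hs⟩ := hφ
  -- With momentum `G/2` the action is still bounded above on bounded sets; the remaining
  -- centrifugal term `-(3G²/8) invSq` tends to `-∞`.
  obtain ⟨C, hC⟩ := exists_action_le hG₀ (G := G / 2) (by positivity) (‖φ‖ + 1)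
  obtain ⟨C', hC', h'⟩ := D12.exists_abs_eval_le hG₀
  set L := ‖φ‖ + 1 + 2 / G₀
  have hL : 0 < L := by positivity
  have hlim : Tendsto (fun μ : ℝ => C - 3 * G ^ 2 / 8 * (Real.log (1 + L ^ 2 / μ ^ 2) / (2 * L ^ 2)))
      (𝓝[>] 0) atBot := by
    have h1 : Tendsto (fun μ : ℝ => 1 + L ^ 2 / μ ^ 2) (𝓝[>] 0) atTop := by
      refine tendsto_atTop_add_const_left _ _ ?_
      have h2 : Tendsto (fun μ : ℝ => (μ⁻¹) ^ 2) (𝓝[>] 0) atTop :=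
        (tendsto_pow_atTop two_ne_zero).comp tendsto_inv_nhdsGT_zero
      refine (h2.const_mul_atTop (by positivity : 0 < L ^ 2)).congr fun μ => ?_
      rw [inv_pow, div_eq_mul_inv]
    have h3 := ((Real.tendsto_log_atTop.comp h1).atTop_div_const
      (by positivity : 0 < 2 * L ^ 2)).const_mul_atTop (by positivity : 0 < 3 * G ^ 2 / 8)
    exact (tendsto_atBot_add_const_left _ C (tendsto_neg_atTop_atBot.comp h3)).congr fun μ => by
      simp [sub_eq_add_neg]
  obtain ⟨μ, hμb, hμ⟩ := ((hlim.eventually_lt_atBot b).and self_mem_nhdsWithin).exists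
  have hμ : 0 < μ := hμ
  have hr0 := r0_pos hG₀ s
  have hpos : 0 < min 1 (μ / (C' * r0 G₀ s)) := by positivity
  filter_upwards [Metric.ball_mem_nhds φ hpos] with ψ hψ
  rw [mem_ball_iff_norm, lt_min_iff] at hψ
  by_cases hn : NoCollision G₀ ψ
  · have hnorm : ‖ψ‖ ≤ ‖φ‖ + 1 := by
      have := norm_le_norm_add_norm_sub' ψ φ
      linarith [hψ.1]
    rw [extAction_of_noCollision hn, EReal.coe_lt_coe_iff]
    have hr := hn s
    have hrμ : radius G₀ ψ s ≤ μ := by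
      have h1 := (abs_le.1 (h' (ψ - φ) s)).2
      rw [D12.eval_sub] at h1
      have h2 := (lt_div_iff₀ (by positivity)).1 hψ.2
      unfold radius at *
      nlinarith
    have h1 := log_le_invSq hG₀ hn (show ‖ψ‖ + 2 / G₀ ≤ L by simp only [L]; linarith) s
    have h2 : Real.log (1 + L ^ 2 / μ ^ 2) ≤ Real.log (1 + L ^ 2 / radius G₀ ψ s ^ 2) := by
      gcongr
    have h3 : Real.log (1 + L ^ 2 / μ ^ 2) / (2 * L ^ 2) ≤ invSq G₀ ψ := by
      rw [div_le_iff₀ (by positivity)]; linarith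
    rw [action_eq_add_invSq hG₀ G (G / 2) hn]
    have h4 := hC ψ hn hnorm
    have h5 : 3 * G ^ 2 / 8 * (Real.log (1 + L ^ 2 / μ ^ 2) / (2 * L ^ 2))
      ≤ 3 * G ^ 2 / 8 * invSq G₀ ψ := by gcongr
    have h6 : ((G / 2) ^ 2 - G ^ 2) / 2 * invSq G₀ ψ = -(3 * G ^ 2 / 8 * invSq G₀ ψ) := by ring
    rw [h6]
    linarith
  · rw [extAction_of_not hn]
    exact EReal.bot_lt_coe b

/-- With the value `-∞` at collisions the action attains its maximum on every path and has closed
superlevel sets, although paths may cross collisions. -/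
theorem upperSemicontinuous_extAction {G₀ : ℝ} (hG₀ : 0 < G₀) {G : ℝ} (hG : G ≠ 0) :
    UpperSemicontinuous (extAction G₀ G) := by
  intro φ b hb
  by_cases hφ : NoCollision G₀ φ
  · rw [extAction_of_noCollision hφ] at hb
    have h1 : Tendsto (fun ψ => (action G₀ G ψ : EReal)) (𝓝 φ) (𝓝 (action G₀ G φ : EReal)) :=
      (continuous_coe_real_ereal.tendsto _).comp (continuousAt_action hG₀ G hφ)
    filter_upwards [h1.eventually_lt_const hb, (isOpen_noCollision hG₀).mem_nhds hφ] with ψ h2 h3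
    rwa [extAction_of_noCollision h3]
  · induction b with
    | bot => exact absurd hb not_lt_bot
    | coe b => exact eventually_extAction_lt_of_collision hG₀ hG hφ b
    | top =>
      exact (eventually_extAction_lt_of_collision hG₀ hG hφ 0).mono fun ψ h =>
        h.trans (EReal.coe_lt_top 0)

/-! ### Adding constants -/

theorem radius_add_const (G₀ : ℝ) (φ : D12) (c s : ℝ) :
    radius G₀ (φ + D12.const c) s = radius G₀ φ s + c := by
  rw [radius_add, D12.eval_const]

theorem noCollision_add_const {G₀ : ℝ} {φ : D12} (hφ : NoCollision G₀ φ) {c : ℝ} (hc : 0 ≤ c) :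
    NoCollision G₀ (φ + D12.const c) := fun s => by
  rw [radius_add_const]; linarith [hφ s]

/-- A constant has zero derivative and the integral of `r₀''` vanishes, so only the potential feels
the translation of the radius. -/
theorem integrable_pot_sub_pot {G₀ : ℝ} (hG₀ : 0 < G₀) (G : ℝ) {φ : D12}
    (hφ : NoCollision G₀ φ) {c : ℝ} (hc : 0 ≤ c) :
    Integrable (fun s => pot (G ^ 2) (rho s) (radius G₀ φ s + c)
      - pot (G ^ 2) (rho s) (radius G₀ φ s)) ∧
    action G₀ G (φ + D12.const c) = action G₀ G φ +
      ∫ s, (pot (G ^ 2) (rho s) (radius G₀ φ s + c) - pot (G ^ 2) (rho s) (radius G₀ φ s)) := by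
  have hφc := noCollision_add_const hφ hc
  have h1 := integrable_potDiff hG₀ G hφ
  have h2 := integrable_potDiff hG₀ G hφc
  have h3 := (integrable_deriv_deriv_r0 hG₀).mul_const c
  have e : (fun s => pot (G ^ 2) (rho s) (radius G₀ φ s + c)
      - pot (G ^ 2) (rho s) (radius G₀ φ s)) = fun s => (potDiff G₀ G (φ + D12.const c) s
        - potDiff G₀ G φ s) + deriv (deriv (r0 G₀)) s * c := by
    funext s
    unfold potDiff
    rw [radius_add_const, D12.eval_add, D12.eval_const, deriv_deriv_r0_eq_force hG₀]
    ring
  have h4 : Integrable fun s => potDiff G₀ G (φ + D12.const c) s - potDiff G₀ G φ s := h2.sub h1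
  refine ⟨by rw [e]; exact h4.add h3, ?_⟩
  have e2 : (φ + D12.const c).weakDeriv = φ.weakDeriv := by
    have : (φ + D12.const c).weakDeriv = φ.weakDeriv + (D12.const c).weakDeriv := rfl
    rw [this, D12.weakDeriv_const, add_zero]
  rw [e, integral_add h4 h3, integral_sub h2 h1, integral_mul_const,
    integral_deriv_deriv_r0 hG₀, action_eq hG₀ G hφ, action_eq hG₀ G hφc, e2]
  ring

theorem action_add_const_le {G₀ : ℝ} (hG₀ : 0 < G₀) (G : ℝ) {φ : D12}
    (hφ : ∀ s, 1 + 4 * G ^ 2 ≤ radius G₀ φ s) {c : ℝ} (hc : 0 ≤ c) :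
    action G₀ G (φ + D12.const c) ≤ action G₀ G φ := by
  have hn : NoCollision G₀ φ := fun s => lt_of_lt_of_le (by positivity) (hφ s)
  rw [(integrable_pot_sub_pot hG₀ G hn hc).2]
  have : ∫ s, (pot (G ^ 2) (rho s) (radius G₀ φ s + c) - pot (G ^ 2) (rho s) (radius G₀ φ s)) ≤ 0 := by
    refine integral_nonpos fun s => sub_nonpos.2 ?_
    have hp : rho s ^ 2 ≤ 1 := pow_le_one₀ (rho_nonneg s) (rho_le_one s)
    exact pot_antitoneOn (sq_nonneg G) hp (hφ s) ((hφ s).trans (by linarith)) (by linarith)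
  linarith

/-- The action tends to `-∞` uniformly on bounded sets when large constants are added. -/
theorem exists_action_add_const_le {G₀ : ℝ} (hG₀ : 0 < G₀) (G B a b : ℝ) :
    ∃ c₀ : ℝ, 0 ≤ c₀ ∧ ∀ φ : D12, (∀ s, 1 + 4 * G ^ 2 ≤ radius G₀ φ s) → ‖φ‖ ≤ B →
      action G₀ G φ ≤ a → ∀ c ≥ c₀, action G₀ G (φ + D12.const c) ≤ b := by
  set κ := r0 G₀ 0 + 2 / G₀ + 2 * |B|
  have hκ : 0 < κ := by have := r0_pos hG₀ 0; positivity
  -- On `[0, R]` the radius is at most `κ(1 + s)`, so the old potential is at least `1/(2κ(1 + s))`,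
  -- while the new one is at most `1/R`. The loss is at least `log(1 + R)/(2κ) - 1`, and `R` makes
  -- this at least `|a - b|`.
  set R := Real.exp (2 * κ * (|a - b| + 1))
  have hR : 0 < R := Real.exp_pos _
  refine ⟨R, hR.le, fun φ hφ hB ha c hc => ?_⟩
  have hc0 : 0 < c := hR.trans_le hc
  have hn : NoCollision G₀ φ := fun s => lt_of_lt_of_le (by positivity) (hφ s)
  obtain ⟨hi, he⟩ := integrable_pot_sub_pot hG₀ G hn hc0.le
  have hnonpos : ∀ s, pot (G ^ 2) (rho s) (radius G₀ φ s + c)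
      - pot (G ^ 2) (rho s) (radius G₀ φ s) ≤ 0 := fun s => by
    have hp : rho s ^ 2 ≤ 1 := pow_le_one₀ (rho_nonneg s) (rho_le_one s)
    exact sub_nonpos.2 (pot_antitoneOn (sq_nonneg G) hp (hφ s) ((hφ s).trans (by linarith))
      (by linarith))
  have hpt : ∀ s ∈ Icc 0 R, pot (G ^ 2) (rho s) (radius G₀ φ s + c)
      - pot (G ^ 2) (rho s) (radius G₀ φ s) ≤ 1 / R - 1 / (2 * κ) * (1 / (1 + s)) := by
    intro s hs
    have hr := hφ s
    have hr1 : 1 ≤ radius G₀ φ s := by nlinarith [sq_nonneg G]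
    have hr0 : 0 < radius G₀ φ s := by linarith
    have hs1 : 0 < 1 + s := by linarith [hs.1]
    have h1 : pot (G ^ 2) (rho s) (radius G₀ φ s + c) ≤ 1 / R := by
      unfold pot
      have hp : 0 < radius G₀ φ s + c := by linarith
      have h2 := le_sqrt_sq_add hp (rho s)
      have h3 : 1 / √((radius G₀ φ s + c) ^ 2 + rho s ^ 2) ≤ 1 / R := by
        gcongr; linarith
      have h4 : 0 ≤ G ^ 2 / (2 * (radius G₀ φ s + c) ^ 2) := by positivity
      linarith
    have h5 : 1 / (2 * radius G₀ φ s) ≤ pot (G ^ 2) (rho s) (radius G₀ φ s) := by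
      unfold pot
      have hp : rho s ^ 2 ≤ 1 := pow_le_one₀ (rho_nonneg s) (rho_le_one s)
      have h6 : √(radius G₀ φ s ^ 2 + rho s ^ 2) ≤ 3 / 2 * radius G₀ φ s :=
        Real.sqrt_le_iff.2 ⟨by positivity, by nlinarith⟩
      have h7 : 1 / (3 / 2 * radius G₀ φ s) ≤ 1 / √(radius G₀ φ s ^ 2 + rho s ^ 2) := by
        have := hr0.trans_le (le_sqrt_sq_add hr0 (rho s))
        gcongr
      have h8 : G ^ 2 / (2 * radius G₀ φ s ^ 2) ≤ 1 / (8 * radius G₀ φ s) := by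
        rw [div_le_div_iff₀ (by positivity) (by positivity)]
        nlinarith
      have h9 : 1 / (3 / 2 * radius G₀ φ s) - 1 / (8 * radius G₀ φ s) - 1 / (2 * radius G₀ φ s)
        = 1 / (24 * radius G₀ φ s) := by field_simp; norm_num
      have h10 : 0 ≤ 1 / (24 * radius G₀ φ s) := by positivity
      linarith
    have h11 : radius G₀ φ s ≤ κ * (1 + s) := by
      have e1 := (abs_le.1 (abs_r0_sub_le hG₀ s 0)).2
      have e2 := (abs_le.1 (φ.abs_eval_le s)).2
      rw [sub_zero, abs_of_nonneg hs.1] at e1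
      rw [abs_of_nonneg hs.1] at e2
      have e3 : √s ≤ 1 + s := Real.sqrt_le_iff.2 ⟨hs1.le, by nlinarith [hs.1]⟩
      have e4 : ‖φ‖ * (1 + √s) ≤ |B| * (2 * (1 + s)) := by
        gcongr
        · exact hB.trans (le_abs_self B)
        · linarith [hs.1]
      have e5 := r0_pos hG₀ 0
      have e6 : 0 ≤ r0 G₀ 0 * s := mul_nonneg e5.le hs.1
      have e7 : 0 < 2 / G₀ := by positivity
      simp only [radius, κ]
      linarith
    have h12 : 1 / (2 * κ) * (1 / (1 + s)) ≤ 1 / (2 * radius G₀ φ s) := by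
      rw [div_mul_div_comm, one_mul]
      exact one_div_le_one_div_of_le (by positivity) (by linarith)
    linarith
  have hcont : ContinuousOn (fun s : ℝ => 1 / (1 + s)) (uIcc 0 R) :=
    continuousOn_const.div (by fun_prop) fun s hs => by
      rw [uIcc_of_le hR.le] at hs; linarith [hs.1]
  have hlog : ∫ s in (0 : ℝ)..R, 1 / (1 + s) = Real.log (1 + R) := by
    have hder : ∀ s ∈ uIcc 0 R, HasDerivAt (fun s : ℝ => Real.log (1 + s)) (1 / (1 + s)) s := by
      intro s hs
      rw [uIcc_of_le hR.le] at hs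
      exact ((hasDerivAt_id' s).const_add 1).log (by linarith [hs.1])
    rw [intervalIntegral.integral_eq_sub_of_hasDerivAt hder hcont.intervalIntegrable]
    simp
  have hint : ∫ s, (pot (G ^ 2) (rho s) (radius G₀ φ s + c)
      - pot (G ^ 2) (rho s) (radius G₀ φ s)) ≤ 1 - 1 / (2 * κ) * Real.log (1 + R) := by
    calc _ ≤ ∫ s in (0 : ℝ)..R, (pot (G ^ 2) (rho s) (radius G₀ φ s + c)
        - pot (G ^ 2) (rho s) (radius G₀ φ s)) := by
          rw [intervalIntegral.integral_of_le hR.le]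
          have := setIntegral_le_integral (s := Ioc 0 R) hi.neg
            (Eventually.of_forall fun s => neg_nonneg.2 (hnonpos s))
          simp only [Pi.neg_apply] at this
          rw [integral_neg, integral_neg] at this
          linarith
      _ ≤ ∫ s in (0 : ℝ)..R, (1 / R - 1 / (2 * κ) * (1 / (1 + s))) :=
          intervalIntegral.integral_mono_on hR.le hi.intervalIntegrable
            (intervalIntegrable_const.sub (hcont.intervalIntegrable.const_mul _)) hpt
      _ = _ := by
          rw [intervalIntegral.integral_sub intervalIntegrable_const
            (hcont.intervalIntegrable.const_mul _), intervalIntegral.integral_const_mul, hlog,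
            intervalIntegral.integral_const, sub_zero, smul_eq_mul, mul_one_div_cancel hR.ne']
  have hlog2 : 2 * κ * (|a - b| + 1) ≤ Real.log (1 + R) := by
    rw [Real.le_log_iff_exp_le (by positivity)]
    simp only [R]; linarith
  have h1 : |a - b| + 1 ≤ 1 / (2 * κ) * Real.log (1 + R) := by
    calc |a - b| + 1 = 1 / (2 * κ) * (2 * κ * (|a - b| + 1)) := by field_simp
      _ ≤ _ := by gcongr
  rw [he]
  linarith [le_abs_self (a - b)]

/-! ### Lower bounds -/

theorem exists_one_add_sqrt_le {G₀ : ℝ} (hG₀ : 0 < G₀) :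
    ∃ C > 0, ∀ s : ℝ, 1 + √|s| ≤ C * r0 G₀ s := by
  obtain ⟨C, hC, h⟩ := D12.exists_abs_eval_le hG₀
  set A := 8 / G₀ ^ 6 + 2
  refine ⟨1 + 8 * A * (2 / G₀ ^ 2), by positivity, fun s => ?_⟩
  have hr := r0_pos hG₀ s
  have hr2 := half_sq_le_r0 G₀ s
  have h2 := sq_le_two_mul_r0_cube hG₀ s
  have h3 : G₀ ^ 6 / 8 ≤ r0 G₀ s ^ 3 := by
    calc G₀ ^ 6 / 8 = (G₀ ^ 2 / 2) ^ 3 := by ring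
      _ ≤ _ := by gcongr
  have h4 : (1 + √|s|) ^ 4 ≤ 8 * (1 + s ^ 2) := by
    have e : √|s| ^ 2 = |s| := Real.sq_sqrt (abs_nonneg s)
    have e2 : s ^ 2 = (√|s| ^ 2) ^ 2 := by rw [e, sq_abs]
    rw [e2]
    nlinarith [sq_nonneg (√|s| - 1), sq_nonneg (√|s| ^ 2 - 1), sq_nonneg (√|s|),
      sq_nonneg (√|s| ^ 2 - √|s|)]
  have h5 : 1 ≤ 8 / G₀ ^ 6 * r0 G₀ s ^ 3 := by
    calc (1 : ℝ) = 8 / G₀ ^ 6 * (G₀ ^ 6 / 8) := by field_simp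
      _ ≤ _ := by gcongr
  refine le_of_pow_le_pow_left₀ (n := 4) (by norm_num) (by positivity) ?_
  set D := 8 * A * (2 / G₀ ^ 2)
  have hD : 0 < D := by positivity
  calc (1 + √|s|) ^ 4 ≤ 8 * (A * r0 G₀ s ^ 3) := by simp only [A]; nlinarith
    _ = D * ((G₀ ^ 2 / 2) * r0 G₀ s ^ 3) := by simp only [D]; field_simp
    _ ≤ D * (r0 G₀ s * r0 G₀ s ^ 3) := by gcongr
    _ ≤ (1 + D) ^ 4 * (r0 G₀ s * r0 G₀ s ^ 3) := by
        gcongr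
        nlinarith [sq_nonneg D, sq_nonneg (D ^ 2), pow_pos hD 3]
    _ = _ := by ring

/-- If the radius is at most `m` somewhere in a bounded interval then `φ` is controlled by its
derivative. -/
theorem exists_abs_eval_le_of_radius_le {G₀ : ℝ} (hG₀ : 0 < G₀) :
    ∃ C > 0, ∀ (φ : D12) (m s₁ : ℝ), NoCollision G₀ φ → s₁ ∈ Icc 0 (2 * Real.pi) →
      radius G₀ φ s₁ ≤ m → ∀ s, |φ.eval s| ≤ C * (1 + m + ‖φ.weakDeriv‖) * r0 G₀ s := by
  obtain ⟨C, hC, h⟩ := exists_one_add_sqrt_le hG₀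
  refine ⟨1 + 4 * C, by positivity, fun φ m s₁ hφ hs₁ hm s => ?_⟩
  have hr := r0_pos hG₀ s
  have hr1 := r0_pos hG₀ s₁
  have hm0 : 0 < m := (hφ s₁).trans_le hm
  have hL := norm_nonneg φ.weakDeriv
  -- The lower bound is just positivity of the radius; only the upper bound uses the time `s₁`.
  have h1 : -r0 G₀ s ≤ φ.eval s := by
    have := hφ s
    unfold radius at this
    linarith
  have h2 := (abs_le.1 (φ.abs_eval_sub_le s₁ s)).2
  have h3 : √|s - s₁| ≤ 3 * (1 + √|s|) := by
    have hpi := Real.pi_le_four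
    have e : √|s| ^ 2 = |s| := Real.sq_sqrt (abs_nonneg s)
    have e2 : |s - s₁| ≤ |s| + 8 := by
      refine (abs_sub s s₁).trans ?_
      rw [abs_of_nonneg hs₁.1]; linarith [hs₁.2]
    exact Real.sqrt_le_iff.2 ⟨by positivity, by nlinarith [Real.sqrt_nonneg |s|]⟩
  have h4 : φ.eval s ≤ m + ‖φ.weakDeriv‖ * (3 * (1 + √|s|)) := by
    have : ‖φ.weakDeriv‖ * √|s - s₁| ≤ ‖φ.weakDeriv‖ * (3 * (1 + √|s|)) := by gcongr
    unfold radius at hm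
    linarith
  have h5 : m ≤ m * (C * r0 G₀ s) :=
    le_mul_of_one_le_right hm0.le (by linarith [h s, Real.sqrt_nonneg |s|])
  have h6 : ‖φ.weakDeriv‖ * (3 * (1 + √|s|)) ≤ ‖φ.weakDeriv‖ * (3 * (C * r0 G₀ s)) := by
    gcongr; exact h s
  have p1 : 0 ≤ C * r0 G₀ s := by positivity
  have p2 := mul_nonneg hm0.le p1
  have p3 := mul_nonneg hL p1
  have p4 := mul_nonneg hm0.le hr.le
  have p5 := mul_nonneg hL hr.le
  rw [abs_le]
  constructor <;> nlinarith

/-- A lower bound for the renormalized potential; the first term is a gain from convexity. -/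
theorem le_potDiff {G₀ : ℝ} (hG₀ : 0 < G₀) (G : ℝ) {φ : D12} {s : ℝ} (hr : 0 < radius G₀ φ s) :
    φ.eval s ^ 2 / ((radius G₀ φ s + 1) * (r0 G₀ s + 1) ^ 2)
      - G ^ 2 / 2 * (1 / radius G₀ φ s ^ 2) - 1 / r0 G₀ s ^ 2
      - (2 + G₀ ^ 2) * (|φ.eval s| / r0 G₀ s ^ 3) ≤ potDiff G₀ G φ s := by
  have hr0 := r0_pos hG₀ s
  unfold potDiff
  rw [pot_zero_right _ hr0, force_zero_right _ hr0]
  have hrad : radius G₀ φ s = r0 G₀ s + φ.eval s := rfl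
  set r := radius G₀ φ s
  set x := r0 G₀ s
  have hy : φ.eval s = r - x := by rw [hrad]; ring
  set y := φ.eval s
  have h1 : 1 / (r + 1) ≤ 1 / √(r ^ 2 + rho s ^ 2) := by
    have := sqrt_sq_add_le hr (rho_nonneg s)
    have := rho_le_one s
    have := hr.trans_le (le_sqrt_sq_add hr (rho s))
    gcongr
    linarith
  -- The exact remainder of the convex function `1/(· + 1)` above its tangent at `x`.
  have h2 : y ^ 2 / ((r + 1) * (x + 1) ^ 2) = 1 / (r + 1) - 1 / (x + 1) + y / (x + 1) ^ 2 := by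
    rw [hy]; field_simp; ring
  have h3 : 1 / x - 1 / (x + 1) ≤ 1 / x ^ 2 := by
    have : 1 / x - 1 / (x + 1) = 1 / (x * (x + 1)) := by field_simp; ring
    rw [this]
    gcongr
    nlinarith
  have h4 : y / (x + 1) ^ 2 - y / x ^ 2 ≤ 2 * (|y| / x ^ 3) := by
    have : y / (x + 1) ^ 2 - y / x ^ 2 = -y * ((2 * x + 1) / (x ^ 2 * (x + 1) ^ 2)) := by
      field_simp; ring
    rw [this]
    calc -y * ((2 * x + 1) / (x ^ 2 * (x + 1) ^ 2))
        ≤ |y| * ((2 * x + 1) / (x ^ 2 * (x + 1) ^ 2)) := by gcongr; exact neg_le_abs y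
      _ ≤ |y| * (2 / x ^ 3) := by
          gcongr ?_ * ?_
          rw [div_le_div_iff₀ (by positivity) (by positivity)]
          have : 0 < x ^ 2 := by positivity
          nlinarith [mul_pos this hr0]
      _ = _ := by ring
  have h5 : G₀ ^ 2 / x ^ 3 * y ≤ G₀ ^ 2 * (|y| / x ^ 3) := by
    calc G₀ ^ 2 / x ^ 3 * y ≤ G₀ ^ 2 / x ^ 3 * |y| := by gcongr; exact le_abs_self y
      _ = _ := by ring
  have h6 : 0 ≤ G₀ ^ 2 / (2 * x ^ 2) := by positivity
  have h7 : pot (G ^ 2) (rho s) r = 1 / √(r ^ 2 + rho s ^ 2) - G ^ 2 / 2 * (1 / r ^ 2) := by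
    unfold pot; field_simp
  rw [h2, h7]
  have h8 : (G₀ ^ 2 / x ^ 3 - 1 / x ^ 2) * y = G₀ ^ 2 / x ^ 3 * y - y / x ^ 2 := by ring
  rw [h8]
  linarith

/-- Bounded sublevels: the action controls `φ` when the radius is small somewhere in a bounded
interval and `∫ (r₀ + φ)⁻²` is bounded. -/
theorem exists_norm_le {G₀ : ℝ} (hG₀ : 0 < G₀) (G a K m : ℝ) :
    ∃ B, ∀ φ : D12, NoCollision G₀ φ → action G₀ G φ ≤ a → invSq G₀ φ ≤ K →
      (∃ s ∈ Icc 0 (2 * Real.pi), radius G₀ φ s ≤ m) → ‖φ‖ ≤ B := by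
  obtain ⟨C, hC, h⟩ := exists_abs_eval_le_of_radius_le hG₀
  set D := ∫ s, 1 / r0 G₀ s ^ 2
  have hD : 0 ≤ D := integral_nonneg fun s => by positivity
  set E := (2 + G₀ ^ 2) * C * D
  have hE : 0 ≤ E := by positivity
  set P := |a| + G ^ 2 / 2 * |K| + D + E * (1 + |m|)
  have hP : 0 ≤ P := by positivity
  refine ⟨C * (1 + |m| + (2 * P + 2 * E + 1)) * r0 G₀ 0 + (2 * P + 2 * E + 1),
    fun φ hφ ha hK ⟨s₁, hs₁, hm⟩ => ?_⟩
  have hφ' := h φ m s₁ hφ hs₁ hm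
  set L := ‖φ.weakDeriv‖
  have hL : 0 ≤ L := norm_nonneg _
  have hm0 : 0 < m := (hφ s₁).trans_le hm
  have hmabs : |m| = m := abs_of_pos hm0
  have hpt : ∀ s, -(G ^ 2 / 2) * (1 / radius G₀ φ s ^ 2)
      - (1 + (2 + G₀ ^ 2) * C * (1 + m + L)) * (1 / r0 G₀ s ^ 2) ≤ potDiff G₀ G φ s := by
    intro s
    have hr0 := r0_pos hG₀ s
    have hr := hφ s
    have h1 := le_potDiff hG₀ G hr
    have h2 : 0 ≤ φ.eval s ^ 2 / ((radius G₀ φ s + 1) * (r0 G₀ s + 1) ^ 2) := by positivity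
    have h3 : (2 + G₀ ^ 2) * (|φ.eval s| / r0 G₀ s ^ 3)
        ≤ (2 + G₀ ^ 2) * C * (1 + m + L) * (1 / r0 G₀ s ^ 2) := by
      calc (2 + G₀ ^ 2) * (|φ.eval s| / r0 G₀ s ^ 3)
          ≤ (2 + G₀ ^ 2) * (C * (1 + m + L) * r0 G₀ s / r0 G₀ s ^ 3) := by
            gcongr; exact hφ' s
        _ = _ := by field_simp
    linarith
  have hi1 : Integrable fun s => -(G ^ 2 / 2) * (1 / radius G₀ φ s ^ 2) :=
    (integrable_inv_radius_sq hG₀ hφ).const_mul _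
  have hi2 : Integrable fun s => (1 + (2 + G₀ ^ 2) * C * (1 + m + L)) * (1 / r0 G₀ s ^ 2) :=
    (integrable_inv_r0_sq hG₀).const_mul _
  have hi12 : Integrable fun s => -(G ^ 2 / 2) * (1 / radius G₀ φ s ^ 2)
      - (1 + (2 + G₀ ^ 2) * C * (1 + m + L)) * (1 / r0 G₀ s ^ 2) := hi1.sub hi2
  have hint : -(G ^ 2 / 2) * invSq G₀ φ - (1 + (2 + G₀ ^ 2) * C * (1 + m + L)) * D
      ≤ ∫ s, potDiff G₀ G φ s := by
    refine le_trans (le_of_eq ?_) (integral_mono hi12 (integrable_potDiff hG₀ G hφ) hpt)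
    rw [integral_sub hi1 hi2, integral_const_mul, integral_const_mul]
    rfl
  rw [action_eq hG₀ G hφ] at ha
  -- The kinetic term is quadratic in `L`, while all losses are at most linear.
  have hL2 : L ^ 2 ≤ 2 * P + 2 * E * L := by
    have h1 : G ^ 2 / 2 * invSq G₀ φ ≤ G ^ 2 / 2 * |K| := by
      gcongr; exact hK.trans (le_abs_self K)
    have h2 : (1 + (2 + G₀ ^ 2) * C * (1 + m + L)) * D = D + E * (1 + m) + E * L := by
      simp only [E]; ring
    have h3 := le_abs_self a
    rw [h2] at hint
    change 1 / 2 * L ^ 2 + _ ≤ a at ha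
    simp only [P, hmabs]
    linarith
  have hLle : L ≤ 2 * P + 2 * E + 1 := by
    by_contra hcon
    push Not at hcon
    nlinarith
  have h0 := hφ' 0
  calc ‖φ‖ ≤ |φ.eval 0| + L := φ.norm_le
    _ ≤ C * (1 + m + L) * r0 G₀ 0 + L := by gcongr
    _ ≤ _ := by
        have := r0_pos hG₀ 0
        rw [hmabs]
        gcongr

/-- The barrier of the mountain-pass geometry. -/
theorem exists_barrier {G₀ : ℝ} (hG₀ : 0 < G₀) :
    ∃ m > 0, ∃ C, ∀ φ : D12, (∀ s, m ≤ radius G₀ φ s) →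
      (∃ s ∈ Icc 0 (2 * Real.pi), radius G₀ φ s ≤ m) → C ≤ action G₀ G₀ φ := by
  obtain ⟨C, hC, h⟩ := exists_abs_eval_le_of_radius_le hG₀
  -- For `r ≥ 9G₀²` the centrifugal term is at most `1/(18r)`.
  set m := 1 + 9 * G₀ ^ 2
  have hm1 : 1 ≤ m := by simp only [m]; nlinarith [sq_nonneg G₀]
  set D := ∫ s, 1 / r0 G₀ s ^ 2
  have hD : 0 ≤ D := integral_nonneg fun s => by positivity
  set E := (2 + G₀ ^ 2) * C * D
  refine ⟨m, by linarith, -((1 + 2 * G₀ ^ 2) * D + E * (1 + m)) - E ^ 2 / 2,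
    fun φ hφm ⟨s₁, hs₁, hm⟩ => ?_⟩
  have hφ : NoCollision G₀ φ := fun s => by linarith [hφm s]
  have hφ' := h φ m s₁ hφ hs₁ hm
  set L := ‖φ.weakDeriv‖
  have hL : 0 ≤ L := norm_nonneg _
  have hpt : ∀ s, -(1 + 2 * G₀ ^ 2 + (2 + G₀ ^ 2) * C * (1 + m + L)) * (1 / r0 G₀ s ^ 2)
      ≤ potDiff G₀ G₀ φ s := by
    intro s
    have hr0 := r0_pos hG₀ s
    have hr := hφ s
    have hrm := hφm s
    have h1 := le_potDiff hG₀ G₀ hr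
    have h2 : 0 ≤ φ.eval s ^ 2 / ((radius G₀ φ s + 1) * (r0 G₀ s + 1) ^ 2) := by positivity
    have h3 : (2 + G₀ ^ 2) * (|φ.eval s| / r0 G₀ s ^ 3)
        ≤ (2 + G₀ ^ 2) * C * (1 + m + L) * (1 / r0 G₀ s ^ 2) := by
      calc (2 + G₀ ^ 2) * (|φ.eval s| / r0 G₀ s ^ 3)
          ≤ (2 + G₀ ^ 2) * (C * (1 + m + L) * r0 G₀ s / r0 G₀ s ^ 3) := by
            gcongr; exact hφ' s
        _ = _ := by field_simp
    -- No bound on `invSq` is available here. Where `r ≥ r₀/2` the centrifugal term is `O(1/r₀²)`;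
    -- elsewhere `|φ| ≥ r₀/2`, and the convexity gain is at least `1/(18r)` and absorbs it.
    have h4 : G₀ ^ 2 / 2 * (1 / radius G₀ φ s ^ 2) ≤ 2 * G₀ ^ 2 * (1 / r0 G₀ s ^ 2)
        + φ.eval s ^ 2 / ((radius G₀ φ s + 1) * (r0 G₀ s + 1) ^ 2) := by
      by_cases hs : 1 / 2 * r0 G₀ s ≤ radius G₀ φ s
      · have : G₀ ^ 2 / 2 * (1 / radius G₀ φ s ^ 2) ≤ G₀ ^ 2 / 2 * (1 / (1 / 2 * r0 G₀ s) ^ 2) := by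
          gcongr
        have e : G₀ ^ 2 / 2 * (1 / (1 / 2 * r0 G₀ s) ^ 2) = 2 * G₀ ^ 2 * (1 / r0 G₀ s ^ 2) := by
          field_simp
        linarith
      · push Not at hs
        have h5 : 0 ≤ 2 * G₀ ^ 2 * (1 / r0 G₀ s ^ 2) := by positivity
        have hrad : radius G₀ φ s = r0 G₀ s + φ.eval s := rfl
        set r := radius G₀ φ s
        set x := r0 G₀ s
        have hr1 : 1 ≤ r := hm1.trans hrm
        have h6 : G₀ ^ 2 / 2 * (1 / r ^ 2) ≤ 1 / (18 * r) := by
          rw [mul_one_div, div_div, div_le_div_iff₀ (by positivity) (by positivity)]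
          have : 9 * G₀ ^ 2 ≤ r := by simp only [m] at hrm; linarith
          nlinarith
        have h7 : 1 / (18 * r) ≤ φ.eval s ^ 2 / ((r + 1) * (x + 1) ^ 2) := by
          have hy : x ^ 2 / 4 ≤ φ.eval s ^ 2 := by
            have : x / 2 ≤ -φ.eval s := by linarith
            nlinarith
          calc 1 / (18 * r) = (x ^ 2 / 4) / (2 * r * (3 / 2 * x) ^ 2) := by
                field_simp; norm_num
            _ ≤ φ.eval s ^ 2 / ((r + 1) * (x + 1) ^ 2) := by
                gcongr
                · linarith
                · linarith
        linarith
    linarith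
  have hi : Integrable fun s =>
      -(1 + 2 * G₀ ^ 2 + (2 + G₀ ^ 2) * C * (1 + m + L)) * (1 / r0 G₀ s ^ 2) :=
    (integrable_inv_r0_sq hG₀).const_mul _
  have hint := integral_mono hi (integrable_potDiff hG₀ G₀ hφ) hpt
  rw [integral_const_mul] at hint
  rw [action_eq hG₀ G₀ hφ]
  have e : -(1 + 2 * G₀ ^ 2 + (2 + G₀ ^ 2) * C * (1 + m + L)) * D
    = -((1 + 2 * G₀ ^ 2) * D + E * (1 + m)) - E * L := by simp only [E]; ring
  have hint' : -(1 + 2 * G₀ ^ 2 + (2 + G₀ ^ 2) * C * (1 + m + L)) * D ≤ _ := hint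
  rw [e] at hint'
  nlinarith [sq_nonneg (L - E)]

/-! ### The constraint set -/

theorem continuous_eval_apply (s : ℝ) : Continuous fun φ : D12 => φ.eval s := by
  obtain ⟨C, hC, h⟩ := D12.exists_abs_eval_le one_pos
  rw [continuous_iff_continuousAt]
  intro φ
  rw [ContinuousAt, tendsto_iff_norm_sub_tendsto_zero]
  have hlim : Tendsto (fun ψ : D12 => C * ‖ψ - φ‖ * r0 1 s) (𝓝 φ) (𝓝 0) := by
    have : Continuous fun ψ : D12 => C * ‖ψ - φ‖ * r0 1 s := by fun_prop
    simpa using this.tendsto φ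
  refine squeeze_zero (fun _ => norm_nonneg _) (fun ψ => ?_) hlim
  rw [← D12.eval_sub]
  exact h (ψ - φ) s

theorem continuous_radius_apply (G₀ s : ℝ) : Continuous fun φ : D12 => radius G₀ φ s :=
  continuous_const.add (continuous_eval_apply s)

/-- Near a given `φ` only a fixed compact set of times can violate `r > m`, since where `r₀` is
large the radius is at least `r₀/2`. -/
theorem isClosed_constraintSet {G₀ : ℝ} (hG₀ : 0 < G₀) (m : ℝ) :
    IsClosed (constraintSet G₀ m) := by
  rw [← isOpen_compl_iff, Metric.isOpen_iff]
  intro φ hφ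
  have hφ' : ∀ s, m < radius G₀ φ s := by
    intro s
    by_contra hs
    exact hφ ⟨s, le_of_not_gt hs⟩
  obtain ⟨C, hC, h⟩ := exists_abs_eval_le_half hG₀
  obtain ⟨C', hC', h'⟩ := D12.exists_abs_eval_le hG₀
  set R := C * (‖φ‖ + 1) ^ 4 + 2 * (|m| + 1)
  have hR : 0 < R := by positivity
  set S := 1 + 2 * R ^ 3
  have hS : 0 < S := by positivity
  obtain ⟨s₀, -, hmin⟩ := isCompact_Icc.exists_isMinOn (s := Icc (-S) S)
    ⟨0, by constructor <;> linarith⟩ (continuous_radius hG₀ φ).continuousOn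
  have hd : 0 < radius G₀ φ s₀ - m := sub_pos.2 (hφ' s₀)
  refine ⟨min 1 ((radius G₀ φ s₀ - m) / (2 * C' * R)), by positivity, fun ψ hψ => ?_⟩
  rw [mem_ball_iff_norm, lt_min_iff] at hψ
  rintro ⟨s, hs⟩
  have hr0 := r0_pos hG₀ s
  by_cases hsR : R ≤ r0 G₀ s
  · have hn : ‖ψ‖ ≤ ‖φ‖ + 1 := by
      have := norm_le_norm_add_norm_sub' ψ φ
      linarith [hψ.1]
    have h1 : C * ‖ψ‖ ^ 4 ≤ r0 G₀ s := by
      have : C * ‖ψ‖ ^ 4 ≤ C * (‖φ‖ + 1) ^ 4 := by gcongr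
      have : 0 ≤ |m| := abs_nonneg m
      linarith
    have h2 := (abs_le.1 (h ψ s h1)).1
    have h3 : 2 * (|m| + 1) ≤ r0 G₀ s := by
      have : 0 ≤ C * (‖φ‖ + 1) ^ 4 := by positivity
      linarith
    unfold radius at hs
    linarith [le_abs_self m]
  · push Not at hsR
    have h1 : s ∈ Icc (-S) S := abs_le.1 (abs_le_of_r0_le hG₀ hsR.le)
    have h2 : radius G₀ φ s₀ ≤ radius G₀ φ s := hmin h1
    have h3 := (abs_le.1 (h' (ψ - φ) s)).1
    rw [D12.eval_sub] at h3
    have h4 := (lt_div_iff₀ (by positivity)).1 hψ.2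
    have h5 : C' * ‖ψ - φ‖ * r0 G₀ s ≤ C' * ‖ψ - φ‖ * R := by gcongr
    unfold radius at *
    linarith

/-! ### Removing the part of a path outside the constraint set -/

theorem D12.const_eq_smul (c : ℝ) : D12.const c = c • D12.const 1 :=
  D12.eval_injective (funext fun s => by
    rw [D12.eval_const, D12.eval_smul, D12.eval_const, mul_one])

theorem continuous_const_comp {X : Type*} [TopologicalSpace X] {f : X → ℝ} (hf : Continuous f) :
    Continuous fun x => D12.const (f x) := by
  simp only [fun x => D12.const_eq_smul (f x)]
  fun_prop

theorem exists_norm_path_le {ψ₁ ψ₂ : D12} (γ : Path ψ₁ ψ₂) : ∃ B, ∀ t, ‖γ t‖ ≤ B := by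
  obtain ⟨B, hB⟩ := (isCompact_range γ.continuous).isBounded.exists_norm_le
  exact ⟨B, fun t => hB _ (mem_range_self t)⟩

/-- If the action is below `b` on the part of a path in the constraint set and at the end points,
then the path can be changed so that the action is below `b` everywhere. -/
theorem exists_path_lt {G₀ : ℝ} (hG₀ : 0 < G₀) {G : ℝ} (hG : G ≠ 0) {m : ℝ}
    (hm : 1 + 4 * G ^ 2 ≤ m) {ψ₁ ψ₂ : D12} (γ : Path ψ₁ ψ₂) {b : ℝ}
    (h₁ : extAction G₀ G ψ₁ < b) (h₂ : extAction G₀ G ψ₂ < b)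
    (h : ∀ t, γ t ∈ constraintSet G₀ m → extAction G₀ G (γ t) < b) :
    ∃ γ' : Path ψ₁ ψ₂, ∀ t, extAction G₀ G (γ' t) < b := by
  have husc := upperSemicontinuous_extAction hG₀ hG
  obtain ⟨B, hB⟩ := exists_norm_path_le γ
  obtain ⟨a, ha⟩ := exists_action_le hG₀ hG B
  obtain ⟨c, hc0, hc⟩ := exists_action_add_const_le hG₀ G B a (b - 1)
  have hK : IsClosed {t | (b : EReal) ≤ extAction G₀ G (γ t)} :=
    (husc.isClosed_preimage (b : EReal)).preimage γ.continuous
  have hF : IsClosed ({t | γ t ∈ constraintSet G₀ m} ∪ {0, 1}) :=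
    ((isClosed_constraintSet hG₀ m).preimage γ.continuous).union (Set.toFinite _).isClosed
  have hdisj : Disjoint ({t | γ t ∈ constraintSet G₀ m} ∪ {0, 1})
      {t | (b : EReal) ≤ extAction G₀ G (γ t)} := by
    rw [Set.disjoint_left]
    rintro t (ht | ht | ht) hb
    · exact absurd hb (not_le.2 (h t ht))
    · rw [ht, Set.mem_ofPred_eq, γ.source] at hb
      exact absurd hb (not_le.2 h₁)
    · rw [mem_singleton_iff.1 ht, Set.mem_ofPred_eq, γ.target] at hb
      exact absurd hb (not_le.2 h₂)
  -- Adding the constant `c χ` leaves the path unchanged in the constraint set and at its ends, and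
  -- pushes it by the full `c` where the action is at least `b`. In the transition region the radius
  -- exceeds `1 + 4G²`, so any nonnegative constant can only lower the action.
  obtain ⟨χ, hχ0, hχ1, hχ⟩ := exists_continuous_zero_one_of_isClosed hF hK hdisj
  have hc00 : D12.const 0 = 0 := by rw [D12.const_eq_smul, zero_smul]
  refine ⟨⟨⟨fun t => γ t + D12.const (c * χ t),
    γ.continuous.add (continuous_const_comp (by fun_prop))⟩, ?_, ?_⟩, fun t => ?_⟩
  · have : χ 0 = 0 := hχ0 (Or.inr (Or.inl rfl))
    simp [this, hc00]
  · have : χ 1 = 0 := hχ0 (Or.inr (Or.inr rfl))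
    simp [this, hc00]
  · change extAction G₀ G (γ t + D12.const (c * χ t)) < b
    by_cases ht : γ t ∈ constraintSet G₀ m
    · have : χ t = 0 := hχ0 (Or.inl ht)
      rw [this, mul_zero, hc00, add_zero]
      exact h t ht
    · have hr : ∀ s, 1 + 4 * G ^ 2 ≤ radius G₀ (γ t) s := fun s => by
        by_contra hs
        exact ht ⟨s, by linarith⟩
      have hn : NoCollision G₀ (γ t) := fun s => lt_of_lt_of_le (by positivity) (hr s)
      have hcχ : 0 ≤ c * χ t := mul_nonneg hc0 (hχ t).1
      have hn' := noCollision_add_const hn hcχ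
      rw [extAction_of_noCollision hn', EReal.coe_lt_coe_iff]
      by_cases hb : (b : EReal) ≤ extAction G₀ G (γ t)
      · have h1 : χ t = 1 := hχ1 hb
        rw [h1, mul_one]
        linarith [hc (γ t) hr (hB t) (ha (γ t) hn (hB t)) c le_rfl]
      · rw [extAction_of_noCollision hn, not_le, EReal.coe_lt_coe_iff] at hb
        exact (action_add_const_le hG₀ G hr hcχ).trans_lt hb

/-! ### Normalization by a translation -/

theorem D12.shift_neg_shift (a : ℝ) (v : D12) : D12.shift a (D12.shift (-a) v) = v :=
  D12.eval_injective (funext fun s => by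
    rw [D12.eval_shift, D12.eval_shift, sub_neg_eq_add, sub_add_cancel])

/-- Every orbit can be translated by a multiple of the period so that it gets close to the origin
at a time in `[0, 2π]`. -/
theorem exists_normalize {G₀ : ℝ} (hG₀ : 0 < G₀) {φ : D12} {m : ℝ}
    (hm : ∃ s, radius G₀ φ s ≤ m) :
    ∃ (a : ℝ) (d : D12), (∃ s ∈ Icc 0 (2 * Real.pi), radius G₀ (D12.shift a φ + d) s ≤ m) ∧
      (∀ (χ : D12) (s : ℝ), radius G₀ (D12.shift a χ + d) s = radius G₀ χ (s - a)) ∧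
      ∀ (G : ℝ) (χ : D12), NoCollision G₀ χ →
        action G₀ G (D12.shift a χ + d) = action G₀ G χ ∧
        ∀ v, firstVar G₀ G (D12.shift a χ + d) (D12.shift a v) = firstVar G₀ G χ v := by
  obtain ⟨s, hs⟩ := hm
  obtain ⟨k, hk, -⟩ := existsUnique_add_zsmul_mem_Ico Real.two_pi_pos s 0
  obtain ⟨d, hd1, hd2⟩ := exists_translate hG₀ k
  refine ⟨k * (2 * Real.pi), d, ⟨s + k * (2 * Real.pi), ?_, ?_⟩, hd1, hd2⟩
  · rw [zsmul_eq_mul, zero_add] at hk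
    exact Ico_subset_Icc_self hk
  · rw [hd1, add_sub_cancel_right]
    exact hs

theorem noCollision_of_radius_eq {G₀ a : ℝ} {φ ψ : D12} (hφ : NoCollision G₀ φ)
    (h : ∀ s, radius G₀ ψ s = radius G₀ φ (s - a)) : NoCollision G₀ ψ := fun s => by
  rw [h]; exact hφ _

theorem invSq_of_radius_eq {G₀ a : ℝ} {φ ψ : D12}
    (h : ∀ s, radius G₀ ψ s = radius G₀ φ (s - a)) : invSq G₀ ψ = invSq G₀ φ := by
  unfold invSq
  simp only [h]
  exact integral_sub_right_eq_self (fun s => 1 / radius G₀ φ s ^ 2) a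

/-! ### Palais-Smale sequences -/

/-- Directions that are admissible at `φ`. -/
structure IsAdmissible (G₀ κ : ℝ) (φ v : D12) : Prop where
  norm_weakDeriv_le : ‖v.weakDeriv‖ ≤ κ
  abs_eval_le : ∀ s, |v.eval s| ≤ κ * radius G₀ φ s

theorem firstVar_smul {G₀ : ℝ} (hG₀ : 0 < G₀) (G : ℝ) {φ : D12} (hφ : NoCollision G₀ φ) (c : ℝ)
    (v : D12) : firstVar G₀ G φ (c • v) = c * firstVar G₀ G φ v := by
  rw [← fderiv_action_apply hG₀ G hφ, ← fderiv_action_apply hG₀ G hφ, map_smul, smul_eq_mul]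

theorem IsAdmissible.smul {G₀ κ : ℝ} {φ v : D12} (h : IsAdmissible G₀ κ φ v) (c : ℝ) :
    IsAdmissible G₀ (|c| * κ) φ (c • v) := by
  refine ⟨?_, fun s => ?_⟩
  · have e : (c • v).weakDeriv = c • v.weakDeriv := rfl
    rw [e, norm_smul, Real.norm_eq_abs]
    gcongr
    exact h.1
  · rw [D12.eval_smul, abs_mul, mul_assoc]
    gcongr
    exact h.2 s

theorem abs_firstVar_le_of_admissible {G₀ : ℝ} (hG₀ : 0 < G₀) {G ε : ℝ} {φ : D12}
    (hφ : NoCollision G₀ φ) (h : ∀ v, IsAdmissible G₀ 1 φ v → -ε ≤ firstVar G₀ G φ v)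
    {κ : ℝ} (hκ : 0 < κ) {w : D12} (hw : IsAdmissible G₀ κ φ w) :
    |firstVar G₀ G φ w| ≤ κ * ε := by
  have h1 := h (κ⁻¹ • w) (by
    have := hw.smul κ⁻¹
    rwa [abs_of_pos (inv_pos.2 hκ), inv_mul_cancel₀ hκ.ne'] at this)
  have h2 := h ((-κ⁻¹) • w) (by
    have := hw.smul (-κ⁻¹)
    rwa [abs_neg, abs_of_pos (inv_pos.2 hκ), inv_mul_cancel₀ hκ.ne'] at this)
  rw [firstVar_smul hG₀ G hφ] at h1 h2
  have e : firstVar G₀ G φ w = κ * (κ⁻¹ * firstVar G₀ G φ w) := by field_simp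
  rw [e, abs_mul, abs_of_pos hκ]
  gcongr
  rw [abs_le]
  constructor <;> linarith

/-- Admissibility bounds `v'` and `v/r`, quantities that translations preserve, whereas the norm
singles out time `0`. Along radii comparable with `r₀` the norm controls it. -/
theorem exists_admissible {G₀ : ℝ} (hG₀ : 0 < G₀) {δ : ℝ} (hδ : 0 < δ) :
    ∃ C > 0, ∀ φ v : D12, (∀ s, δ * r0 G₀ s ≤ radius G₀ φ s) →
      IsAdmissible G₀ (C * ‖v‖) φ v := by
  obtain ⟨C, hC, h⟩ := D12.exists_abs_eval_le hG₀
  refine ⟨1 + C / δ, by positivity, fun φ v hφ => ⟨?_, fun s => ?_⟩⟩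
  · refine v.norm_weakDeriv_le.trans (le_mul_of_one_le_left (norm_nonneg v) ?_)
    have : 0 < C / δ := by positivity
    linarith
  · have hr0 := r0_pos hG₀ s
    calc |v.eval s| ≤ C * ‖v‖ * r0 G₀ s := h v s
      _ = C / δ * ‖v‖ * (δ * r0 G₀ s) := by field_simp
      _ ≤ (1 + C / δ) * ‖v‖ * radius G₀ φ s := by
          gcongr
          · linarith
          · exact hφ s

/-- The force is monotone at infinity, so that the first variation controls the distance of two
functions in terms of their uniform distance on a bounded interval. -/
theorem exists_norm_weakDeriv_sub_sq_le {G₀ : ℝ} (hG₀ : 0 < G₀) (G B : ℝ) {δ : ℝ} (hδ : 0 < δ) :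
    ∃ S > 0, ∃ C > 0, ∀ φ ψ : D12, ‖φ‖ ≤ B → ‖ψ‖ ≤ B → (∀ s, δ * r0 G₀ s ≤ radius G₀ φ s) →
      (∀ s, δ * r0 G₀ s ≤ radius G₀ ψ s) → ∀ η, (∀ s ∈ Icc (-S) S, |(φ - ψ).eval s| ≤ η) →
      ‖(φ - ψ).weakDeriv‖ ^ 2 ≤
        firstVar G₀ G φ (φ - ψ) - firstVar G₀ G ψ (φ - ψ) + C * η ^ 2 := by
  obtain ⟨C, hC, h⟩ := exists_abs_eval_le_half hG₀
  set R := C * |B| ^ 4 + 2 * (2 + 24 * G ^ 2)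
  have hR : 0 < R := by positivity
  set S := 1 + 2 * R ^ 3
  have hS : 0 < S := by positivity
  set Q := quadConst G₀ (G ^ 2) δ
  have hQ : 0 ≤ Q := quadConst_nonneg (sq_nonneg G) hδ
  set D := ∫ s, 1 / r0 G₀ s ^ 2
  have hD : 0 ≤ D := integral_nonneg fun s => by positivity
  refine ⟨S, hS, Q * (2 / G₀ ^ 2) * D + 1, by positivity, fun φ ψ hφB hψB hφ hψ η hη => ?_⟩
  obtain ⟨_, h1⟩ := exists_forceDiff_mul_le hG₀ G (noCollision_of_le hG₀ hδ hφ)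
  obtain ⟨_, h2⟩ := exists_forceDiff_mul_le hG₀ G (noCollision_of_le hG₀ hδ hψ)
  have e1 : (φ - ψ).weakDeriv = φ.weakDeriv - ψ.weakDeriv := rfl
  have e : firstVar G₀ G φ (φ - ψ) - firstVar G₀ G ψ (φ - ψ) = ‖(φ - ψ).weakDeriv‖ ^ 2 +
      ∫ s, (forceDiff G₀ G φ s * (φ - ψ).eval s - forceDiff G₀ G ψ s * (φ - ψ).eval s) := by
    rw [integral_sub (h1 _).1 (h2 _).1, firstVar, firstVar, ← real_inner_self_eq_norm_sq]
    have : inner ℝ (φ - ψ).weakDeriv (φ - ψ).weakDeriv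
      = inner ℝ φ.weakDeriv (φ - ψ).weakDeriv - inner ℝ ψ.weakDeriv (φ - ψ).weakDeriv := by
      rw [← inner_sub_left, ← e1]
    rw [this]; ring
  have hpt : ∀ s, -(Q * (2 / G₀ ^ 2) * η ^ 2) * (1 / r0 G₀ s ^ 2) ≤
      forceDiff G₀ G φ s * (φ - ψ).eval s - forceDiff G₀ G ψ s * (φ - ψ).eval s := by
    intro s
    have hr0 := r0_pos hG₀ s
    have hw : (φ - ψ).eval s = radius G₀ φ s - radius G₀ ψ s := by
      rw [D12.eval_sub]; unfold radius; ring
    have e4 : forceDiff G₀ G φ s * (φ - ψ).eval s - forceDiff G₀ G ψ s * (φ - ψ).eval s =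
      (force (G ^ 2) (rho s) (radius G₀ φ s) - force (G ^ 2) (rho s) (radius G₀ ψ s))
        * (φ - ψ).eval s := by
      unfold forceDiff; ring
    rw [e4]
    -- Where `r₀ ≥ R` both radii lie in the region of monotone force and the integrand is
    -- nonnegative. The other times lie in `[-S, S]`, where the Lipschitz bound costs `η²`.
    by_cases hs : R ≤ r0 G₀ s
    · have hbig : ∀ χ : D12, ‖χ‖ ≤ B → 2 + 24 * G ^ 2 ≤ radius G₀ χ s := by
        intro χ hχ
        have h3 : C * ‖χ‖ ^ 4 ≤ C * |B| ^ 4 := by gcongr; exact hχ.trans (le_abs_self B)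
        have h4 := (abs_le.1 (h χ s (by linarith [sq_nonneg G]))).1
        have h5 : 0 ≤ C * |B| ^ 4 := by positivity
        unfold radius
        linarith
      have hp : rho s ^ 2 ≤ 1 := pow_le_one₀ (rho_nonneg s) (rho_le_one s)
      have hmono := force_monotoneOn (sq_nonneg G) hp
      have h0 : -(Q * (2 / G₀ ^ 2) * η ^ 2) * (1 / r0 G₀ s ^ 2) ≤ 0 := by
        have : 0 ≤ Q * (2 / G₀ ^ 2) * η ^ 2 * (1 / r0 G₀ s ^ 2) := by positivity
        linarith
      refine h0.trans ?_
      rw [hw]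
      rcases le_total (radius G₀ φ s) (radius G₀ ψ s) with hle | hle
      · exact mul_nonneg_of_nonpos_of_nonpos
          (sub_nonpos.2 (hmono (hbig φ hφB) (hbig ψ hψB) hle)) (sub_nonpos.2 hle)
      · exact mul_nonneg
          (sub_nonneg.2 (hmono (hbig ψ hψB) (hbig φ hφB) hle)) (sub_nonneg.2 hle)
    · push Not at hs
      have hsS : s ∈ Icc (-S) S := abs_le.1 (abs_le_of_r0_le hG₀ hs.le)
      have h3 := hη s hsS
      have h4 := (abs_force_sub_le (p := rho s) (sq_nonneg G) (by positivity) (hψ s) (hφ s))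
      rw [← hw] at h4
      have h5 := h4.trans (mul_le_mul_of_nonneg_right
        (quad_le_quadConst hG₀ (sq_nonneg G) hδ s) (abs_nonneg _))
      have hη0 : 0 ≤ η := (abs_nonneg _).trans h3
      have h6 : |(force (G ^ 2) (rho s) (radius G₀ φ s) - force (G ^ 2) (rho s) (radius G₀ ψ s))
        * (φ - ψ).eval s| ≤ Q * (2 / G₀ ^ 2) * η ^ 2 * (1 / r0 G₀ s ^ 2) := by
        rw [abs_mul]
        calc _ ≤ (Q / r0 G₀ s ^ 3 * η) * η := by
              gcongr
              exact h5.trans (by gcongr)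
          _ = Q * η ^ 2 * (1 / r0 G₀ s ^ 3) := by ring
          _ ≤ Q * η ^ 2 * (2 / G₀ ^ 2 * (1 / r0 G₀ s ^ 2)) := by
              gcongr; exact inv_r0_cube_le hG₀ s
          _ = _ := by ring
      have := (abs_le.1 h6).1
      linarith
  have hi : Integrable fun s =>
      forceDiff G₀ G φ s * (φ - ψ).eval s - forceDiff G₀ G ψ s * (φ - ψ).eval s :=
    (h1 _).1.sub (h2 _).1
  have hint := integral_mono ((integrable_inv_r0_sq hG₀).const_mul _) hi hpt
  rw [integral_const_mul] at hint
  have hint' : -(Q * (2 / G₀ ^ 2) * η ^ 2) * D ≤ _ := hint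
  rw [e]
  nlinarith [sq_nonneg η]

/-- Bounded sequences in `D^{1,2}` are precompact in the topology of locally uniform convergence. -/
theorem exists_tendsto_locally_uniformly (U : Ultrafilter ℕ) {ψ : ℕ → D12} {B : ℝ}
    (hB : ∀ n, ‖ψ n‖ ≤ B) : ∃ ℓ : ℝ → ℝ, ∀ S η : ℝ, 0 < η →
      ∀ᶠ n in (U : Filter ℕ), ∀ s ∈ Icc (-S) S, |(ψ n).eval s - ℓ s| ≤ η := by
  have hB0 : 0 ≤ B := (norm_nonneg _).trans (hB 0)
  have hex : ∀ s : ℝ, ∃ x, Tendsto (fun n => (ψ n).eval s) U (𝓝 x) := by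
    intro s
    have hc : IsCompact (Icc (-(B * (1 + √|s|))) (B * (1 + √|s|))) := isCompact_Icc
    obtain ⟨x, -, hx⟩ := hc.ultrafilter_le_nhds (U.map fun n => (ψ n).eval s) (by
      rw [Ultrafilter.coe_map, le_principal_iff, mem_map]
      refine univ_mem' fun n => ?_
      exact abs_le.1 (((ψ n).abs_eval_le s).trans (by gcongr; exact hB n)))
    exact ⟨x, hx⟩
  choose ℓ hℓ using hex
  refine ⟨ℓ, fun S η hη => ?_⟩
  have hhol : ∀ (n : ℕ) (a b : ℝ), |(ψ n).eval b - (ψ n).eval a| ≤ B * √|b - a| := fun n a b =>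
    ((ψ n).abs_eval_sub_le a b).trans (by
      gcongr; exact (ψ n).norm_weakDeriv_le.trans (hB n))
  have hℓhol : ∀ a b : ℝ, |ℓ b - ℓ a| ≤ B * √|b - a| := fun a b =>
    le_of_tendsto ((hℓ b).sub (hℓ a)).abs (Eventually.of_forall fun n => hhol n a b)
  -- The mesh at which the common Hölder modulus is at most `η/3`; pointwise convergence along the
  -- ultrafilter on a finite net then becomes uniform.
  set h := (η / (3 * (B + 1))) ^ 2
  have hh : 0 < h := by positivity
  have hBh : ∀ x : ℝ, |x| < h → B * √|x| ≤ η / 3 := by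
    intro x hx
    have h1 : √|x| ≤ η / (3 * (B + 1)) := Real.sqrt_le_iff.2 ⟨by positivity, hx.le⟩
    calc B * √|x| ≤ (B + 1) * (η / (3 * (B + 1))) := by gcongr; linarith
      _ = η / 3 := by field_simp
  obtain ⟨F, -, hF, hcov⟩ := (isCompact_Icc (a := -S) (b := S)).finite_cover_balls hh
  have hev : ∀ᶠ n in (U : Filter ℕ), ∀ t ∈ F, |(ψ n).eval t - ℓ t| < η / 3 := by
    rw [Filter.eventually_all_finite hF]
    intro t _
    have := (tendsto_iff_norm_sub_tendsto_zero.1 (hℓ t)).eventually_lt_const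
      (by positivity : 0 < η / 3)
    exact this
  filter_upwards [hev] with n hn s hs
  obtain ⟨t, htF, hst⟩ := mem_iUnion₂.1 (hcov hs)
  rw [Metric.mem_ball, Real.dist_eq] at hst
  have h1 := (hhol n t s).trans (hBh _ hst)
  have h2 := (hℓhol t s).trans (hBh _ hst)
  have h3 := hn t htF
  have e : (ψ n).eval s - ℓ s = ((ψ n).eval s - (ψ n).eval t) + ((ψ n).eval t - ℓ t)
    - (ℓ s - ℓ t) := by ring
  rw [e]
  have h4 := abs_sub ((ψ n).eval s - (ψ n).eval t + ((ψ n).eval t - ℓ t)) (ℓ s - ℓ t)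
  have h5 := abs_add_le ((ψ n).eval s - (ψ n).eval t) ((ψ n).eval t - ℓ t)
  linarith

/-- Bounded Palais-Smale sequences along which the radius stays comparable with `r₀` yield critical
points. -/
theorem exists_criticalPoint_of_palaisSmale {G₀ : ℝ} (hG₀ : 0 < G₀) {G B δ c : ℝ} (hδ : 0 < δ)
    {ψ : ℕ → D12} (hB : ∀ n, ‖ψ n‖ ≤ B) (hr : ∀ n s, δ * r0 G₀ s ≤ radius G₀ (ψ n) s)
    (hc : ∀ n, |action G₀ G (ψ n) - c| ≤ 1 / ((n : ℝ) + 1))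
    (hps : ∀ n v, IsAdmissible G₀ 1 (ψ n) v → -(1 / ((n : ℝ) + 1)) ≤ firstVar G₀ G (ψ n) v) :
    ∃ φ, IsCriticalPoint G₀ G φ ∧ action G₀ G φ = c := by
  have hB0 : 0 ≤ B := (norm_nonneg _).trans (hB 0)
  have hn : ∀ n, NoCollision G₀ (ψ n) := fun n => noCollision_of_le hG₀ hδ (hr n)
  obtain ⟨A, hA, hadm⟩ := exists_admissible hG₀ hδ
  obtain ⟨S, hS, Q, hQ, hmono⟩ := exists_norm_weakDeriv_sub_sq_le hG₀ G B hδ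
  set U : Ultrafilter ℕ := hyperfilter ℕ
  have hU : (U : Filter ℕ) ≤ atTop := Nat.hyperfilter_le_atTop
  have hlim0 : Tendsto (fun n : ℕ => 1 / ((n : ℝ) + 1)) U (𝓝 0) :=
    tendsto_one_div_add_atTop_nhds_zero_nat.mono_left hU
  obtain ⟨ℓ, hℓ⟩ := exists_tendsto_locally_uniformly U hB
  set κ := A * (2 * B + 1)
  have hκ : 0 < κ := by positivity
  -- Strong convergence: differences are uniformly small on `[-S, S]` and both first variations are
  -- small on them, so the monotonicity estimate makes the derivatives Cauchy in `L²`.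
  have hcauchy : Cauchy (map ψ (U : Filter ℕ)) := by
    rw [Metric.cauchy_iff]
    refine ⟨inferInstance, fun ε hε => ?_⟩
    set η := ε / (2 * (1 + 2 * κ + Q))
    have hη : 0 < η := by positivity
    refine ⟨ψ '' {n | (∀ s ∈ Icc (-S) S, |(ψ n).eval s - ℓ s| ≤ η / 2) ∧
      1 / ((n : ℝ) + 1) < η ^ 2}, ?_, ?_⟩
    · exact image_mem_map ((hℓ S (η / 2) (by positivity)).and
        (hlim0.eventually_lt_const (by positivity)))
    · rintro _ ⟨i, ⟨hi1, hi2⟩, rfl⟩ _ ⟨j, ⟨hj1, hj2⟩, rfl⟩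
      have hw : ∀ s ∈ Icc (-S) S, |(ψ i - ψ j).eval s| ≤ η := fun s hs => by
        have e : (ψ i - ψ j).eval s = ((ψ i).eval s - ℓ s) - ((ψ j).eval s - ℓ s) := by
          rw [D12.eval_sub]; ring
        rw [e]
        refine (abs_sub _ _).trans ?_
        linarith [hi1 s hs, hj1 s hs]
      have h1 := hmono (ψ i) (ψ j) (hB i) (hB j) (hr i) (hr j) η hw
      have hnw : A * ‖ψ i - ψ j‖ ≤ κ := by
        have := (norm_sub_le (ψ i) (ψ j)).trans (add_le_add (hB i) (hB j))
        simp only [κ]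
        gcongr
        linarith
      have hadm' : ∀ n, IsAdmissible G₀ κ (ψ n) (ψ i - ψ j) := fun n =>
        ⟨(hadm (ψ n) (ψ i - ψ j) (hr n)).1.trans hnw, fun s =>
          ((hadm (ψ n) (ψ i - ψ j) (hr n)).2 s).trans (by
            have := (hn n s).le
            gcongr)⟩
      have h2 := (abs_le.1 (abs_firstVar_le_of_admissible hG₀ (hn i) (hps i) hκ (hadm' i))).2
      have h3 := (abs_le.1 (abs_firstVar_le_of_admissible hG₀ (hn j) (hps j) hκ (hadm' j))).1
      have h4 : κ * (1 / ((i : ℝ) + 1)) ≤ κ * η ^ 2 := by gcongr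
      have h5 : κ * (1 / ((j : ℝ) + 1)) ≤ κ * η ^ 2 := by gcongr
      have h6 : |(ψ i - ψ j).eval 0| ≤ η := hw 0 ⟨by linarith, hS.le⟩
      have h7 : ‖ψ i - ψ j‖ ^ 2 ≤ (1 + 2 * κ + Q) * η ^ 2 := by
        rw [D12.norm_sq, ← sq_abs]
        have : |(ψ i - ψ j).eval 0| ^ 2 ≤ η ^ 2 := by gcongr
        linarith
      rw [dist_eq_norm]
      refine lt_of_pow_lt_pow_left₀ 2 hε.le (h7.trans_lt ?_)
      have h8 : ε = 2 * (1 + 2 * κ + Q) * η := by simp only [η]; field_simp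
      rw [h8]
      have h9 : 1 ≤ 1 + 2 * κ + Q := by linarith
      have h10 : 0 < η ^ 2 := by positivity
      nlinarith [mul_pos (by linarith : 0 < 1 + 2 * κ + Q) h10,
        mul_le_mul_of_nonneg_right h9 (mul_pos (by linarith : 0 < 1 + 2 * κ + Q) h10).le]
  obtain ⟨φ, hφ⟩ := cauchy_iff_exists_le_nhds.1 hcauchy
  have hφ : Tendsto ψ U (𝓝 φ) := hφ
  have hrφ : ∀ s, δ * r0 G₀ s ≤ radius G₀ φ s := fun s =>
    ge_of_tendsto (((continuous_radius_apply G₀ s).tendsto φ).comp hφ)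
      (Eventually.of_forall fun n => hr n s)
  have hnφ := noCollision_of_le hG₀ hδ hrφ
  refine ⟨φ, (isCriticalPoint_iff hG₀ G φ).2 ⟨hnφ, fun v => ?_⟩, ?_⟩
  · have h1 := (tendsto_firstVar hG₀ G hnφ v).comp hφ
    have h2 : Tendsto (fun n => firstVar G₀ G (ψ n) v) U (𝓝 0) := by
      have hκv : 0 < A * ‖v‖ + 1 := by positivity
      refine squeeze_zero_norm (a := fun n : ℕ => (A * ‖v‖ + 1) * (1 / ((n : ℝ) + 1)))
        (fun n => ?_) (by simpa using hlim0.const_mul (A * ‖v‖ + 1))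
      refine abs_firstVar_le_of_admissible hG₀ (hn n) (hps n) hκv ?_
      refine ⟨(hadm (ψ n) v (hr n)).1.trans (by linarith), fun s =>
        ((hadm (ψ n) v (hr n)).2 s).trans ?_⟩
      have := (hn n s).le
      gcongr
      linarith
    exact tendsto_nhds_unique h1 h2
  · have h1 := (continuousAt_action hG₀ G hnφ).tendsto.comp hφ
    have h2 : Tendsto (fun n => action G₀ G (ψ n)) U (𝓝 c) :=
      tendsto_iff_norm_sub_tendsto_zero.2
        (squeeze_zero (fun _ => norm_nonneg _) hc hlim0)
    exact tendsto_nhds_unique h1 h2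

/-- If `c` is not a critical level then there are uniform directions of descent near the level
`c`. -/
theorem exists_descent {G₀ : ℝ} (hG₀ : 0 < G₀) (G K m c : ℝ)
    (hcrit : ¬ ∃ φ, IsCriticalPoint G₀ G φ ∧ action G₀ G φ = c) :
    ∃ ε > 0, ∀ φ, NoCollision G₀ φ → invSq G₀ φ ≤ K → (∃ s, radius G₀ φ s ≤ m) →
      |action G₀ G φ - c| ≤ ε → ∃ v, IsAdmissible G₀ 1 φ v ∧ firstVar G₀ G φ v < -ε := by
  by_contra hcon
  push Not at hcon
  have hseq : ∀ n : ℕ, ∃ ψ : D12, NoCollision G₀ ψ ∧ invSq G₀ ψ ≤ K ∧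
      (∃ s ∈ Icc 0 (2 * Real.pi), radius G₀ ψ s ≤ m) ∧
      |action G₀ G ψ - c| ≤ 1 / ((n : ℝ) + 1) ∧
      ∀ v, IsAdmissible G₀ 1 ψ v → -(1 / ((n : ℝ) + 1)) ≤ firstVar G₀ G ψ v := by
    intro n
    obtain ⟨φ, h1, h2, h3, h4, h5⟩ := hcon (1 / ((n : ℝ) + 1)) (by positivity)
    obtain ⟨a, d, g1, g2, g3⟩ := exists_normalize hG₀ h3
    refine ⟨D12.shift a φ + d, noCollision_of_radius_eq h1 (g2 φ),
      (invSq_of_radius_eq (g2 φ)).le.trans h2, g1, ?_, fun v hv => ?_⟩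
    -- The almost critical point is replaced by its normalized translate; the level, `invSq` and the
    -- admissible directions are all translation invariant.
    · rw [(g3 G φ h1).1]; exact h4
    · have h6 := h5 (D12.shift (-a) v) ⟨by rw [D12.norm_weakDeriv_shift]; exact hv.1, fun s => by
        have := hv.2 (s + a)
        rw [D12.eval_shift, sub_neg_eq_add]
        rwa [g2, add_sub_cancel_right] at this⟩
      rwa [← (g3 G φ h1).2, D12.shift_neg_shift] at h6
  choose ψ h1 h2 h3 h4 h5 using hseq
  obtain ⟨B, hB⟩ := exists_norm_le hG₀ G (c + 1) K m
  have hψB : ∀ n, ‖ψ n‖ ≤ B := fun n => hB (ψ n) (h1 n) (by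
    have := (abs_le.1 (h4 n)).2
    have h6 : 1 / ((n : ℝ) + 1) ≤ 1 := by
      rw [div_le_one (by positivity)]
      linarith [(Nat.cast_nonneg n : (0 : ℝ) ≤ n)]
    linarith) (h2 n) (h3 n)
  obtain ⟨δ, hδ, hr⟩ := exists_le_radius_of_invSq_le hG₀ B K
  exact hcrit (exists_criticalPoint_of_palaisSmale hG₀ hδ hψB
    (fun n => hr (ψ n) (h1 n) (hψB n) (h2 n)) h4 h5)

/-! ### Deformation of paths -/

/-- Nothing bounds the norm of `φ` itself, as its close approach may occur at any time. Its
normalized translate is bounded, and the Taylor estimate there carries back with a uniform constant.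
-/
theorem exists_action_add_le {G₀ : ℝ} (hG₀ : 0 < G₀) (G a K m : ℝ) :
    ∃ C > 0, ∀ (φ w : D12) (κ : ℝ), NoCollision G₀ φ → action G₀ G φ ≤ a → invSq G₀ φ ≤ K →
      (∃ s, radius G₀ φ s ≤ m) → IsAdmissible G₀ κ φ w → κ ≤ 1 / 2 →
      action G₀ G (φ + w) ≤ action G₀ G φ + firstVar G₀ G φ w + C * κ ^ 2 := by
  obtain ⟨B, hB⟩ := exists_norm_le hG₀ G a K m
  obtain ⟨δ, hδ, hr⟩ := exists_le_radius_of_invSq_le hG₀ B K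
  obtain ⟨C, hC, hT⟩ := exists_action_taylor hG₀ G (half_pos hδ)
  refine ⟨C * (1 + r0 G₀ 0 + |B|) ^ 2, by have := r0_pos hG₀ 0; positivity,
    fun φ w κ hφ ha hK hm hw hκ => ?_⟩
  have hκ0 : 0 ≤ κ := (norm_nonneg _).trans hw.1
  obtain ⟨t, d, g1, g2, g3⟩ := exists_normalize hG₀ hm
  set ψ := D12.shift t φ + d
  have hψ : NoCollision G₀ ψ := noCollision_of_radius_eq hφ (g2 φ)
  have hψB : ‖ψ‖ ≤ B := hB ψ hψ ((g3 G φ hφ).1.le.trans ha)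
    ((invSq_of_radius_eq (g2 φ)).le.trans hK) g1
  have hψr := hr ψ hψ hψB ((invSq_of_radius_eq (g2 φ)).le.trans hK)
  have e : D12.shift t (φ + w) + d = ψ + D12.shift t w := by
    rw [D12.shift_add]; simp only [ψ]; abel
  have hφw : NoCollision G₀ (φ + w) := fun s => by
    rw [radius_add]
    have h1 := (abs_le.1 (hw.2 s)).1
    have h2 := hφ s
    nlinarith
  have hwψ : ∀ s, |(D12.shift t w).eval s| ≤ κ * radius G₀ ψ s := fun s => by
    rw [D12.eval_shift, g2]; exact hw.2 _
  have h1 := hT ψ (D12.shift t w) (fun s => by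
    have h2 := hψr s
    have h3 := r0_pos hG₀ s
    nlinarith) (fun s => by
    rw [radius_add]
    have h1 := (abs_le.1 (hwψ s)).1
    have h2 := hψ s
    have h3 := hψr s
    nlinarith)
  rw [← e, (g3 G _ hφw).1, (g3 G φ hφ).1, (g3 G φ hφ).2] at h1
  have h2 : ‖D12.shift t w‖ ≤ κ * (1 + r0 G₀ 0 + |B|) := by
    refine (D12.norm_le _).trans ?_
    rw [D12.norm_weakDeriv_shift]
    have h3 := hwψ 0
    have h4 : radius G₀ ψ 0 ≤ r0 G₀ 0 + |B| := by
      unfold radius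
      have := (le_abs_self _).trans (ψ.abs_eval_zero_le.trans (hψB.trans (le_abs_self B)))
      linarith
    have h5 : κ * radius G₀ ψ 0 ≤ κ * (r0 G₀ 0 + |B|) := by gcongr
    linarith [hw.1]
  have h3 : C * ‖D12.shift t w‖ ^ 2 ≤ C * (κ * (1 + r0 G₀ 0 + |B|)) ^ 2 := by gcongr
  have h4 := (abs_le.1 h1).2
  nlinarith

theorem isOpen_lt_extAction {G₀ : ℝ} (hG₀ : 0 < G₀) (G b : ℝ) :
    IsOpen {φ | (b : EReal) < extAction G₀ G φ} := by
  rw [isOpen_iff_mem_nhds]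
  intro φ hφ
  rw [Set.mem_ofPred_eq] at hφ
  by_cases hn : NoCollision G₀ φ
  · rw [extAction_of_noCollision hn, EReal.coe_lt_coe_iff] at hφ
    filter_upwards [(continuousAt_action hG₀ G hn).eventually_const_lt hφ,
      (isOpen_noCollision hG₀).mem_nhds hn] with ψ h2 h3
    rw [extAction_of_noCollision h3, EReal.coe_lt_coe_iff]
    exact h2
  · rw [extAction_of_not hn] at hφ
    exact absurd hφ not_lt_bot

theorem noCollision_of_lt_extAction {G₀ G : ℝ} {b : ℝ} {φ : D12}
    (h : (b : EReal) < extAction G₀ G φ) : NoCollision G₀ φ := by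
  by_contra hn
  rw [extAction_of_not hn] at h
  exact absurd h not_lt_bot

/-- A direction admissible at `φ` with constant 1 is therefore admissible nearby with constant 2;
hence the factor 2 in `descentCone`. -/
theorem eventually_radius_le_two_mul {G₀ : ℝ} (hG₀ : 0 < G₀) {φ : D12} (hφ : NoCollision G₀ φ) :
    ∀ᶠ ψ in 𝓝 φ, ∀ s, radius G₀ φ s ≤ 2 * radius G₀ ψ s := by
  obtain ⟨δ, hδ, -, hr⟩ := hφ.exists_le hG₀
  obtain ⟨C, hC, h⟩ := D12.exists_abs_eval_le hG₀
  filter_upwards [Metric.ball_mem_nhds φ (by positivity : 0 < δ / (2 * C))] with ψ hψ s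
  rw [mem_ball_iff_norm, lt_div_iff₀ (by positivity)] at hψ
  have h1 := (abs_le.1 (h (ψ - φ) s)).1
  rw [D12.eval_sub] at h1
  have h2 := hr s
  have h3 := r0_pos hG₀ s
  have h4 : ‖ψ - φ‖ * (2 * C) * r0 G₀ s ≤ δ * r0 G₀ s := by gcongr
  unfold radius at *
  linarith

/-- Vectors `(v, η)` such that `v` is a direction of descent of `action G₀ G` at `φ` with speed at
most `η`. -/
def descentCone (G₀ G ε : ℝ) (φ : D12) : Set (D12 × ℝ) :=
  {p | ‖p.1.weakDeriv‖ ≤ p.2 ∧ (∀ s, |p.1.eval s| ≤ 2 * p.2 * radius G₀ φ s) ∧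
    fderiv ℝ (action G₀ G) φ p.1 ≤ -ε * p.2 ∧ p.2 ≤ 1}

/-- Carrying the speed as a second component makes all the conditions convex, so that descent
directions may be averaged by a partition of unity. -/
theorem convex_descentCone (G₀ G ε : ℝ) (φ : D12) : Convex ℝ (descentCone G₀ G ε φ) := by
  intro p hp q hq a b ha hb hab
  obtain ⟨p1, p2, p3, p4⟩ := hp
  obtain ⟨q1, q2, q3, q4⟩ := hq
  refine ⟨?_, fun s => ?_, ?_, ?_⟩
  · have e : (a • p + b • q).1.weakDeriv = a • p.1.weakDeriv + b • q.1.weakDeriv := rfl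
    rw [e]
    refine (norm_add_le _ _).trans ?_
    rw [norm_smul, norm_smul, Real.norm_of_nonneg ha, Real.norm_of_nonneg hb]
    simp only [Prod.snd_add, Prod.smul_snd, smul_eq_mul]
    gcongr
  · simp only [Prod.fst_add, Prod.smul_fst, Prod.snd_add, Prod.smul_snd, smul_eq_mul, D12.eval_add,
      D12.eval_smul]
    refine (abs_add_le _ _).trans ?_
    rw [abs_mul, abs_mul, abs_of_nonneg ha, abs_of_nonneg hb]
    nlinarith [mul_le_mul_of_nonneg_left (p2 s) ha, mul_le_mul_of_nonneg_left (q2 s) hb]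
  · simp only [Prod.fst_add, Prod.smul_fst, Prod.snd_add, Prod.smul_snd, smul_eq_mul, map_add,
      map_smul]
    nlinarith [mul_le_mul_of_nonneg_left p3 ha, mul_le_mul_of_nonneg_left q3 hb]
  · simp only [Prod.snd_add, Prod.smul_snd, smul_eq_mul]
    nlinarith

theorem zero_mem_descentCone (G₀ G ε : ℝ) (φ : D12) : (0 : D12 × ℝ) ∈ descentCone G₀ G ε φ := by
  refine ⟨?_, fun s => ?_, ?_, zero_le_one⟩
  · change ‖(0 : D12).weakDeriv‖ ≤ 0
    exact (D12.norm_weakDeriv_le 0).trans norm_zero.le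
  · have : (0 : D12).eval s = 0 := by
      rw [← sub_self (0 : D12), D12.eval_sub, sub_self]
    simp [this]
  · simp

/-- A continuous selection of directions of descent along a path. -/
theorem exists_descent_field {G₀ : ℝ} (hG₀ : 0 < G₀) {G ε : ℝ} {X : Type*} [TopologicalSpace X]
    [NormalSpace X] [ParacompactSpace X] {γ : X → D12} (hγ : Continuous γ) {T Ω : Set X}
    (hT : IsClosed T) (hΩ : IsOpen Ω) (hTΩ : T ⊆ Ω)
    (h : ∀ t ∈ T, NoCollision G₀ (γ t) ∧
      ∃ v, IsAdmissible G₀ 1 (γ t) v ∧ firstVar G₀ G (γ t) v < -ε) :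
    ∃ g : C(X, D12 × ℝ), ∀ t, g t ∈ descentCone G₀ G ε (γ t) ∧ (t ∈ T → (g t).2 = 1) ∧
      (t ∉ Ω → g t = 0) := by
  -- Constant local choices suffice: `(v, 1)` near a point of `T`, and `0` away from `T`.
  refine exists_continuous_forall_mem_convex_of_local_const
    (t := fun t => {p | p ∈ descentCone G₀ G ε (γ t) ∧ (t ∈ T → p.2 = 1) ∧ (t ∉ Ω → p = 0)})
    (fun t => ?_) (fun t => ?_)
  · intro p hp q hq a b ha hb hab
    refine ⟨convex_descentCone G₀ G ε (γ t) hp.1 hq.1 ha hb hab, fun ht => ?_, fun ht => ?_⟩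
    · simp [hp.2.1 ht, hq.2.1 ht, hab]
    · simp [hp.2.2 ht, hq.2.2 ht]
  · by_cases ht : t ∈ T
    · obtain ⟨hn, v, hv1, hv2⟩ := h t ht
      refine ⟨(v, 1), ?_⟩
      filter_upwards [hΩ.mem_nhds (hTΩ ht), hγ.continuousAt.eventually
        (eventually_radius_le_two_mul hG₀ hn), hγ.continuousAt.eventually
        ((isOpen_noCollision hG₀).mem_nhds hn), hγ.continuousAt.eventually
        ((tendsto_firstVar hG₀ G hn v).eventually_lt_const hv2)] with y h1 h2 h3 h4
      refine ⟨⟨hv1.1, fun s => ?_, ?_, le_rfl⟩, fun _ => rfl, fun hy => absurd h1 hy⟩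
      · have := hv1.2 s
        have := h2 s
        simp only
        linarith
      · simp only
        rw [fderiv_action_apply hG₀ G h3]
        linarith
    · refine ⟨0, ?_⟩
      filter_upwards [hT.isOpen_compl.mem_nhds ht] with y hy
      exact ⟨zero_mem_descentCone _ _ _ _, fun hy' => absurd hy' hy, fun _ => rfl⟩

theorem isOpen_exists_radius_lt (G₀ m : ℝ) : IsOpen {φ : D12 | ∃ s, radius G₀ φ s < m} := by
  simp only [Set.ofPred_exists]
  exact isOpen_iUnion fun s => isOpen_Iio.preimage (continuous_radius_apply G₀ s)

/-- If `c` is not a critical level, then paths whose action does not much exceed `c` and along which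
`invSq` is bounded at the level `c` can be deformed to paths whose action is below `c` in the
constraint set. -/
theorem exists_deformation {G₀ : ℝ} (hG₀ : 0 < G₀) {G : ℝ} (hG : G ≠ 0) (K : ℝ) {m : ℝ}
    (hm : 0 < m) {c : ℝ} (hcrit : ¬ ∃ φ, IsCriticalPoint G₀ G φ ∧ action G₀ G φ = c) :
    ∃ ε > 0, ∀ e > 0, e ≤ ε → ∀ {ψ₁ ψ₂ : D12} (γ : Path ψ₁ ψ₂),
      extAction G₀ G ψ₁ < ((c - e : ℝ) : EReal) → extAction G₀ G ψ₂ < ((c - e : ℝ) : EReal) →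
      (∀ t, extAction G₀ G (γ t) < ((c + e : ℝ) : EReal)) →
      (∀ t, ((c - e : ℝ) : EReal) < extAction G₀ G (γ t) → invSq G₀ (γ t) ≤ K) →
      ∃ γ' : Path ψ₁ ψ₂, ∀ t, γ' t ∈ constraintSet G₀ m → extAction G₀ G (γ' t) < (c : EReal) := by
  obtain ⟨ε, hε, hdesc⟩ := exists_descent hG₀ G K (m + 2) c hcrit
  obtain ⟨C, hC, hT⟩ := exists_action_add_le hG₀ G (c + ε) K (m + 2)
  -- The three conditions keep the step admissible with constant at most 1/2, make the second order
  -- error at most half of the first order gain, and ensure that a point moved into the constraint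
  -- set at `m` came from the one at `m + 1`.
  obtain ⟨τ, hτ, hτ1, hτ2, hτ3⟩ : ∃ τ > 0, τ ≤ 1 / 4 ∧ 8 * C * τ ≤ ε ∧ 2 * τ * (m + 1) ≤ 1 := by
    refine ⟨min (1 / 4) (min (ε / (8 * C)) (1 / (2 * (m + 1)))), by positivity,
      min_le_left _ _, ?_, ?_⟩
    · have : min (1 / 4) (min (ε / (8 * C)) (1 / (2 * (m + 1)))) ≤ ε / (8 * C) :=
        (min_le_right _ _).trans (min_le_left _ _)
      rw [le_div_iff₀ (by positivity)] at this
      linarith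
    · have : min (1 / 4) (min (ε / (8 * C)) (1 / (2 * (m + 1)))) ≤ 1 / (2 * (m + 1)) :=
        (min_le_right _ _).trans (min_le_right _ _)
      rw [le_div_iff₀ (by positivity)] at this
      linarith
  refine ⟨min ε (τ * ε / 4), by positivity, fun e he heε ψ₁ ψ₂ γ h₁ h₂ hup hK => ?_⟩
  have heε1 : e ≤ ε := heε.trans (min_le_left _ _)
  have heε2 : e ≤ τ * ε / 4 := heε.trans (min_le_right _ _)
  -- The descent must have full speed on `T` and is switched off outside `Ω`, which avoids the end
  -- points and on which `invSq` is bounded.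
  set T : Set unitInterval := {t | ((c - e / 2 : ℝ) : EReal) ≤ extAction G₀ G (γ t)} ∩
    {t | γ t ∈ constraintSet G₀ (m + 1)}
  set Ω : Set unitInterval := {t | ((c - e : ℝ) : EReal) < extAction G₀ G (γ t)} ∩
    {t | ∃ s, radius G₀ (γ t) s < m + 2}
  have hTc : IsClosed T :=
    (((upperSemicontinuous_extAction hG₀ hG).isClosed_preimage _).preimage γ.continuous).inter
      ((isClosed_constraintSet hG₀ _).preimage γ.continuous)
  have hΩo : IsOpen Ω := ((isOpen_lt_extAction hG₀ G (c - e)).preimage γ.continuous).inter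
    ((isOpen_exists_radius_lt G₀ (m + 2)).preimage γ.continuous)
  have hTΩ : T ⊆ Ω := fun t ht => by
    obtain ⟨h3, s, hs⟩ := ht
    refine ⟨lt_of_lt_of_le (EReal.coe_lt_coe_iff.2 (by linarith)) (show _ ≤ _ from h3), s,
      hs.trans_lt (by linarith)⟩
  have hreg : ∀ t ∈ Ω, NoCollision G₀ (γ t) ∧ c - e < action G₀ G (γ t) ∧
      action G₀ G (γ t) < c + e ∧ invSq G₀ (γ t) ≤ K ∧ ∃ s, radius G₀ (γ t) s ≤ m + 2 := by
    rintro t ⟨h3, s, hs⟩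
    have hn := noCollision_of_lt_extAction h3
    have h4 := hup t
    have h5 := hK t h3
    rw [Set.mem_ofPred_eq, extAction_of_noCollision hn, EReal.coe_lt_coe_iff] at h3
    rw [extAction_of_noCollision hn, EReal.coe_lt_coe_iff] at h4
    exact ⟨hn, h3, h4, h5, s, hs.le⟩
  obtain ⟨g, hg⟩ := exists_descent_field hG₀ (ε := ε) γ.continuous hTc hΩo hTΩ fun t ht => by
    obtain ⟨h3, h4, h5, h6, h7⟩ := hreg t (hTΩ ht)
    exact ⟨h3, hdesc _ h3 h6 h7 (abs_le.2 ⟨by linarith, by linarith⟩)⟩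
  have hkey : ∀ t ∈ Ω, NoCollision G₀ (γ t + τ • (g t).1) ∧
      action G₀ G (γ t + τ • (g t).1) ≤ action G₀ G (γ t) - τ * ε / 2 * (g t).2 := by
    intro t ht
    obtain ⟨h3, h4, h5, h6, h7⟩ := hreg t ht
    obtain ⟨⟨g1, g2, g3, g4⟩, -, -⟩ := hg t
    have g0 : 0 ≤ (g t).2 := (norm_nonneg _).trans g1
    have hadm : IsAdmissible G₀ (τ * (2 * (g t).2)) (γ t) (τ • (g t).1) := by
      have : IsAdmissible G₀ (2 * (g t).2) (γ t) (g t).1 := ⟨by linarith, g2⟩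
      simpa [abs_of_pos hτ] using this.smul τ
    have hκ : τ * (2 * (g t).2) ≤ 1 / 2 := by nlinarith
    refine ⟨fun s => ?_, ?_⟩
    · rw [radius_add]
      have h8 := (abs_le.1 (hadm.2 s)).1
      have h9 := h3 s
      nlinarith
    · have h8 := hT _ _ _ h3 (by linarith) h6 h7 hadm hκ
      rw [firstVar_smul hG₀ G h3, ← fderiv_action_apply hG₀ G h3] at h8
      have h9 : τ * fderiv ℝ (action G₀ G) (γ t) (g t).1 ≤ τ * (-ε * (g t).2) := by gcongr
      have h10 : C * (τ * (2 * (g t).2)) ^ 2 ≤ τ * ε / 2 * (g t).2 := by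
        calc C * (τ * (2 * (g t).2)) ^ 2 = (8 * C * τ) * (τ / 2 * (g t).2 * (g t).2) := by ring
          _ ≤ ε * (τ / 2 * (g t).2 * 1) := by gcongr
          _ = _ := by ring
      linarith
  have hends : ∀ t, γ t = ψ₁ ∨ γ t = ψ₂ → (g t).1 = 0 := by
    intro t ht
    have : t ∉ Ω := by
      rintro ⟨h3, -⟩
      rw [Set.mem_ofPred_eq] at h3
      rcases ht with ht | ht
      · rw [ht] at h3; exact absurd h3 h₁.not_gt
      · rw [ht] at h3; exact absurd h3 h₂.not_gt
    rw [(hg t).2.2 this]; rfl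
  refine ⟨⟨⟨fun t => γ t + τ • (g t).1, by fun_prop⟩, ?_, ?_⟩, fun t ht => ?_⟩
  · simp [hends 0 (Or.inl γ.source)]
  · simp [hends 1 (Or.inr γ.target)]
  · change extAction G₀ G (γ t + τ • (g t).1) < c
    change γ t + τ • (g t).1 ∈ constraintSet G₀ m at ht
    by_cases htΩ : t ∈ Ω
    · obtain ⟨h3, h4⟩ := hkey t htΩ
      obtain ⟨k1, k2, k3, k4, k5⟩ := hreg t htΩ
      obtain ⟨⟨g1, g2, g3, g4⟩, g5, -⟩ := hg t
      have g0 : 0 ≤ (g t).2 := (norm_nonneg _).trans g1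
      rw [extAction_of_noCollision h3, EReal.coe_lt_coe_iff]
      -- On `T` the action drops by at least `τε/2 ≥ 2e`, from below `c + e` to below `c`. Off `T`,
      -- the moved point being in the constraint set, the action was already below `c - e/2` and
      -- does not increase.
      by_cases htT : t ∈ T
      · rw [g5 htT] at h4
        nlinarith
      · have h5 : γ t ∈ constraintSet G₀ (m + 1) := by
          obtain ⟨s, hs⟩ := ht
          refine ⟨s, ?_⟩
          rw [radius_add, D12.eval_smul] at hs
          have h6 := (abs_le.1 (g2 s)).1
          have h7 := k1 s
          by_contra hlt
          push Not at hlt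
          have h8 : 2 * (g t).2 * radius G₀ (γ t) s ≤ 2 * radius G₀ (γ t) s := by nlinarith
          have h9 : -(2 * τ * radius G₀ (γ t) s) ≤ τ * (g t).1.eval s := by nlinarith
          nlinarith
        have h6 : ¬ ((c - e / 2 : ℝ) : EReal) ≤ extAction G₀ G (γ t) := fun h => htT ⟨h, h5⟩
        rw [extAction_of_noCollision k1, EReal.coe_le_coe_iff, not_le] at h6
        have : 0 ≤ τ * ε / 2 * (g t).2 := by positivity
        linarith
    · have h3 : g t = 0 := (hg t).2.2 htΩ
      have h4 : γ t + τ • (g t).1 = γ t := by rw [h3]; simp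
      rw [h4] at ht ⊢
      have h5 : ¬ ((c - e : ℝ) : EReal) < extAction G₀ G (γ t) := by
        obtain ⟨s, hs⟩ := ht
        exact fun h => htΩ ⟨h, s, by linarith⟩
      refine (not_lt.1 h5).trans_lt ?_
      rw [EReal.coe_lt_coe_iff]; linarith

/-! ### The unconstrained mountain-pass level -/

/-- The level `inf_γ max 𝒜_G(γ)`. -/
def passLevel (G₀ G : ℝ) (ψ₁ ψ₂ : D12) : EReal :=
  ⨅ γ : Path ψ₁ ψ₂, ⨆ t, extAction G₀ G (γ t)

theorem extAction_anti {G₀ : ℝ} (hG₀ : 0 < G₀) {G G' : ℝ} (h : G' ^ 2 ≤ G ^ 2) (φ : D12) :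
    extAction G₀ G φ ≤ extAction G₀ G' φ := by
  by_cases hφ : NoCollision G₀ φ
  · rw [extAction_of_noCollision hφ, extAction_of_noCollision hφ, EReal.coe_le_coe_iff]
    exact action_anti hG₀ h hφ
  · rw [extAction_of_not hφ]; exact bot_le

theorem passLevel_anti {G₀ : ℝ} (hG₀ : 0 < G₀) {G G' : ℝ} (h : G' ^ 2 ≤ G ^ 2) (ψ₁ ψ₂ : D12) :
    passLevel G₀ G ψ₁ ψ₂ ≤ passLevel G₀ G' ψ₁ ψ₂ :=
  iInf_mono fun _ => iSup_mono fun _ => extAction_anti hG₀ h _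

theorem passLevel_lt_top {G₀ : ℝ} (hG₀ : 0 < G₀) {G : ℝ} (hG : G ≠ 0) (ψ₁ ψ₂ : D12) :
    passLevel G₀ G ψ₁ ψ₂ < ⊤ := by
  have γ := PathConnectedSpace.somePath ψ₁ ψ₂
  obtain ⟨B, hB⟩ := exists_norm_path_le γ
  obtain ⟨C, hC⟩ := exists_action_le hG₀ hG B
  refine lt_of_le_of_lt ((iInf_le _ γ).trans (iSup_le fun t => ?_)) (EReal.coe_lt_top C)
  by_cases hn : NoCollision G₀ (γ t)
  · rw [extAction_of_noCollision hn, EReal.coe_le_coe_iff]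
    exact hC _ hn (hB t)
  · rw [extAction_of_not hn]; exact bot_le

theorem extAction_le_passLevel (G₀ G : ℝ) (ψ₁ ψ₂ : D12) :
    extAction G₀ G ψ₁ ≤ passLevel G₀ G ψ₁ ψ₂ :=
  le_iInf fun γ => by
    have := le_iSup (fun t => extAction G₀ G (γ t)) 0
    simpa using this

theorem coe_toReal_passLevel {G₀ : ℝ} (hG₀ : 0 < G₀) {G : ℝ} (hG : G ≠ 0) {ψ₁ : D12} (ψ₂ : D12)
    (h : NoCollision G₀ ψ₁) :
    ((passLevel G₀ G ψ₁ ψ₂).toReal : EReal) = passLevel G₀ G ψ₁ ψ₂ := by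
  refine EReal.coe_toReal (passLevel_lt_top hG₀ hG ψ₁ ψ₂).ne ?_
  have h1 := extAction_le_passLevel G₀ G ψ₁ ψ₂
  rw [extAction_of_noCollision h] at h1
  exact ((EReal.bot_lt_coe _).trans_le h1).ne'

theorem passLevel_lt_of_path {G₀ : ℝ} (hG₀ : 0 < G₀) {G : ℝ} (hG : G ≠ 0) {ψ₁ ψ₂ : D12}
    (γ : Path ψ₁ ψ₂) {b : EReal} (h : ∀ t, extAction G₀ G (γ t) < b) :
    passLevel G₀ G ψ₁ ψ₂ < b := by
  have husc : UpperSemicontinuous fun t => extAction G₀ G (γ t) :=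
    (upperSemicontinuous_extAction hG₀ hG).comp γ.continuous
  obtain ⟨t, -, ht⟩ := husc.upperSemicontinuousOn univ |>.exists_isMaxOn ⟨0, mem_univ _⟩
    isCompact_univ
  exact ((iInf_le _ γ).trans (iSup_le fun u => ht (mem_univ u))).trans_lt (h t)

/-- A path that is low on the constraint set can be made low everywhere by adding constants outside
it (`exists_path_lt`), so the constraint does not lower the level. -/
theorem mountainPassLevel_eq {G₀ : ℝ} (hG₀ : 0 < G₀) {G : ℝ} (hG : G ≠ 0) {m : ℝ}
    (hm : 1 + 4 * G ^ 2 ≤ m) {ψ₁ ψ₂ : D12} (h₁ : extAction G₀ G ψ₁ < passLevel G₀ G ψ₁ ψ₂)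
    (h₂ : extAction G₀ G ψ₂ < passLevel G₀ G ψ₁ ψ₂) :
    mountainPassLevel G₀ G m ψ₁ ψ₂ = passLevel G₀ G ψ₁ ψ₂ := by
  refine le_antisymm (iInf_mono fun γ => iSup_le fun t => le_iSup (fun t => extAction G₀ G (γ t)) _)
    (le_of_not_gt fun hlt => ?_)
  obtain ⟨γ, hγ⟩ := iInf_lt_iff.1 hlt
  obtain ⟨b, hb1, hb2⟩ := EReal.lt_iff_exists_real_btwn.1 (max_lt hγ (max_lt h₁ h₂))
  rw [max_lt_iff, max_lt_iff] at hb1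
  obtain ⟨γ', hγ'⟩ := exists_path_lt hG₀ hG hm γ hb1.2.1 hb1.2.2 fun t ht =>
    (le_iSup (fun t : {t : unitInterval // γ t ∈ constraintSet G₀ m} => extAction G₀ G (γ t))
      ⟨t, ht⟩).trans_lt hb1.1
  exact (hb2.trans (passLevel_lt_of_path hG₀ hG γ' hγ')).false

/-- The end points may be changed along paths of low action. -/
theorem passLevel_le_of_paths {G₀ G : ℝ} {ψ₁ ψ₂ χ₁ χ₂ : D12} (α : Path χ₁ ψ₁) (β : Path ψ₂ χ₂)
    {a : EReal} (hα : ∀ t, extAction G₀ G (α t) ≤ a) (hβ : ∀ t, extAction G₀ G (β t) ≤ a) :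
    passLevel G₀ G χ₁ χ₂ ≤ max a (passLevel G₀ G ψ₁ ψ₂) := by
  rw [passLevel, passLevel, sup_iInf_eq]
  refine le_iInf fun γ => (iInf_le _ ((α.trans γ).trans β)).trans (iSup_le fun t => ?_)
  have ht : ((α.trans γ).trans β) t ∈ range ((α.trans γ).trans β) := mem_range_self t
  rw [Path.trans_range, Path.trans_range] at ht
  rcases ht with (⟨u, hu⟩ | ⟨u, hu⟩) | ⟨u, hu⟩
  · rw [← hu]; exact (hα u).trans le_sup_left
  · rw [← hu]
    exact (le_iSup (fun t => extAction G₀ G (γ t)) u).trans le_sup_right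
  · rw [← hu]; exact (hβ u).trans le_sup_left

/-! ### Monotonicity in the angular momentum -/

/-- If the level is differentiable as a function of the angular momentum, then it is critical. -/
theorem exists_criticalPoint_of_differentiableAt {G₀ : ℝ} (hG₀ : 0 < G₀) {g : ℝ} (hg : 0 < g)
    {ψ₁ ψ₂ : D12} (hn : NoCollision G₀ ψ₁)
    (hd : DifferentiableAt ℝ (fun x => (passLevel G₀ x ψ₁ ψ₂).toReal) g)
    (h₁ : extAction G₀ g ψ₁ < passLevel G₀ g ψ₁ ψ₂)
    (h₂ : extAction G₀ g ψ₂ < passLevel G₀ g ψ₁ ψ₂) :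
    ∃ φ, IsCriticalPoint G₀ g φ ∧ (action G₀ g φ : EReal) = passLevel G₀ g ψ₁ ψ₂ := by
  by_contra hcon
  set c := (passLevel G₀ g ψ₁ ψ₂).toReal
  have hc : (c : EReal) = passLevel G₀ g ψ₁ ψ₂ := coe_toReal_passLevel hG₀ hg.ne' ψ₂ hn
  rw [← hc] at hcon h₁ h₂
  simp only [EReal.coe_eq_coe_iff] at hcon
  obtain ⟨b, hb1, hb2⟩ := EReal.lt_iff_exists_real_btwn.1 (max_lt h₁ h₂)
  rw [max_lt_iff] at hb1
  rw [EReal.coe_lt_coe_iff] at hb2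
  -- Of differentiability only the bound `L` on difference quotients at `g` is used.
  obtain ⟨L, hL, hO⟩ := hd.isBigO_sub.exists_pos
  obtain ⟨η, hη, hball⟩ := Metric.eventually_nhds_iff.1 hO.bound
  obtain ⟨ε, hε, hdef⟩ := exists_deformation hG₀ hg.ne' (4 * (L + 1) / g)
    (by positivity : 0 < 1 + 4 * g ^ 2) hcon
  obtain ⟨h, hh, hhη, hhg, hhe, hhb⟩ : ∃ h > 0, h < η ∧ h < g ∧ (L + 1) * h ≤ ε ∧
      (L + 1) * h ≤ c - b := by
    have hcb : 0 < c - b := sub_pos.2 hb2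
    refine ⟨min (min (η / 2) (g / 2)) (min ε (c - b) / (L + 1)), by positivity, ?_, ?_, ?_, ?_⟩
    · exact ((min_le_left _ _).trans (min_le_left _ _)).trans_lt (by linarith)
    · exact ((min_le_left _ _).trans (min_le_right _ _)).trans_lt (by linarith)
    all_goals
      have h5 : min (min (η / 2) (g / 2)) (min ε (c - b) / (L + 1)) ≤ min ε (c - b) / (L + 1) :=
        min_le_right _ _
      rw [le_div_iff₀ (by positivity), mul_comm] at h5
    · exact h5.trans (min_le_left _ _)
    · exact h5.trans (min_le_right _ _)
  set e := (L + 1) * h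
  have he : 0 < e := by positivity
  -- A path nearly optimal for the smaller momentum `x` has action below `c + e` there, and a
  -- fortiori for `g`.
  set x := g - h
  have hx : 0 < x := sub_pos.2 hhg
  have hfx : (passLevel G₀ x ψ₁ ψ₂).toReal < c + e - h / 2 := by
    have h3 := hball (y := x) (by
      rw [Real.dist_eq]; simp only [x]
      rw [show g - h - g = -h by ring, abs_neg, abs_of_pos hh]; exact hhη)
    rw [Real.norm_eq_abs, Real.norm_eq_abs, show x - g = -h by simp only [x]; ring, abs_neg,
      abs_of_pos hh] at h3
    have h4 := (abs_le.1 h3).2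
    simp only [e]
    linarith
  have hlt : passLevel G₀ x ψ₁ ψ₂ < ((c + e : ℝ) : EReal) := by
    rw [← coe_toReal_passLevel hG₀ hx.ne' ψ₂ hn, EReal.coe_lt_coe_iff]
    linarith
  obtain ⟨γ, hγ⟩ := iInf_lt_iff.1 hlt
  have hγ' : ∀ t, extAction G₀ x (γ t) < ((c + e : ℝ) : EReal) := fun t =>
    (le_iSup (fun t => extAction G₀ x (γ t)) t).trans_lt hγ
  have hxg : x ^ 2 ≤ g ^ 2 := by
    have : x ≤ g := by simp only [x]; linarith
    gcongr
  have hlow : (b : EReal) ≤ ((c - e : ℝ) : EReal) := by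
    rw [EReal.coe_le_coe_iff]; linarith
  -- Where the action for `g` exceeds `c - e` while that for `x` is below `c + e`, the difference
  -- `(g² - x²)/2 · invSq` is below `2e = 2(L + 1)h`. Since `g² - x² ≥ hg`, this bounds `invSq` by
  -- `4(L + 1)/g`, independently of `h`.
  obtain ⟨γ₁, hγ₁⟩ := hdef e he hhe γ (hb1.1.trans_le hlow) (hb1.2.trans_le hlow)
    (fun t => (extAction_anti hG₀ hxg _).trans_lt (hγ' t)) fun t ht => by
      have hnt := noCollision_of_lt_extAction ht
      have h3 := hγ' t
      rw [extAction_of_noCollision hnt, EReal.coe_lt_coe_iff] at ht h3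
      rw [action_eq_add_invSq hG₀ x g hnt] at h3
      rw [le_div_iff₀ hg]
      have h4 : (g ^ 2 - x ^ 2) / 2 = h * (2 * g - h) / 2 := by simp only [x]; ring
      rw [h4] at h3
      have h5 := invSq_nonneg G₀ (γ t)
      have h6 : h * (invSq G₀ (γ t) * g) ≤ h * (4 * (L + 1)) := by
        have h7 : h * g * invSq G₀ (γ t) ≤ h * (2 * g - h) * invSq G₀ (γ t) := by
          gcongr; linarith
        simp only [e] at ht h3
        nlinarith
      exact le_of_mul_le_mul_left h6 hh
  obtain ⟨γ₂, hγ₂⟩ := exists_path_lt hG₀ hg.ne' le_rfl γ₁ h₁ h₂ hγ₁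
  exact absurd hc (passLevel_lt_of_path hG₀ hg.ne' γ₂ hγ₂).ne'

/-- The level is antitone in the momentum on `(0, ∞)`, and Lebesgue's theorem applies; negative
momenta follow by reflection. -/
theorem ae_differentiableAt_passLevel {G₀ : ℝ} (hG₀ : 0 < G₀) {ψ₁ : D12} (ψ₂ : D12)
    (hn : NoCollision G₀ ψ₁) :
    ∀ᵐ G : ℝ, G ≠ 0 → DifferentiableAt ℝ (fun x => (passLevel G₀ x ψ₁ ψ₂).toReal) |G| := by
  have hmono : MonotoneOn (fun x => -(passLevel G₀ x ψ₁ ψ₂).toReal) (Ioi 0) := by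
    intro x hx y hy hxy
    have hx' : 0 < x := hx
    have hy' : 0 < y := hy
    rw [neg_le_neg_iff, ← EReal.coe_le_coe_iff, coe_toReal_passLevel hG₀ hx'.ne' ψ₂ hn,
      coe_toReal_passLevel hG₀ hy'.ne' ψ₂ hn]
    exact passLevel_anti hG₀ (by gcongr) ψ₁ ψ₂
  have h1 := (ae_restrict_iff' measurableSet_Ioi).1 (hmono.ae_differentiableWithinAt
    measurableSet_Ioi)
  have h2 : ∀ᵐ x : ℝ, x ∈ Ioi (0 : ℝ) →
      DifferentiableAt ℝ (fun x => (passLevel G₀ x ψ₁ ψ₂).toReal) x := by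
    filter_upwards [h1] with x hx hx0
    have := ((hx hx0).differentiableAt (Ioi_mem_nhds hx0)).neg
    simpa using this
  have h3 := (Measure.measurePreserving_neg (volume : Measure ℝ)).quasiMeasurePreserving.ae h2
  filter_upwards [h2, h3] with G hG hG' h0
  rcases lt_or_gt_of_ne h0 with h | h
  · rw [abs_of_neg h]; exact hG' (neg_pos.2 h)
  · rw [abs_of_pos h]; exact hG h

theorem action_abs (G₀ G : ℝ) : action G₀ |G| = action G₀ G := by
  funext φ
  simp only [action, renLagrangian, effPotential, sq_abs]

theorem extAction_abs (G₀ G : ℝ) : extAction G₀ |G| = extAction G₀ G := by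
  funext φ
  simp only [extAction, action_abs]

theorem passLevel_abs (G₀ G : ℝ) : passLevel G₀ |G| = passLevel G₀ G := by
  funext ψ₁ ψ₂
  simp only [passLevel, extAction_abs]

theorem exists_countable_dense_D12 : ∃ S : Set D12, S.Countable ∧ Dense S := by
  have h2 : Fact ((2 : ENNReal) ≠ ⊤) := ⟨by norm_num⟩
  have : SecondCountableTopology (Lp ℝ 2 (volume : Measure ℝ)) := inferInstance
  have : SecondCountableTopology D12 := inferInstance
  exact TopologicalSpace.exists_countable_dense D12

/-- Points of low action can be joined to a dense set by paths of low action. -/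
theorem exists_path_to_dense {G₀ : ℝ} (hG₀ : 0 < G₀) {G : ℝ} (hG : G ≠ 0) {S : Set D12}
    (hS : Dense S) {ψ : D12} (hψ : NoCollision G₀ ψ) {a : EReal} (ha : extAction G₀ G ψ < a) :
    ∃ χ ∈ S, NoCollision G₀ χ ∧ ∃ α : Path ψ χ, ∀ t, extAction G₀ G (α t) ≤ a := by
  obtain ⟨η, hη, hball⟩ := Metric.eventually_nhds_iff_ball.1
    ((upperSemicontinuous_extAction hG₀ hG ψ a ha).and ((isOpen_noCollision hG₀).mem_nhds hψ))
  obtain ⟨χ, hχS, hχ⟩ := hS.exists_dist_lt ψ hη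
  have hχ' : χ ∈ Metric.ball ψ η := by rwa [Metric.mem_ball, dist_comm]
  refine ⟨χ, hχS, (hball χ hχ').2, ?_⟩
  have hj := ((convex_ball ψ η).isPathConnected ⟨ψ, Metric.mem_ball_self hη⟩).joinedIn ψ
    (Metric.mem_ball_self hη) χ hχ'
  obtain ⟨α, hα⟩ := hj
  exact ⟨α, fun t => (hball _ (hα t)).1.le⟩

/-- For almost every angular momentum, mountain-pass levels are critical. -/
theorem exists_criticalPoint_mountainPassLevel {G₀ : ℝ} (hG₀ : 0 < G₀) :
    ∃ J ⊆ Icc (-G₀) G₀, volume (Icc (-G₀) G₀ \ J) = 0 ∧ ∀ G ∈ J, G ≠ 0 ∧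
      ∀ M > 0, ∀ ψ₁ ψ₂ : D12, IsMountainPassPair G₀ G M ψ₁ ψ₂ → ∀ m ≥ 1 + 4 * G₀ ^ 2,
        ∃ φ : D12, IsCriticalPoint G₀ G φ ∧
          (action G₀ G φ : EReal) = mountainPassLevel G₀ G m ψ₁ ψ₂ := by
  obtain ⟨S, hSc, hS⟩ := exists_countable_dense_D12
  -- The exceptional null set depends on the end points, so differentiability is required only for
  -- those in a countable dense set.
  set P : ℝ → Prop := fun G => G ≠ 0 ∧ ∀ χ₁ ∈ S, ∀ χ₂ ∈ S, NoCollision G₀ χ₁ →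
    DifferentiableAt ℝ (fun x => (passLevel G₀ x χ₁ χ₂).toReal) |G|
  have hae : ∀ᵐ G : ℝ, P G := by
    have h0 : ∀ᵐ G : ℝ, G ≠ 0 := by
      rw [ae_iff]; simp
    have h1 : ∀ᵐ G : ℝ, ∀ χ₁ ∈ S, ∀ χ₂ ∈ S, NoCollision G₀ χ₁ → G ≠ 0 →
        DifferentiableAt ℝ (fun x => (passLevel G₀ x χ₁ χ₂).toReal) |G| := by
      rw [ae_ball_iff hSc]
      intro χ₁ _
      rw [ae_ball_iff hSc]
      intro χ₂ _
      by_cases hn : NoCollision G₀ χ₁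
      · filter_upwards [ae_differentiableAt_passLevel hG₀ χ₂ hn] with G hG _ using hG
      · exact Eventually.of_forall fun G h => absurd h hn
    filter_upwards [h0, h1] with G hG0 hG1
    exact ⟨hG0, fun χ₁ h1 χ₂ h2 hn => hG1 χ₁ h1 χ₂ h2 hn hG0⟩
  refine ⟨Icc (-G₀) G₀ ∩ {G | P G}, inter_subset_left, ?_, ?_⟩
  · refine measure_mono_null ?_ (ae_iff.1 hae)
    rintro G ⟨h1, h2⟩ h3
    exact h2 ⟨h1, h3⟩
  rintro G ⟨hGI, hG, hdiff⟩
  refine ⟨hG, fun M hM ψ₁ ψ₂ hψ m hm => ?_⟩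
  have hG2 : 1 + 4 * G ^ 2 ≤ m := by
    have : G ^ 2 ≤ G₀ ^ 2 := sq_le_sq' hGI.1 hGI.2
    linarith
  -- A value strictly between the end point bound `-M` and the pass bound `-M/2`. End points joined
  -- by paths below `a` have the same level, which permits replacing the given pair by one in `S`.
  set a : EReal := ((-(3 / 4) * M : ℝ) : EReal)
  have haM : a < ((-M / 2 : ℝ) : EReal) := by
    rw [EReal.coe_lt_coe_iff]; linarith
  have hlow : ∀ {ψ}, NoCollision G₀ ψ → action G₀ G ψ ≤ -M → extAction G₀ G ψ < a := by
    intro ψ h1 h2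
    rw [extAction_of_noCollision h1, EReal.coe_lt_coe_iff]; linarith
  have hψ1 := hlow hψ.noCollision₁ hψ.low₁
  have hψ2 := hlow hψ.noCollision₂ hψ.low₂
  have hlev : ((-M / 2 : ℝ) : EReal) ≤ passLevel G₀ G ψ₁ ψ₂ := le_iInf fun γ => by
    obtain ⟨t, ht⟩ := hψ.pass γ
    exact ht.trans (le_iSup (fun t => extAction G₀ G (γ t)) t)
  obtain ⟨χ₁, hχ₁S, hχ₁, α, hα⟩ := exists_path_to_dense hG₀ hG hS hψ.noCollision₁ hψ1
  obtain ⟨χ₂, hχ₂S, hχ₂, β, hβ⟩ := exists_path_to_dense hG₀ hG hS hψ.noCollision₂ hψ2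
  have hle1 : passLevel G₀ G ψ₁ ψ₂ ≤ passLevel G₀ G χ₁ χ₂ := by
    have := passLevel_le_of_paths α β.symm hα (fun t => hβ _)
    rcases le_max_iff.1 this with h | h
    · exact absurd (haM.trans_le (hlev.trans h)) (lt_irrefl _)
    · exact h
  have hle2 : passLevel G₀ G χ₁ χ₂ ≤ passLevel G₀ G ψ₁ ψ₂ := by
    have := passLevel_le_of_paths α.symm β (fun t => hα _) hβ
    rcases le_max_iff.1 this with h | h
    · exact h.trans (haM.le.trans hlev)
    · exact h
  have heq := le_antisymm hle1 hle2
  rw [mountainPassLevel_eq hG₀ hG hG2 ((hψ1.trans haM).trans_le hlev)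
    ((hψ2.trans haM).trans_le hlev), heq]
  have hb : a < passLevel G₀ |G| χ₁ χ₂ := by
    rw [passLevel_abs, ← heq]; exact haM.trans_le hlev
  obtain ⟨φ, ⟨hφ1, hφ2⟩, hφ3⟩ := exists_criticalPoint_of_differentiableAt hG₀ (abs_pos.2 hG) hχ₁
    (hdiff χ₁ hχ₁S χ₂ hχ₂S hχ₁)
    (lt_of_le_of_lt (by rw [extAction_abs]; simpa using hα 1) hb)
    (lt_of_le_of_lt (by rw [extAction_abs]; simpa using hβ 1) hb)
  rw [action_abs] at hφ2 hφ3
  rw [passLevel_abs] at hφ3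
  exact ⟨φ, ⟨hφ1, hφ2⟩, hφ3⟩

/-! ### The mountain-pass geometry -/

theorem r0_zero {G₀ : ℝ} (hG₀ : 0 < G₀) : r0 G₀ 0 = G₀ ^ 2 / 2 := by
  have h := r0_parabolicTime hG₀ 0
  have e : parabolicTime G₀ 0 = 0 := by unfold parabolicTime; ring
  rw [e] at h
  rw [h]; ring

theorem radius_const (G₀ c s : ℝ) : radius G₀ (D12.const c) s = r0 G₀ s + c := by
  rw [radius, D12.eval_const]

/-- Low points close to collision. -/
theorem exists_low_near_collision {G₀ : ℝ} (hG₀ : 0 < G₀) {G : ℝ} (hG : G ≠ 0) {m : ℝ}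
    (hm : 0 < m) (b : ℝ) :
    ∃ ψ, NoCollision G₀ ψ ∧ action G₀ G ψ ≤ b ∧ ∃ s, radius G₀ ψ s < m := by
  -- The constant is minus the pericentre distance, so the radius vanishes at time `0`; slightly
  -- larger constants give low collision-free functions.
  have hcol : ¬ NoCollision G₀ (D12.const (-(G₀ ^ 2 / 2))) := fun h => by
    have := h 0
    rw [radius_const, r0_zero hG₀] at this
    linarith
  have h1 : Tendsto (fun c : ℝ => D12.const c) (𝓝[>] (-(G₀ ^ 2 / 2)))
      (𝓝 (D12.const (-(G₀ ^ 2 / 2)))) :=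
    ((continuous_const_comp continuous_id).tendsto _).mono_left nhdsWithin_le_nhds
  have h2 := h1.eventually (eventually_extAction_lt_of_collision hG₀ hG hcol b)
  have h3 : ∀ᶠ c in 𝓝[>] (-(G₀ ^ 2 / 2)), c < -(G₀ ^ 2 / 2) + m :=
    nhdsWithin_le_nhds (Iio_mem_nhds (by linarith))
  obtain ⟨c, hc1, hc2, hc3⟩ := (h2.and (h3.and self_mem_nhdsWithin)).exists
  have hc3 : -(G₀ ^ 2 / 2) < c := hc3
  have hn : NoCollision G₀ (D12.const c) := fun s => by
    rw [radius_const]; linarith [half_sq_le_r0 G₀ s]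
  refine ⟨D12.const c, hn, ?_, 0, ?_⟩
  · rw [extAction_of_noCollision hn, EReal.coe_lt_coe_iff] at hc1
    exact hc1.le
  · rw [radius_const, r0_zero hG₀]; linarith

/-- Low points far from the origin. -/
theorem exists_low_far {G₀ : ℝ} (hG₀ : 0 < G₀) (G m b : ℝ) :
    ∃ ψ, NoCollision G₀ ψ ∧ action G₀ G ψ ≤ b ∧ ∀ s, m < radius G₀ ψ s := by
  set χ := D12.const (1 + 4 * G ^ 2)
  have hχ : ∀ s, 1 + 4 * G ^ 2 ≤ radius G₀ χ s := fun s => by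
    rw [radius_const]; linarith [r0_pos hG₀ s]
  obtain ⟨c, hc, h⟩ := exists_action_add_const_le hG₀ G ‖χ‖ (action G₀ G χ) b
  have hcm : 0 ≤ max c m := hc.trans (le_max_left _ _)
  have hr : ∀ s, m < radius G₀ (χ + D12.const (max c m)) s := fun s => by
    rw [radius_add_const]
    have := hχ s
    have := le_max_right c m
    nlinarith [sq_nonneg G]
  refine ⟨χ + D12.const (max c m), noCollision_add_const (fun s => ?_) hcm,
    h χ hχ le_rfl le_rfl _ (le_max_left _ _), hr⟩
  exact lt_of_lt_of_le (by positivity) (hχ s)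

/-- Connectedness of the parameter interval: `min r < m` and `min r > m` are open conditions, each
met at one end, and cannot cover the path. -/
theorem exists_mem_path_radius_eq {G₀ : ℝ} (hG₀ : 0 < G₀) {m : ℝ} {ψ₁ ψ₂ : D12} (γ : Path ψ₁ ψ₂)
    (h₁ : ∃ s, radius G₀ ψ₁ s < m) (h₂ : ∀ s, m < radius G₀ ψ₂ s) :
    ∃ t, (∀ s, m ≤ radius G₀ (γ t) s) ∧ ∃ s, radius G₀ (γ t) s ≤ m := by
  by_contra hcon
  push Not at hcon
  have hU : IsOpen {t | ∃ s, radius G₀ (γ t) s < m} :=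
    (isOpen_exists_radius_lt G₀ m).preimage γ.continuous
  have hV : IsOpen {t | ∀ s, m < radius G₀ (γ t) s} := by
    have h := (isClosed_constraintSet hG₀ m).isOpen_compl.preimage γ.continuous
    convert h using 1
    ext t
    simp [constraintSet]
  have hcov : (univ : Set unitInterval) ⊆
      {t | ∃ s, radius G₀ (γ t) s < m} ∪ {t | ∀ s, m < radius G₀ (γ t) s} := by
    intro t _
    by_cases ht : ∀ s, m ≤ radius G₀ (γ t) s
    · exact Or.inr (hcon t ht)
    · push Not at ht
      exact Or.inl ht
  obtain ⟨t, -, ⟨s, hs⟩, ht⟩ := isPreconnected_univ _ _ hU hV hcov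
    ⟨0, mem_univ _, by simpa using h₁⟩ ⟨1, mem_univ _, by simpa using h₂⟩
  exact absurd (ht s) hs.not_gt

/-- Every path from near collision to far away crosses the barrier. The barrier is computed for `G₀`
and serves all `|G| ≤ G₀`, the action being larger for smaller momenta; once `M ≥ 2|C|` it lies
above `-M/2`. -/
theorem exists_isMountainPassPair {G₀ : ℝ} (hG₀ : 0 < G₀) :
    ∃ Mstar > 0, ∀ G : ℝ, G ≠ 0 → G ^ 2 ≤ G₀ ^ 2 → ∀ M ≥ Mstar,
      ∃ ψ₁ ψ₂ : D12, IsMountainPassPair G₀ G M ψ₁ ψ₂ := by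
  obtain ⟨m, hm, C, hC⟩ := exists_barrier hG₀
  refine ⟨2 * |C| + 1, by positivity, fun G hG hGG M hM => ?_⟩
  obtain ⟨ψ₁, h1, h2, h3⟩ := exists_low_near_collision hG₀ hG hm (-M)
  obtain ⟨ψ₂, g1, g2, g3⟩ := exists_low_far hG₀ G m (-M)
  refine ⟨ψ₁, ψ₂, h1, g1, h2, g2, fun γ => ?_⟩
  obtain ⟨t, ht1, ht2⟩ := exists_mem_path_radius_eq hG₀ γ h3 g3
  refine ⟨t, ?_⟩
  have hn : NoCollision G₀ (γ t) := fun s => hm.trans_le (ht1 s)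
  rw [extAction_of_noCollision hn, EReal.coe_le_coe_iff]
  obtain ⟨a, d, e1, e2, e3⟩ := exists_normalize hG₀ ht2
  have h4 := hC _ (fun s => by rw [e2]; exact ht1 _) e1
  rw [(e3 G₀ _ hn).1] at h4
  have h5 := action_anti hG₀ hGG hn
  have h6 := neg_abs_le C
  linarith

/-! ### The Euler-Lagrange equation -/

theorem r0_cube_le {G₀ : ℝ} (hG₀ : 0 < G₀) (s : ℝ) : r0 G₀ s ^ 3 ≤ 18 * s ^ 2 + G₀ ^ 6 / 2 := by
  conv_rhs => rw [← parabolicTime_param hG₀ s]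
  rw [r0_eq, parabolicTime]
  set τ := parabolicParam G₀ s
  have h6 : 0 < G₀ ^ 6 := by positivity
  have h1 : (τ ^ 2 + 1) ^ 3 / 8 ≤ 18 * ((τ + τ ^ 3 / 3) / 2) ^ 2 + 1 / 2 := by
    have h2 : 0 ≤ τ ^ 2 := sq_nonneg τ
    nlinarith [mul_nonneg (add_nonneg h2 zero_le_one) (sq_nonneg (τ ^ 2 - 1)), mul_nonneg h2 h2]
  calc (G₀ ^ 2 * (τ ^ 2 + 1) / 2) ^ 3 = G₀ ^ 6 * ((τ ^ 2 + 1) ^ 3 / 8) := by ring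
    _ ≤ G₀ ^ 6 * (18 * ((τ + τ ^ 3 / 3) / 2) ^ 2 + 1 / 2) := by gcongr
    _ = _ := by ring

theorem D12.inner_weakDeriv (φ : D12) (c : ℝ) {w : ℝ → ℝ}
    (hw : MemLp w 2 (volume : Measure ℝ)) :
    inner ℝ φ.weakDeriv (D12.ofDeriv c hw).weakDeriv = ∫ s, φ.weakDeriv s * w s := by
  rw [L2.inner_def]
  refine integral_congr_ae ?_
  filter_upwards [D12.coeFn_weakDeriv_ofDeriv c hw] with s hs
  rw [hs]
  exact mul_comm _ _

/-- Weak solutions of `φ'' = F` are classical solutions. -/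
theorem exists_hasDerivAt_eval {φ : D12} {F : ℝ → ℝ} (hF : Continuous F)
    (h : ∀ χ : D12, inner ℝ φ.weakDeriv χ.weakDeriv + ∫ s, F s * χ.eval s = 0) :
    ∃ c, ∀ s, HasDerivAt φ.eval (c + ∫ t in (0 : ℝ)..s, F t) s := by
  set W : ℝ → ℝ := fun s => ∫ t in (0 : ℝ)..s, F t
  have hW : ∀ s, HasDerivAt W (F s) s := fun s =>
    intervalIntegral.integral_hasDerivAt_right (hF.intervalIntegrable _ _)
      (hF.stronglyMeasurableAtFilter _ _) hF.continuousAt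
  have hWc : Continuous W := continuous_iff_continuousAt.2 fun s => (hW s).continuousAt
  have hWp : IsPrimitive W F := isPrimitive_of_hasDerivAt hW hF
  have hloc : ∀ R : ℝ, 0 < R → ∃ c, ∀ s ∈ Icc (-R) R,
      φ.eval s = φ.eval 0 + ∫ t in (0 : ℝ)..s, (c + W t) := by
    intro R hR
    set μ : Measure ℝ := volume.restrict (Ioc (-R) R)
    have hμ : IsFiniteMeasure μ := ⟨by
      simp only [μ, Measure.restrict_apply_univ]; exact measure_Ioc_lt_top⟩
    have hWμ : MemLp W 2 μ := by
      obtain ⟨B, hB⟩ := isCompact_Icc.exists_bound_of_continuousOn (s := Icc (-R) R)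
        hWc.continuousOn
      refine MemLp.of_bound hWc.aestronglyMeasurable B ?_
      exact (ae_restrict_mem measurableSet_Ioc).mono fun s hs => hB s (Ioc_subset_Icc_self hs)
    have hφμ : MemLp (φ.weakDeriv : ℝ → ℝ) 2 μ := φ.memLp.restrict _
    have hf : MemLp (fun s => φ.weakDeriv s - W s) 2 μ := hφμ.sub hWμ
    have hfi : Integrable (fun s => φ.weakDeriv s - W s) μ := hf.integrable (by norm_num)
    -- Du Bois-Reymond: `c` is the mean of `φ' - W` on `(-R, R]`, so the primitive of `φ' - W - c`
    -- vanishes at both ends and, extended by zero, is a test function. Testing with it gives `∫ (φ'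
    -- - W - c)² = 0`.
    set c := (2 * R)⁻¹ * ∫ s, (φ.weakDeriv s - W s) ∂μ
    have hfc : MemLp (fun s => φ.weakDeriv s - W s - c) 2 μ := hf.sub (memLp_const c)
    have hfc0 : ∫ s, (φ.weakDeriv s - W s - c) ∂μ = 0 := by
      rw [integral_sub hfi (integrable_const c), integral_const]
      simp only [μ, measureReal_restrict_apply_univ, Real.volume_real_Ioc, smul_eq_mul, c]
      rw [max_eq_left (by linarith)]
      field_simp
      ring
    set w : ℝ → ℝ := (Ioc (-R) R).indicator fun s => φ.weakDeriv s - W s - c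
    have hw : MemLp w 2 volume := (memLp_indicator_iff_restrict measurableSet_Ioc).2 hfc
    have hwint : ∫ s in (-R)..R, w s = 0 := by
      rw [intervalIntegral.integral_of_le (by linarith), ← hfc0]
      refine integral_congr_ae ?_
      filter_upwards [ae_restrict_mem measurableSet_Ioc] with s hs
      exact indicator_of_mem hs _
    have hwI : ∀ a b, IntervalIntegrable w volume a b := D12.intervalIntegrable hw
    set χ : D12 := D12.ofDeriv (∫ s in (-R)..0, w s) hw
    have hχ : ∀ s, χ.eval s = ∫ t in (-R)..s, w t := fun s => by
      rw [D12.eval_ofDeriv, intervalIntegral.integral_add_adjacent_intervals (hwI _ _) (hwI _ _)]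
    have hχp : IsPrimitive χ.eval w := ⟨hwI, fun s => by rw [D12.eval_ofDeriv, hχ]⟩
    have hout : ∀ s, s ∉ Ioc (-R) R → χ.eval s = 0 := by
      intro s hs
      rw [hχ]
      by_cases h1 : s ≤ -R
      · rw [intervalIntegral.integral_symm, neg_eq_zero, intervalIntegral.integral_of_le h1]
        refine setIntegral_eq_zero_of_forall_eq_zero fun t ht => indicator_of_notMem ?_ _
        exact fun h2 => absurd h2.1 ht.2.not_gt
      · have h2 : R < s := by
          by_contra h3
          exact hs ⟨not_le.1 h1, not_lt.1 h3⟩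
        rw [← intervalIntegral.integral_add_adjacent_intervals (hwI _ R) (hwI _ _), hwint, zero_add,
          intervalIntegral.integral_of_le h2.le]
        refine setIntegral_eq_zero_of_forall_eq_zero fun t ht => indicator_of_notMem ?_ _
        exact fun h2 => absurd h2.2 ht.1.not_ge
    have h1 := h χ
    have h2 : ∫ s, F s * χ.eval s = -∫ s, W s * (φ.weakDeriv s - W s - c) ∂μ := by
      have h3 := hWp.integral_mul hχp (-R) R
      rw [intervalIntegral.integral_add] at h3
      · rw [hout (-R) (fun h => lt_irrefl _ h.1), hχ R, hwint, mul_zero, mul_zero, sub_zero] at h3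
        have h4 : ∫ s in (-R)..R, F s * χ.eval s = ∫ s, F s * χ.eval s := by
          rw [intervalIntegral.integral_of_le (by linarith)]
          refine setIntegral_eq_integral_of_forall_compl_eq_zero fun s hs => ?_
          rw [hout s hs, mul_zero]
        have h5 : ∫ s in (-R)..R, W s * w s = ∫ s, W s * (φ.weakDeriv s - W s - c) ∂μ := by
          rw [intervalIntegral.integral_of_le (by linarith)]
          refine integral_congr_ae ?_
          filter_upwards [ae_restrict_mem measurableSet_Ioc] with s hs
          simp only [w]
          rw [indicator_of_mem hs]
        linarith
      · exact (hF.mul χ.continuous_eval).intervalIntegrable _ _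
      · exact (hwI _ _).continuousOn_mul hWc.continuousOn
    have h3 : inner ℝ φ.weakDeriv χ.weakDeriv
        = ∫ s, φ.weakDeriv s * (φ.weakDeriv s - W s - c) ∂μ := by
      rw [D12.inner_weakDeriv]
      simp only [w, μ]
      rw [← integral_indicator measurableSet_Ioc]
      congr 1
      funext s
      by_cases hs : s ∈ Ioc (-R) R
      · rw [indicator_of_mem hs, indicator_of_mem hs]
      · rw [indicator_of_notMem hs, indicator_of_notMem hs, mul_zero]
    have i1 : Integrable (fun s => φ.weakDeriv s * (φ.weakDeriv s - W s - c)) μ :=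
      hφμ.integrable_mul hfc
    have i2 : Integrable (fun s => W s * (φ.weakDeriv s - W s - c)) μ := hWμ.integrable_mul hfc
    have h4 : ∫ s, (φ.weakDeriv s - W s - c) ^ 2 ∂μ = 0 := by
      have e : ∀ s, (φ.weakDeriv s - W s - c) ^ 2 = (φ.weakDeriv s * (φ.weakDeriv s - W s - c)
        - W s * (φ.weakDeriv s - W s - c)) - c * (φ.weakDeriv s - W s - c) := fun s => by ring
      simp only [e]
      have i3 : Integrable (fun s => φ.weakDeriv s * (φ.weakDeriv s - W s - c)
        - W s * (φ.weakDeriv s - W s - c)) μ := i1.sub i2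
      rw [integral_sub i3 ((hfc.integrable (by norm_num)).const_mul c),
        integral_sub i1 i2, integral_const_mul, hfc0]
      linarith
    have h5 : ∀ᵐ s ∂μ, φ.weakDeriv s = c + W s := by
      have := (integral_eq_zero_iff_of_nonneg (fun s => sq_nonneg _) hfc.integrable_sq).1 h4
      filter_upwards [this] with s hs
      have := pow_eq_zero_iff (two_ne_zero) |>.1 hs
      linarith
    refine ⟨c, fun s hs => ?_⟩
    have h6 := φ.isPrimitive.sub_eq 0 s
    have h7 : ∫ t in (0 : ℝ)..s, φ.weakDeriv t = ∫ t in (0 : ℝ)..s, (c + W t) := by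
      refine intervalIntegral.integral_congr_ae ?_
      filter_upwards [(ae_restrict_iff' measurableSet_Ioc).1 h5] with t ht hts
      refine ht ?_
      rcases le_total 0 s with h0 | h0
      · rw [uIoc_of_le h0] at hts
        exact ⟨by linarith [hts.1], hts.2.trans hs.2⟩
      · rw [uIoc_of_ge h0] at hts
        exact ⟨by linarith [hts.1, hs.1], by linarith [hts.2]⟩
    linarith
  choose! c hc using hloc
  -- The constants agree because all intervals with `R ≥ 1` contain `[0, 1]`.
  have hcc : ∀ R : ℝ, 1 ≤ R → c R = c 1 := by
    intro R hR
    have h1 := hc R (by linarith) 1 ⟨by linarith, hR⟩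
    have h2 := hc 1 one_pos 1 ⟨by norm_num, le_rfl⟩
    rw [intervalIntegral.integral_add (by simp) (hWc.intervalIntegrable _ _)] at h1 h2
    simp at h1 h2
    linarith
  have hall : φ.eval = fun s => φ.eval 0 + ∫ t in (0 : ℝ)..s, (c 1 + W t) := by
    funext s
    have h1 := hc (|s| + 1) (by positivity) s ⟨by linarith [neg_abs_le s], by linarith [le_abs_self s]⟩
    rw [hcc _ (by linarith [abs_nonneg s])] at h1
    exact h1
  refine ⟨c 1, fun s => ?_⟩
  rw [hall]
  have hcont : Continuous fun t => c 1 + W t := by fun_prop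
  exact (intervalIntegral.integral_hasDerivAt_right (hcont.intervalIntegrable _ _)
      (hcont.stronglyMeasurableAtFilter _ _) hcont.continuousAt).const_add _

/-! ### Critical points and homoclinic orbits -/

theorem isHomoclinicOrbit_iff {G : ℝ} {r y : ℝ → ℝ} : IsHomoclinicOrbit G r y ↔
    (∀ s, 0 < r s) ∧ (∀ s, HasDerivAt r (y s) s) ∧
    (∀ s, HasDerivAt y (force (G ^ 2) (rho s) (r s)) s) ∧
    Tendsto r atTop atTop ∧ Tendsto r atBot atTop ∧ Tendsto y atTop (𝓝 0) ∧
    Tendsto y atBot (𝓝 0) := by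
  have e1 : ∀ s, deriv (fun p => hamiltonian G (r s) s p) (y s) = y s := fun s => by
    have : HasDerivAt (fun p => hamiltonian G (r s) s p) (y s) (y s) := by
      have h := (((hasDerivAt_id' (y s)).fun_pow 2).div_const 2).add_const
        (effPotential G (r s) s)
      convert! h using 1
      simp
    exact this.deriv
  have e2 : ∀ s, 0 < r s → -deriv (fun x => hamiltonian G x s (y s)) (r s)
      = force (G ^ 2) (rho s) (r s) := fun s hs => by
    have : HasDerivAt (fun x => hamiltonian G x s (y s)) (-force (G ^ 2) (rho s) (r s)) (r s) := by
      simp only [hamiltonian, effPotential_eq]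
      exact (hasDerivAt_pot (G ^ 2) (rho s) hs).fun_neg.const_add _
    rw [this.deriv, neg_neg]
  constructor
  · intro h
    refine ⟨h.pos, fun s => ?_, fun s => ?_, h.r_atTop, h.r_atBot, h.y_atTop, h.y_atBot⟩
    · have := h.hasDerivAt_r s
      rwa [e1] at this
    · have := h.hasDerivAt_y s
      rwa [e2 s (h.pos s)] at this
  · rintro ⟨h1, h2, h3, h4, h5, h6, h7⟩
    refine ⟨h1, fun s => ?_, fun s => ?_, h4, h5, h6, h7⟩
    · rw [e1]; exact h2 s
    · rw [e2 s (h1 s)]; exact h3 s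

theorem exists_abs_forceDiff_le_inv_sq {G₀ : ℝ} (hG₀ : 0 < G₀) (G : ℝ) {φ : D12}
    (hφ : NoCollision G₀ φ) : ∃ C, ∀ s, |forceDiff G₀ G φ s| ≤ C / r0 G₀ s ^ 2 := by
  obtain ⟨δ, hδ, hδ1, h⟩ := hφ.exists_le hG₀
  obtain ⟨C, hC, h'⟩ := D12.exists_abs_eval_le hG₀
  set A := (3 + G ^ 2 + G₀ ^ 2) / δ ^ 3
  set Q := quadConst G₀ (G₀ ^ 2) δ
  have hQ : 0 ≤ Q := quadConst_nonneg (sq_nonneg G₀) hδ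
  refine ⟨A * (2 / G₀ ^ 2) + Q * (C * ‖φ‖), fun s => (abs_forceDiff_le hG₀ G hδ hδ1 h s).trans ?_⟩
  have hr := r0_pos hG₀ s
  have h1 : |φ.eval s| / r0 G₀ s ^ 3 ≤ C * ‖φ‖ * r0 G₀ s / r0 G₀ s ^ 3 := by
    gcongr; exact h' φ s
  have h2 : C * ‖φ‖ * r0 G₀ s / r0 G₀ s ^ 3 = C * ‖φ‖ * (1 / r0 G₀ s ^ 2) := by
    field_simp
  have h3 := inv_r0_cube_le hG₀ s
  calc A / r0 G₀ s ^ 3 + Q * (|φ.eval s| / r0 G₀ s ^ 3)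
      ≤ A * (2 / G₀ ^ 2 * (1 / r0 G₀ s ^ 2)) + Q * (C * ‖φ‖ * (1 / r0 G₀ s ^ 2)) := by
        rw [div_eq_mul_one_div A]
        gcongr
        exact h1.trans h2.le
    _ = _ := by ring

/-- The weak equation holds classically. The velocity `v` of `φ` and its derivative, the force
difference, are both square integrable, so `v²` has an integrable derivative and tends to zero; the
radius diverges because it dominates `δ r₀`. -/
theorem IsCriticalPoint.exists_isHomoclinicOrbit {G₀ : ℝ} (hG₀ : 0 < G₀) {G : ℝ} {φ : D12}
    (h : IsCriticalPoint G₀ G φ) : ∃ y, IsHomoclinicOrbit G (radius G₀ φ) y := by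
  obtain ⟨hn, hv⟩ := (isCriticalPoint_iff hG₀ G φ).1 h
  have hFc := continuous_forceDiff hG₀ G hn
  obtain ⟨c, hc⟩ := exists_hasDerivAt_eval (φ := φ) hFc fun χ => hv χ
  set v : ℝ → ℝ := fun s => c + ∫ t in (0 : ℝ)..s, forceDiff G₀ G φ t
  have hv' : ∀ s, HasDerivAt v (forceDiff G₀ G φ s) s := fun s =>
    (intervalIntegral.integral_hasDerivAt_right (hFc.intervalIntegrable _ _)
      (hFc.stronglyMeasurableAtFilter _ _) hFc.continuousAt).const_add c
  have hvc : Continuous v := continuous_iff_continuousAt.2 fun s => (hv' s).continuousAt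
  have hvL : MemLp v 2 volume := by
    refine (memLp_congr_ae ?_).1 φ.memLp
    have hp1 := φ.isPrimitive
    have hp2 : IsPrimitive φ.eval v := isPrimitive_of_hasDerivAt hc hvc
    have h3 : ∀ n : ℕ, ∀ᵐ s, s ∈ uIcc (-(n : ℝ)) n → φ.weakDeriv s = v s := fun n => by
      filter_upwards [hp1.ae_hasDerivAt (-n) n, hp2.ae_hasDerivAt (-n) n] with s h1 h2 hs
      exact (h1 hs).unique (h2 hs)
    filter_upwards [ae_all_iff.2 h3] with s hs
    obtain ⟨n, hn⟩ := exists_nat_ge |s|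
    refine hs n ?_
    rw [uIcc_of_le (by linarith [(Nat.cast_nonneg n : (0 : ℝ) ≤ n)])]
    exact abs_le.1 hn
  obtain ⟨C, hC⟩ := exists_abs_forceDiff_le_inv_sq hG₀ G hn
  have hFi : Integrable (forceDiff G₀ G φ) :=
    integrable_of_le_inv_r0_sq hG₀ hFc.aestronglyMeasurable C hC
  have hv2 : Integrable fun s => v s ^ 2 := hvL.integrable_sq
  have hF2 : Integrable fun s => forceDiff G₀ G φ s ^ 2 := by
    refine (hFi.norm.const_mul (|C| * (4 / G₀ ^ 4))).mono' (hFc.pow 2).aestronglyMeasurable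
      (Eventually.of_forall fun s => ?_)
    rw [Real.norm_of_nonneg (sq_nonneg _), Real.norm_eq_abs, ← sq_abs, sq]
    gcongr
    have hr := r0_pos hG₀ s
    refine (hC s).trans ?_
    have h1 : 1 / r0 G₀ s ^ 2 ≤ 4 / G₀ ^ 4 := by
      have h2 := half_sq_le_r0 G₀ s
      calc 1 / r0 G₀ s ^ 2 ≤ 1 / (G₀ ^ 2 / 2) ^ 2 := by gcongr
        _ = _ := by field_simp; norm_num
    calc C / r0 G₀ s ^ 2 ≤ |C| / r0 G₀ s ^ 2 := by gcongr; exact le_abs_self C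
      _ = |C| * (1 / r0 G₀ s ^ 2) := by ring
      _ ≤ _ := by gcongr
  have hd : ∀ s, HasDerivAt (fun s => v s ^ 2) (2 * (v s * forceDiff G₀ G φ s)) s := fun s => by
    have := (hv' s).fun_pow 2
    convert! this using 1
    simp; ring
  have hdi : Integrable fun s => 2 * (v s * forceDiff G₀ G φ s) := by
    refine (hv2.add hF2).mono' (by fun_prop) (Eventually.of_forall fun s => ?_)
    rw [Real.norm_eq_abs, abs_le, Pi.add_apply]
    constructor <;> nlinarith [sq_nonneg (v s + forceDiff G₀ G φ s),
      sq_nonneg (v s - forceDiff G₀ G φ s)]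
  have habs : ∀ {l : Filter ℝ}, Tendsto (fun s => v s ^ 2) l (𝓝 0) → Tendsto v l (𝓝 0) := by
    intro l hl
    have := hl.sqrt
    simp only [Real.sqrt_sq_eq_abs, Real.sqrt_zero] at this
    exact (tendsto_zero_iff_abs_tendsto_zero _).2 this
  have hvT : Tendsto v atTop (𝓝 0) := habs
    (tendsto_zero_of_hasDerivAt_of_integrableOn_Ioi (a := 0) (fun s _ => hd s) hdi.integrableOn
      hv2.integrableOn)
  have hvB : Tendsto v atBot (𝓝 0) := habs
    (tendsto_zero_of_hasDerivAt_of_integrableOn_Iic (a := 0) (fun s _ => hd s) hdi.integrableOn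
      hv2.integrableOn)
  obtain ⟨δ, hδ, -, hr⟩ := hn.exists_le hG₀
  refine ⟨fun s => deriv (r0 G₀) s + v s, isHomoclinicOrbit_iff.2 ⟨hn, fun s => ?_, fun s => ?_,
    tendsto_atTop_mono hr ((tendsto_r0_atTop hG₀).const_mul_atTop hδ),
    tendsto_atTop_mono hr ((tendsto_r0_atBot hG₀).const_mul_atTop hδ), ?_, ?_⟩⟩
  · exact (hasDerivAt_r0 hG₀ s).differentiableAt.hasDerivAt.fun_add (hc s)
  · have h1 := (hasDerivAt_deriv_r0 hG₀ s).differentiableAt.hasDerivAt.fun_add (hv' s)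
    rw [deriv_deriv_r0_eq_force hG₀, forceDiff, add_sub_cancel] at h1
    exact h1
  · simpa using (tendsto_deriv_r0_of_abs hG₀ tendsto_abs_atTop_atTop).add hvT
  · simpa using (tendsto_deriv_r0_of_abs hG₀ tendsto_abs_atBot_atTop).add hvB

/-- While `f > 0`, the function `v - C/t` is nondecreasing. If it were positive at `s`, then `f`
would increase, stay positive for ever, and `v - C/t` would stay away from zero, contrary to `v →
0`. -/
theorem le_div_of_convex_defect {f v w : ℝ → ℝ} (hf : ∀ s, HasDerivAt f (v s) s)
    (hv : ∀ s, HasDerivAt v (w s) s) (hv0 : Tendsto v atTop (𝓝 0)) {C T : ℝ} (hC : 0 ≤ C)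
    (hT : 0 < T) (h : ∀ s ≥ T, 0 < f s → -(C / s ^ 2) ≤ w s) {s : ℝ} (hs : T ≤ s)
    (hfs : 0 < f s) : v s ≤ C / s := by
  by_contra hlt
  push Not at hlt
  set p : ℝ → ℝ := fun t => v t - C * t⁻¹
  have hp : ∀ t ≥ s, HasDerivAt p (w t + C / t ^ 2) t := fun t ht => by
    have ht0 : t ≠ 0 := by linarith
    have := (hv t).fun_sub (((hasDerivAt_id' t).fun_inv ht0).const_mul C)
    convert! this using 1
    field_simp
    ring
  have hps : 0 < p s := by
    simp only [p]; rw [← div_eq_mul_inv]; linarith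
  have hfc : Continuous f := continuous_iff_continuousAt.2 fun t => (hf t).continuousAt
  have hmono : ∀ b, (∀ t ∈ Ioo s b, 0 < f t) → ∀ t ∈ Icc s b, p s ≤ p t := by
    intro b hb t ht
    refine monotoneOn_of_deriv_nonneg (convex_Icc s b)
      (fun t ht => (hp t ht.1).continuousAt.continuousWithinAt)
      (fun t ht => ?_) (fun t ht => ?_) (left_mem_Icc.2 (ht.1.trans ht.2)) ht ht.1
    · rw [interior_Icc] at ht
      exact (hp t ht.1.le).differentiableAt.differentiableWithinAt
    · rw [interior_Icc] at ht
      rw [(hp t ht.1.le).deriv]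
      linarith [h t (hs.trans ht.1.le) (hb t ht)]
  have hpos : ∀ t ≥ s, 0 < f t := by
    by_contra hcon
    push Not at hcon
    obtain ⟨b, hb, hfb⟩ := hcon
    have hZ : IsCompact (Icc s b ∩ {t | f t ≤ 0}) :=
      isCompact_Icc.inter_right (isClosed_le hfc continuous_const)
    obtain ⟨t₀, ⟨ht₀, hft₀⟩, hleast⟩ := hZ.exists_isLeast ⟨b, ⟨hb, le_rfl⟩, hfb⟩
    have hft₀ : f t₀ ≤ 0 := hft₀
    have h1 : ∀ t ∈ Ioo s t₀, 0 < f t := fun t ht => by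
      by_contra h2
      exact absurd (hleast ⟨⟨ht.1.le, ht.2.le.trans ht₀.2⟩, not_lt.1 h2⟩) ht.2.not_ge
    have h2 : f s ≤ f t₀ := by
      refine monotoneOn_of_deriv_nonneg (convex_Icc s t₀) hfc.continuousOn
        (fun t _ => (hf t).differentiableAt.differentiableWithinAt) (fun t ht => ?_)
        (left_mem_Icc.2 ht₀.1) (right_mem_Icc.2 ht₀.1) ht₀.1
      rw [(hf t).deriv]
      have h3 := hmono t₀ h1 t (interior_subset ht)
      have h4 := (interior_subset ht).1
      have h5 : 0 ≤ C * t⁻¹ := mul_nonneg hC (inv_nonneg.2 (by linarith))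
      have h6 : p t = v t - C * t⁻¹ := rfl
      linarith
    linarith
  have hlim : Tendsto p atTop (𝓝 0) := by
    simpa using hv0.sub (tendsto_inv_atTop_zero.const_mul C)
  have : p s ≤ 0 := ge_of_tendsto hlim (by
    filter_upwards [eventually_ge_atTop s] with t ht
    exact hmono t (fun x hx => hpos x hx.1.le) t ⟨ht, le_rfl⟩)
  linarith

/-- A function `f` with `f' → 0`, and `f f'' ≥ -C |f| / s²` at infinity, has finite energy. -/
theorem integrableOn_sq_of_mul_le {f v w : ℝ → ℝ} (hf : ∀ s, HasDerivAt f (v s) s)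
    (hv : ∀ s, HasDerivAt v (w s) s) (hv0 : Tendsto v atTop (𝓝 0)) {C T : ℝ} (hC : 0 < C)
    (hT : 0 < T) (h : ∀ s ≥ T, -(C * |f s| / s ^ 2) ≤ f s * w s) :
    IntegrableOn (fun s => v s ^ 2) (Ioi T) := by
  have hfc : Continuous f := continuous_iff_continuousAt.2 fun t => (hf t).continuousAt
  have hvc : Continuous v := continuous_iff_continuousAt.2 fun t => (hv t).continuousAt
  -- The one-sided bound on the velocity, applied to `f` or to `-f` according to the sign.
  have h1 : ∀ s ≥ T, f s * v s ≤ C * |f s| / s := by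
    intro s hs
    have hs0 : 0 < s := hT.trans_le hs
    rcases lt_trichotomy (f s) 0 with h0 | h0 | h0
    · have := le_div_of_convex_defect (f := fun s => -f s) (fun s => (hf s).fun_neg)
        (fun s => (hv s).fun_neg) (by simpa using hv0.neg) hC.le hT (fun t ht hft => by
          have h2 := h t ht
          have h3 : f t < 0 := by linarith
          rw [abs_of_neg h3, ← sub_nonneg] at h2
          have h4 : f t * w t - -(C * -f t / t ^ 2) = (-f t) * (C / t ^ 2 - w t) := by ring
          rw [h4] at h2
          linarith [nonneg_of_mul_nonneg_right h2 hft]) hs (by linarith)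
      rw [abs_of_neg h0]
      calc f s * v s = (-f s) * (-v s) := by ring
        _ ≤ (-f s) * (C / s) := by gcongr; linarith
        _ = _ := by ring
    · simp [h0]
    · have := le_div_of_convex_defect hf hv hv0 hC.le hT (fun t ht hft => by
          have h2 := h t ht
          rw [abs_of_pos hft, ← sub_nonneg] at h2
          have h4 : f t * w t - -(C * f t / t ^ 2) = f t * (w t + C / t ^ 2) := by ring
          rw [h4] at h2
          linarith [nonneg_of_mul_nonneg_right h2 hft]) hs h0
      rw [abs_of_pos h0]
      calc f s * v s ≤ f s * (C / s) := by gcongr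
        _ = _ := by ring
  set K := (f T ^ 2 + C ^ 2) / T
  have hK : 0 < K := by positivity
  -- The quotient `(f² + C²)/t` is nonincreasing: by `h1` its derivative is at most `-(|f| -
  -- C)²/t²`.
  have h2 : ∀ s ≥ T, f s ^ 2 ≤ K * s := by
    intro s hs
    have hs0 : 0 < s := hT.trans_le hs
    have hd : ∀ t ≥ T, HasDerivAt (fun t => (f t ^ 2 + C ^ 2) * t⁻¹)
        (2 * (f t * v t) * t⁻¹ + (f t ^ 2 + C ^ 2) * (-(t ^ 2)⁻¹)) t := fun t ht => by
      have := (((hf t).fun_pow 2).add_const (C ^ 2)).fun_mul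
        ((hasDerivAt_id' t).fun_inv (by linarith))
      convert! this using 1
      simp
      ring
    have hanti : AntitoneOn (fun t => (f t ^ 2 + C ^ 2) * t⁻¹) (Ici T) := by
      refine antitoneOn_of_deriv_nonpos (convex_Ici T)
        (fun t ht => (hd t ht).continuousAt.continuousWithinAt)
        (fun t ht => (hd t (interior_subset ht)).differentiableAt.differentiableWithinAt)
        (fun t ht => ?_)
      have ht' : T ≤ t := interior_subset ht
      have ht0 : 0 < t := hT.trans_le ht'
      rw [(hd t ht').deriv]
      have h3 : 2 * (f t * v t) * t⁻¹ ≤ 2 * (C * |f t| / t) * t⁻¹ := by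
        gcongr; exact h1 t ht'
      have h4 : 2 * (C * |f t| / t) * t⁻¹ + (f t ^ 2 + C ^ 2) * (-(t ^ 2)⁻¹)
          = -((|f t| - C) ^ 2 / t ^ 2) := by
        rw [← sq_abs (f t)]
        field_simp
        ring
      have h5 : 0 ≤ (|f t| - C) ^ 2 / t ^ 2 := by positivity
      linarith
    have h3 := hanti self_mem_Ici hs hs
    simp only [← div_eq_mul_inv] at h3
    rw [div_le_iff₀ hs0] at h3
    nlinarith [sq_nonneg C]
  have h3 : ∀ s ≥ T, |f s| ≤ √K * √s := fun s hs => by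
    rw [← Real.sqrt_mul hK.le, ← Real.sqrt_sq_eq_abs]
    exact Real.sqrt_le_sqrt (h2 s hs)
  -- As `f = O(√s)`, the defect `C|f|/s²` is `O(s^(-3/2))`. The second term compensates for it, so
  -- `q' ≥ v²`, while `q` is bounded above by `h1` and `h2`.
  set q : ℝ → ℝ := fun s => f s * v s - 2 * C * √K * (√s)⁻¹
  have hq : ∀ s ≥ T, HasDerivAt q (v s * v s + f s * w s + C * √K * ((√s) ^ 3)⁻¹) s := by
    intro s hs
    have hs0 : 0 < s := hT.trans_le hs
    have hsq : 0 < √s := Real.sqrt_pos.2 hs0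
    have := ((hf s).fun_mul (hv s)).fun_sub
      (((Real.hasDerivAt_sqrt hs0.ne').fun_inv hsq.ne').const_mul (2 * C * √K))
    convert! this using 1
    field_simp
    ring
  have hle : ∀ s ≥ T, v s ^ 2 ≤ v s * v s + f s * w s + C * √K * ((√s) ^ 3)⁻¹ := by
    intro s hs
    have hs0 : 0 < s := hT.trans_le hs
    have hsq : 0 < √s := Real.sqrt_pos.2 hs0
    have h4 : C * |f s| / s ^ 2 ≤ C * √K * ((√s) ^ 3)⁻¹ := by
      calc C * |f s| / s ^ 2 ≤ C * (√K * √s) / s ^ 2 := by gcongr; exact h3 s hs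
        _ = C * (√K * √s) / (√s ^ 2) ^ 2 := by rw [Real.sq_sqrt hs0.le]
        _ = _ := by field_simp
    linarith [h s hs, sq (v s)]
  refine integrableOn_Ioi_of_intervalIntegral_norm_bounded (l := atTop) (b := fun b : ℝ => b)
    (C * (K + 1 / T) - q T) T (fun i => ?_) tendsto_id ?_
  · exact (hvc.pow 2).integrableOn_Ioc
  filter_upwards [eventually_ge_atTop T] with S hS
  have hS0 : 0 < S := hT.trans_le hS
  simp only [Real.norm_of_nonneg (sq_nonneg (v _))]
  have h5 := intervalIntegral.integral_le_sub_of_hasDeriv_right_of_le hS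
    (fun t ht => (hq t ht.1).continuousAt.continuousWithinAt)
    (fun t ht => (hq t ht.1.le).hasDerivWithinAt) (hvc.pow 2).integrableOn_Icc
    (fun t ht => hle t ht.1.le)
  have h6 : q S ≤ C * (K + 1 / T) := by
    have h7 : 0 ≤ 2 * C * √K * (√S)⁻¹ := by positivity
    have h8 : C * |f S| / S ≤ C * (K + 1 / T) := by
      rw [mul_div_assoc]
      gcongr
      rw [div_le_iff₀ hS0]
      have h9 := h2 S hS
      have h10 : 1 ≤ 1 / T * S := by rw [one_div, ← div_eq_inv_mul, one_le_div hT]; exact hS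
      nlinarith [sq_nonneg (|f S| - 1), sq_abs (f S)]
    have h11 := h1 S hS
    simp only [q]
    linarith
  have h7 : ∫ y in T..S, v y ^ 2 ≤ q S - q T := h5
  linarith

/-- The first variation vanishes at solutions. -/
theorem firstVar_eq_zero_of_hasDerivAt {G₀ : ℝ} (hG₀ : 0 < G₀) {G : ℝ} {φ : D12}
    (hφ : NoCollision G₀ φ) {v : ℝ → ℝ} (hv : ∀ s, HasDerivAt v (forceDiff G₀ G φ s) s)
    (hφv : (φ.weakDeriv : ℝ → ℝ) =ᵐ[volume] v) (χ : D12) : firstVar G₀ G φ χ = 0 := by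
  have hFc := continuous_forceDiff hG₀ G hφ
  have hvL : MemLp v 2 volume := (memLp_congr_ae hφv).1 φ.memLp
  obtain ⟨_, h1⟩ := exists_forceDiff_mul_le hG₀ G hφ
  have hFχ := (h1 χ).1
  have hvχ : Integrable fun s => v s * χ.weakDeriv s := hvL.integrable_mul χ.memLp
  have hsum : Integrable fun s => forceDiff G₀ G φ s * χ.eval s + v s * χ.weakDeriv s :=
    hFχ.add hvχ
  have hinner : inner ℝ φ.weakDeriv χ.weakDeriv = ∫ s, v s * χ.weakDeriv s := by
    rw [L2.inner_def]
    refine integral_congr_ae ?_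
    filter_upwards [hφv] with s hs
    rw [hs]
    exact mul_comm _ _
  have hfv : firstVar G₀ G φ χ
      = ∫ s, (forceDiff G₀ G φ s * χ.eval s + v s * χ.weakDeriv s) := by
    rw [integral_add hFχ hvχ, firstVar, hinner, add_comm]
  have hlim := intervalIntegral_tendsto_integral hsum tendsto_neg_atTop_atBot
    (tendsto_id (α := ℝ) (x := atTop))
  rw [← hfv] at hlim
  have hvp : IsPrimitive v (forceDiff G₀ G φ) := isPrimitive_of_hasDerivAt hv hFc
  -- The boundary term converges to the first variation. By Hardy's inequality `|P(S)|/S` is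
  -- integrable at infinity while `1/S` is not, so the limit must be zero.
  set P : ℝ → ℝ := fun S => v S * χ.eval S - v (-S) * χ.eval (-S)
  have hP : Tendsto P atTop (𝓝 (firstVar G₀ G φ χ)) :=
    hlim.congr fun S => hvp.integral_mul χ.isPrimitive (-S) S
  obtain ⟨C, hC, hH⟩ := D12.exists_hardy hG₀
  have hvc : Continuous v := hvp.continuous
  have hχc := χ.continuous_eval
  have hQ : Integrable fun s => v s ^ 2 + (18 + G₀ ^ 6) * (χ.eval s ^ 2 / r0 G₀ s ^ 3) :=
    hvL.integrable_sq.add ((hH χ).1.const_mul _)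
  have hPle : ∀ s : ℝ, 1 ≤ |s| → |v s * χ.eval s| * |s|⁻¹ ≤
      v s ^ 2 + (18 + G₀ ^ 6) * (χ.eval s ^ 2 / r0 G₀ s ^ 3) := by
    intro s hs
    have hs0 : 0 < |s| := by linarith
    have hr := r0_pos hG₀ s
    have h2 : r0 G₀ s ^ 3 ≤ (18 + G₀ ^ 6) * |s| ^ 2 := by
      have h3 := r0_cube_le hG₀ s
      rw [← sq_abs] at h3
      have h4 : (1 : ℝ) ≤ |s| ^ 2 := one_le_pow₀ hs
      have h5 : 0 ≤ G₀ ^ 6 := by positivity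
      nlinarith
    have h3 : χ.eval s ^ 2 / |s| ^ 2 ≤ (18 + G₀ ^ 6) * (χ.eval s ^ 2 / r0 G₀ s ^ 3) := by
      rw [div_le_iff₀ (by positivity)]
      calc χ.eval s ^ 2 = χ.eval s ^ 2 / r0 G₀ s ^ 3 * r0 G₀ s ^ 3 := by field_simp
        _ ≤ χ.eval s ^ 2 / r0 G₀ s ^ 3 * ((18 + G₀ ^ 6) * |s| ^ 2) := by gcongr
        _ = _ := by ring
    have h4 : |v s * χ.eval s| * |s|⁻¹ = |v s| * (|χ.eval s| / |s|) := by
      rw [abs_mul]; ring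
    have h5 : (|χ.eval s| / |s|) ^ 2 = χ.eval s ^ 2 / |s| ^ 2 := by
      rw [div_pow, sq_abs (χ.eval s)]
    rw [h4]
    nlinarith [sq_nonneg (|v s| - |χ.eval s| / |s|), sq_abs (v s),
      sq_nonneg (|v s|), sq_nonneg (|χ.eval s| / |s|)]
  by_contra hne
  set ℓ := firstVar G₀ G φ χ
  have hℓ : 0 < |ℓ| := abs_pos.2 hne
  obtain ⟨N, hN⟩ := eventually_atTop.1
    ((hP.abs.eventually_const_lt (half_lt_self hℓ)).and (eventually_ge_atTop (1 : ℝ)))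
  refine not_integrableOn_Ioi_inv (a := N) ?_
  have hint : Integrable fun s => 2 / |ℓ| *
      ((v s ^ 2 + (18 + G₀ ^ 6) * (χ.eval s ^ 2 / r0 G₀ s ^ 3)) +
      (v (-s) ^ 2 + (18 + G₀ ^ 6) * (χ.eval (-s) ^ 2 / r0 G₀ (-s) ^ 3))) :=
    (hQ.add hQ.comp_neg).const_mul _
  refine hint.integrableOn.mono' (measurable_inv.aestronglyMeasurable) ?_
  filter_upwards [ae_restrict_mem measurableSet_Ioi] with s hs
  obtain ⟨h2, h3⟩ := hN s (le_of_lt hs)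
  have hs0 : 0 < s := by linarith
  have h4 := hPle s (by rwa [abs_of_pos hs0])
  have h5 := hPle (-s) (by rwa [abs_neg, abs_of_pos hs0])
  rw [abs_neg, abs_of_pos hs0] at h5
  rw [abs_of_pos hs0] at h4
  rw [Real.norm_of_nonneg (by positivity)]
  have h6 : |P s| * s⁻¹ ≤ |v s * χ.eval s| * s⁻¹ + |v (-s) * χ.eval (-s)| * s⁻¹ := by
    rw [← add_mul]
    gcongr
    exact abs_sub _ _
  have h7 : |ℓ| / 2 * s⁻¹ ≤ |P s| * s⁻¹ := by gcongr
  calc s⁻¹ = 2 / |ℓ| * (|ℓ| / 2 * s⁻¹) := by field_simp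
    _ ≤ _ := by
        gcongr
        linarith

/-- The point is that `f = r - r₀` has finite energy, although only `f' → 0` is given. In `f f''`
the difference of the same force at `r` and `r₀` contributes a nonnegative term by monotonicity, and
the perturbation of the force at `r₀` is `O(r₀⁻³) = O(s⁻²)`. The half-line lemma then applies at
both ends, after time reversal at `-∞`. -/
theorem IsHomoclinicOrbit.exists_isCriticalPoint {G₀ : ℝ} (hG₀ : 0 < G₀) {G : ℝ} {r y : ℝ → ℝ}
    (h : IsHomoclinicOrbit G r y) : ∃ φ : D12, IsCriticalPoint G₀ G φ ∧ r = radius G₀ φ := by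
  obtain ⟨hpos, hr, hy, hrT, hrB, hyT, hyB⟩ := isHomoclinicOrbit_iff.1 h
  set f : ℝ → ℝ := fun s => r s - r0 G₀ s
  set v : ℝ → ℝ := fun s => y s - deriv (r0 G₀) s
  set w : ℝ → ℝ := fun s => force (G ^ 2) (rho s) (r s) - force (G₀ ^ 2) 0 (r0 G₀ s)
  have hf : ∀ s, HasDerivAt f (v s) s := fun s =>
    (hr s).fun_sub (hasDerivAt_r0 hG₀ s).differentiableAt.hasDerivAt
  have hv : ∀ s, HasDerivAt v (w s) s := fun s => by
    have h1 := (hy s).fun_sub (hasDerivAt_deriv_r0 hG₀ s).differentiableAt.hasDerivAt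
    rwa [deriv_deriv_r0_eq_force hG₀] at h1
  have hvc : Continuous v := continuous_iff_continuousAt.2 fun s => (hv s).continuousAt
  set C := 2 * (3 + G ^ 2 + G₀ ^ 2)
  have hC : 0 < C := by positivity
  have key : ∀ s, s ≠ 0 → 2 + 24 * G ^ 2 ≤ r s → 2 + 24 * G ^ 2 ≤ r0 G₀ s →
      -(C * |f s| / s ^ 2) ≤ f s * w s := by
    intro s hs h1 h2
    have hr0 := r0_pos hG₀ s
    have hs2 : 0 < s ^ 2 := by positivity
    have hmono := force_monotoneOn (sq_nonneg G) (pow_le_one₀ (n := 2) (rho_nonneg s) (rho_le_one s))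
    have h3 : 0 ≤ f s * (force (G ^ 2) (rho s) (r s) - force (G ^ 2) (rho s) (r0 G₀ s)) := by
      rcases le_total (r s) (r0 G₀ s) with hle | hle
      · exact mul_nonneg_of_nonpos_of_nonpos (sub_nonpos.2 hle)
          (sub_nonpos.2 (hmono h1 h2 hle))
      · exact mul_nonneg (sub_nonneg.2 hle) (sub_nonneg.2 (hmono h2 h1 hle))
    have h4 := abs_force_sub_force_le (sq_nonneg G) (sq_nonneg G₀) (rho_nonneg s) (rho_le_one s) hr0
    have h5 : (3 + G ^ 2 + G₀ ^ 2) / r0 G₀ s ^ 3 ≤ C / s ^ 2 := by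
      rw [div_le_div_iff₀ (by positivity) hs2]
      have := sq_le_two_mul_r0_cube hG₀ s
      simp only [C]
      nlinarith [sq_nonneg G, sq_nonneg G₀]
    have h6 : |f s * (force (G ^ 2) (rho s) (r0 G₀ s) - force (G₀ ^ 2) 0 (r0 G₀ s))|
        ≤ C * |f s| / s ^ 2 := by
      rw [abs_mul]
      calc _ ≤ |f s| * (C / s ^ 2) := by gcongr; exact h4.trans h5
        _ = _ := by ring
    have h7 := (abs_le.1 h6).1
    simp only [w]
    linarith
  obtain ⟨T₁, hT₁⟩ := eventually_atTop.1 ((hrT.eventually_ge_atTop (2 + 24 * G ^ 2)).and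
    ((tendsto_r0_atTop hG₀).eventually_ge_atTop (2 + 24 * G ^ 2)))
  obtain ⟨T₂, hT₂⟩ := eventually_atBot.1 ((hrB.eventually_ge_atTop (2 + 24 * G ^ 2)).and
    ((tendsto_r0_atBot hG₀).eventually_ge_atTop (2 + 24 * G ^ 2)))
  set T := max 1 (max T₁ (-T₂))
  have hT1 : 1 ≤ T := le_max_left _ _
  have hT2 : T₁ ≤ T := (le_max_left _ _).trans (le_max_right _ _)
  have hT3 : -T₂ ≤ T := (le_max_right _ _).trans (le_max_right _ _)
  have hvT : Tendsto v atTop (𝓝 0) := by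
    simpa using hyT.sub (tendsto_deriv_r0_of_abs hG₀ tendsto_abs_atTop_atTop)
  have hvB : Tendsto v atBot (𝓝 0) := by
    simpa using hyB.sub (tendsto_deriv_r0_of_abs hG₀ tendsto_abs_atBot_atTop)
  have i1 : IntegrableOn (fun s => v s ^ 2) (Ioi T) :=
    integrableOn_sq_of_mul_le hf hv hvT hC (by linarith) fun s hs =>
      key s (by linarith) (hT₁ s (by linarith)).1 (hT₁ s (by linarith)).2
  have hneg : ∀ {u : ℝ → ℝ} {u' s : ℝ}, HasDerivAt u u' (-s) →
      HasDerivAt (fun s => u (-s)) (-u') s := fun hu => by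
    have := hu.scomp _ (hasDerivAt_neg _)
    rw [neg_one_smul] at this
    exact this
  have i2 : IntegrableOn (fun s => (-v (-s)) ^ 2) (Ioi T) :=
    integrableOn_sq_of_mul_le (f := fun s => f (-s)) (w := fun s => w (-s))
      (fun s => hneg (hf (-s))) (fun s => by simpa using (hneg (hv (-s))).fun_neg)
      (by simpa using (hvB.comp tendsto_neg_atTop_atBot).neg) hC (by linarith) fun s hs => by
      have := key (-s) (by linarith) (hT₂ (-s) (by linarith)).1 (hT₂ (-s) (by linarith)).2
      rwa [neg_sq] at this
  have i3 : IntegrableOn (fun s => v s ^ 2) (Iio (-T)) := by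
    simp only [neg_sq] at i2
    have := (Measure.measurePreserving_neg (volume : Measure ℝ)).integrableOn_comp_preimage
      (Homeomorph.neg ℝ).measurableEmbedding (f := fun s => v s ^ 2) (s := Iio (-T))
    rw [show (Neg.neg ⁻¹' Iio (-T) : Set ℝ) = Ioi T by ext s; simp] at this
    exact this.1 i2
  have hv2 : Integrable fun s => v s ^ 2 := by
    have h1 : IntegrableOn (fun s => v s ^ 2) (Iio (-T) ∪ Icc (-T) T ∪ Ioi T) :=
      (i3.union (hvc.pow 2).integrableOn_Icc).union i1
    rw [← integrableOn_univ]
    refine h1.mono_set fun s _ => ?_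
    rcases lt_or_ge s (-T) with h2 | h2
    · exact Or.inl (Or.inl h2)
    · rcases le_or_gt s T with h3 | h3
      · exact Or.inl (Or.inr ⟨h2, h3⟩)
      · exact Or.inr h3
  have hvL : MemLp v 2 volume := (memLp_two_iff_integrable_sq hvc.aestronglyMeasurable).2 hv2
  set φ := D12.ofDeriv (f 0) hvL
  have hφ : φ.eval = f := D12.eval_ofDeriv_eq (isPrimitive_of_hasDerivAt hf hvc) hvL
  have hrad : radius G₀ φ = r := by
    funext s
    rw [radius, hφ]
    simp only [f]
    ring
  have hn : NoCollision G₀ φ := fun s => by rw [hrad]; exact hpos s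
  refine ⟨φ, (isCriticalPoint_iff hG₀ G φ).2 ⟨hn, fun χ => ?_⟩, hrad.symm⟩
  refine firstVar_eq_zero_of_hasDerivAt hG₀ hn (fun s => ?_) (D12.coeFn_weakDeriv_ofDeriv _ hvL) χ
  rw [forceDiff, hrad]
  exact hv s

/-! ### Doubly parabolic motions -/

theorem hasDerivAt_vec {a b : ℝ → ℝ} {a' b' t : ℝ} (ha : HasDerivAt a a' t)
    (hb : HasDerivAt b b' t) :
    HasDerivAt (fun t => (!₂[a t, b t] : EuclideanSpace ℝ (Fin 2))) !₂[a', b'] t := by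
  have h : HasDerivAt (fun t => (![a t, b t] : Fin 2 → ℝ)) ![a', b'] t := by
    rw [hasDerivAt_pi]
    intro i
    fin_cases i
    · exact ha
    · exact hb
  exact ((EuclideanSpace.equiv (Fin 2) ℝ).symm.hasFDerivAt.comp_hasDerivAt t h)

theorem norm_vec_sq (a b : ℝ) : ‖(!₂[a, b] : EuclideanSpace ℝ (Fin 2))‖ ^ 2 = a ^ 2 + b ^ 2 := by
  rw [EuclideanSpace.norm_sq_eq, Fin.sum_univ_two]
  simp

/-- Homoclinic orbits are the radial parts of doubly parabolic motions. -/
theorem IsHomoclinicOrbit.exists_isDoublyParabolicMotion {G : ℝ} {r y : ℝ → ℝ}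
    (h : IsHomoclinicOrbit G r y) :
    ∃ q, IsDoublyParabolicMotion G q ∧ ∀ t, ‖q t‖ = r t := by
  obtain ⟨hpos, hr, hy, hrT, hrB, hyT, hyB⟩ := isHomoclinicOrbit_iff.1 h
  have hrc : Continuous r := continuous_iff_continuousAt.2 fun s => (hr s).continuousAt
  have hωc : Continuous fun t => G / r t ^ 2 :=
    continuous_const.div (hrc.pow 2) fun t => pow_ne_zero _ (hpos t).ne'
  -- Polar coordinates: angular momentum `G` prescribes the angular velocity `G/r²`.
  set θ : ℝ → ℝ := fun t => ∫ s in (0 : ℝ)..t, G / r s ^ 2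
  have hθ : ∀ t, HasDerivAt θ (G / r t ^ 2) t := fun t =>
    intervalIntegral.integral_hasDerivAt_right (hωc.intervalIntegrable _ _)
      (hωc.stronglyMeasurableAtFilter _ _) hωc.continuousAt
  set q : ℝ → EuclideanSpace ℝ (Fin 2) := fun t => !₂[r t * Real.cos (θ t), r t * Real.sin (θ t)]
  set p : ℝ → EuclideanSpace ℝ (Fin 2) := fun t =>
    !₂[y t * Real.cos (θ t) - G / r t * Real.sin (θ t),
      y t * Real.sin (θ t) + G / r t * Real.cos (θ t)]
  have hq : ∀ t, HasDerivAt q (p t) t := fun t => by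
    have hr0 := (hpos t).ne'
    refine hasDerivAt_vec ?_ ?_
    · have := (hr t).fun_mul (hθ t).cos
      convert! this using 1
      field_simp
      ring
    · have := (hr t).fun_mul (hθ t).sin
      convert! this using 1
      field_simp
  have hp : deriv q = p := funext fun t => (hq t).deriv
  have hnorm : ∀ t, ‖q t‖ = r t := fun t => by
    have h1 := norm_vec_sq (r t * Real.cos (θ t)) (r t * Real.sin (θ t))
    have h2 : ‖q t‖ ^ 2 = r t ^ 2 := by
      rw [h1, mul_pow, mul_pow, ← mul_add, Real.cos_sq_add_sin_sq, mul_one]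
    exact (sq_eq_sq₀ (norm_nonneg _) (hpos t).le).1 h2
  have hspeed : ∀ t, ‖p t‖ = √(y t ^ 2 + (G / r t) ^ 2) := fun t => by
    have h1 := norm_vec_sq (y t * Real.cos (θ t) - G / r t * Real.sin (θ t))
      (y t * Real.sin (θ t) + G / r t * Real.cos (θ t))
    have h2 : ‖p t‖ ^ 2 = y t ^ 2 + (G / r t) ^ 2 := by
      rw [h1]
      linear_combination (y t ^ 2 + (G / r t) ^ 2) * Real.cos_sq_add_sin_sq (θ t)
    rw [← h2, Real.sqrt_sq (norm_nonneg _)]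
  have hspeed0 : ∀ {l : Filter ℝ}, Tendsto r l atTop → Tendsto y l (𝓝 0) →
      Tendsto (fun t => ‖deriv q t‖) l (𝓝 0) := by
    intro l hl1 hl2
    rw [hp]
    simp only [hspeed]
    have := ((hl2.pow 2).add ((hl1.const_div_atTop G).pow 2)).sqrt
    simpa using this
  refine ⟨q, ⟨fun t ht => ?_, fun t => (hq t).differentiableAt, fun t => ?_, fun t => ?_, ?_, ?_,
    hspeed0 hrT hyT, hspeed0 hrB hyB⟩, hnorm⟩
  · have := hnorm t
    rw [ht, norm_zero] at this
    exact (hpos t).ne this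
  · have hr0 := (hpos t).ne'
    have hS : 0 < r t ^ 2 + rho t ^ 2 := by have := hpos t; positivity
    have hrpow : (r t ^ 2 + rho t ^ 2) ^ (3 / 2 : ℝ) = √(r t ^ 2 + rho t ^ 2) ^ 3 := by
      rw [Real.sqrt_eq_rpow, ← Real.rpow_mul_natCast hS.le]
      norm_num
    rw [hp, hnorm, hrpow]
    have hc1 := ((hy t).fun_mul (hθ t).cos).fun_sub
      (((hr t).fun_inv hr0).const_mul G |>.fun_mul (hθ t).sin)
    have hc2 := ((hy t).fun_mul (hθ t).sin).fun_add
      (((hr t).fun_inv hr0).const_mul G |>.fun_mul (hθ t).cos)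
    simp only [← div_eq_mul_inv] at hc1 hc2
    have hd := hasDerivAt_vec hc1 hc2
    convert! hd using 1
    have hS3 : √(r t ^ 2 + rho t ^ 2) ^ 3 ≠ 0 := by positivity
    ext i
    fin_cases i
    · simp [q, force]
      field_simp
      ring
    · simp [q, force]
      field_simp
      ring
  · rw [hp]
    have hr0 := (hpos t).ne'
    simp [q, p]
    field_simp
    linear_combination G * Real.cos_sq_add_sin_sq (θ t)
  · simpa only [hnorm] using hrT
  · simpa only [hnorm] using hrB

end RI3BP

end

theorem theorem4p11 (G₀ : ℝ) (hG₀ : 0 < G₀) :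
    ∃ Mstar > (0 : ℝ), ∃ mstar > (0 : ℝ), ∃ J ⊆ Set.Icc (-G₀) G₀,
      MeasureTheory.volume (Set.Icc (-G₀) G₀ \ J) = 0 ∧
      ∀ G ∈ J,
        -- the mountain-pass geometry occurs for every large constant
        (∀ M ≥ Mstar, ∃ ψ₁ ψ₂ : D12, IsMountainPassPair G₀ G M ψ₁ ψ₂) ∧
        -- the constrained mountain-pass level is a critical level
        (∀ M ≥ Mstar, ∀ ψ₁ ψ₂ : D12, IsMountainPassPair G₀ G M ψ₁ ψ₂ → ∀ m ≥ mstar,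
          ∃ φ : D12, IsCriticalPoint G₀ G φ ∧
            (action G₀ G φ : EReal) = mountainPassLevel G₀ G m ψ₁ ψ₂) ∧
        -- critical points are the orbits homoclinic to infinity
        (∀ r : ℝ → ℝ, (∃ y : ℝ → ℝ, IsHomoclinicOrbit G r y) ↔
          ∃ φ : D12, IsCriticalPoint G₀ G φ ∧ r = radius G₀ φ) ∧
        -- there is such an orbit, and the corresponding planar motion is doubly parabolic
        (∃ (r y : ℝ → ℝ) (q : ℝ → EuclideanSpace ℝ (Fin 2)), IsHomoclinicOrbit G r y ∧
          IsDoublyParabolicMotion G q ∧ ∀ t, ‖q t‖ = r t) := by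
  obtain ⟨Mstar, hM, hpair⟩ := exists_isMountainPassPair hG₀
  obtain ⟨J, hJ, hJ0, hcrit⟩ := exists_criticalPoint_mountainPassLevel hG₀
  -- The constraint threshold is the radius beyond which attraction dominates for every `|G| ≤ G₀`.
  refine ⟨Mstar, hM, 1 + 4 * G₀ ^ 2, by positivity, J, hJ, hJ0, fun G hG => ?_⟩
  obtain ⟨hG0, hlev⟩ := hcrit G hG
  have h1 := hpair G hG0 (sq_le_sq' (hJ hG).1 (hJ hG).2)
  have h2 : ∀ M ≥ Mstar, ∀ ψ₁ ψ₂ : D12, IsMountainPassPair G₀ G M ψ₁ ψ₂ → ∀ m ≥ 1 + 4 * G₀ ^ 2,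
      ∃ φ : D12, IsCriticalPoint G₀ G φ ∧
        (action G₀ G φ : EReal) = mountainPassLevel G₀ G m ψ₁ ψ₂ :=
    fun M hMM => hlev M (lt_of_lt_of_le hM hMM)
  refine ⟨h1, h2, fun r => ⟨?_, ?_⟩, ?_⟩
  · rintro ⟨y, hy⟩
    exact hy.exists_isCriticalPoint hG₀
  · rintro ⟨φ, hφ, rfl⟩
    exact hφ.exists_isHomoclinicOrbit hG₀
  · obtain ⟨ψ₁, ψ₂, hψ⟩ := h1 Mstar le_rfl
    obtain ⟨φ, hφ, -⟩ := h2 Mstar le_rfl ψ₁ ψ₂ hψ _ le_rfl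
    obtain ⟨y, hy⟩ := hφ.exists_isHomoclinicOrbit hG₀
    obtain ⟨q, hq1, hq2⟩ := hy.exists_isDoublyParabolicMotion
    exact ⟨_, y, q, hy, hq1, hq2⟩
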